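/- Let $N\ge 1$ be an integer, $r>1$ a real number and $x$ a complex number with $0<|x|<1$; fix a logarithm of $x$ and use it to define all powers $x^a$. Put $[a]_x=\frac{x^a-x^{-a}}{x-x^{-1}}$, $$c=[r]_x[r-1]_x(x-x^{-1}),\qquad d(z)=\frac{(1-x^{2r-1}z)(1-x^{-2r+1}z)}{(1-xz)(1-x^{-1}z)},$$ $$f_{i,j}(z)=\exp\Big(-\sum_{m\ge 1}\frac1m[(r-1)m]_x[rm]_x(x-x^{-1})^2\,\frac{[\min(i,j)m]_x\big([(N+1-\max(i,j))m]_x-[(N-\max(i,j))m]_x\big)}{[m]_x\big([(N+1)m]_x-[Nm]_x\big)}z^m\Big).$$ *Fock space.* Let $q_1=x^{2r}$, $q_2=x^{-2}$, $q_3=x^{2(1-r)}$, $s_2=x^{-1}$, $\kappa_m=\prod_{c=1}^3(1-q_c^m)$ and $a_k=x^{N-k+1/2}$. For $m\ge1$ and $1\le k\le N$ let $h^{(k)}_{\pm m}$ and $H_{\pm m}$ be bosons whose only non-zero commutators are $$[h^{(k)}_m,h^{(k)}_{-m}]=\frac{s_2^m-s_2^{-m}}{m\kappa_m},\qquad [H_m,H_{-m}]=-\frac{\kappa_m(1+s_2^m)}{m},$$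 acting on the Fock space $\mathbb C[h^{(k)}_{-m},H_{-m}]$. Put $$\Delta H_{m}=H_m+\sum_{k=1}^N\kappa_m(s_2^{-1}a_k)^{-m}h^{(k)}_m,\qquad \Delta H_{-m}=H_{-m}-\sum_{k=1}^N\kappa_ma_k^{-m}h^{(k)}_{-m}\qquad(m\ge1),$$ and let $\mathcal F$ be the quotient of the Fock space by $\sum_{m\ge1}\operatorname{im}\Delta H_{-m}$. *Basic current.* Let $u_1,\dots,u_N\in\mathbb C^\times$, and write, with all sums over $m\ge1$, $$V_k(z)=u_k\exp\Big(\sum_m\tfrac{\kappa_m}{1-q_2^m}h^{(k)}_{-m}z^m\Big)\exp\Big(\sum_m\tfrac{\kappa_ms_2^m}{1-q_2^m}h^{(k)}_mz^{-m}\Big),\quad \psi_k^\pm(z)=\exp\Big(\sum_m\kappa_mh^{(k)}_{\pm m}z^{\mp m}\Big),\quad K^\pm(z)=\exp\Big(\sum_mH_{\pm m}z^{\mp m}\Big),$$ $$\Lambda_k(z)=V_k(a_kz)\prod_{l>k}\psi_l^+(s_2^{-1}a_lz)\,K^+(z),\qquad \Lambda_{\bar k}(z)={:}V_k(a_k^{-1}z)^{-1}{:}\prod_{l>k}\psi_l^-(a_l^{-1}z)^{-1}\,K^-(z),$$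 $$\Lambda_0(z)=\exp\Big(\sum_m\tfrac{1}{1+s_2^m}H_{-m}z^m\Big)\exp\Big(\sum_m\tfrac{s_2^{-m}}{1+s_2^{-m}}H_mz^{-m}\Big).$$ The dressed currents $$\mathbf\Lambda_i(z)=\Lambda_i(z)\exp\Big(-\sum_{m\ge1}\frac{\Delta H_m}{1+x^{-(2N+1)m}}z^{-m}\Big),\qquad i=1,\dots,N,0,\bar N,\dots,\bar1,$$ commute with all $\Delta H_{-m}$, $m\ge1$, hence act on $\mathcal F$. Let $$\mathbf T_1(z)=\sum_{k=1}^N\mathbf\Lambda_k(z)+\frac{[r-\frac12]_x}{[\frac12]_x}\mathbf\Lambda_0(z)+\sum_{k=1}^N\mathbf\Lambda_{\bar k}(z).$$ *Fused currents.* Let $\mathbf T_0(z)=1$ and let $\mathbf T_i(z)=\sum_{n\in\mathbb Z}\mathbf T_{i,n}z^n$, $i\ge2$, be currents on $\mathcal F$ (linear maps $\mathcal F\to\mathcal F((z))$) such that for all $i,j\ge1$ and both signs $$\lim_{z_1\to x^{\pm(i+j)}z_2}\Big(1-\frac{x^{\pm(i+j)}z_2}{z_1}\Big)f_{i,j}\Big(\frac{z_2}{z_1}\Big)\mathbf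 T_i(z_1)\mathbf T_j(z_2)=\mp c\prod_{l=1}^{\min(i,j)-1}d(x^{2l+1})\;\mathbf T_{i+j}(x^{\pm i}z_2).$$ Here the limit is taken for every matrix coefficient and every power of $z_2$: as a Laurent series in $w=z_2/z_1$ it converges for small $w\ne0$ and is continued meromorphically to $\mathbb C^\times$. Then, as currents on $\mathcal F$, $$\mathbf T_{2N+1-i}(z)=\frac{[r-\frac12]_x}{[\frac12]_x}\prod_{k=1}^{N-i}d(x^{2k})\;\mathbf T_i(z)\qquad(0\le i\le N),$$ and $\mathbf T_i(z)=0$ for all $i\ge 2N+2$. -/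

import Mathlib

namespace DeformedW

noncomputable section

open Filter Topology

/-! ### Scalars

The complex number `x` with `0 < |x| < 1` is given together with a choice `ℓ` of its logarithm:
`x = exp ℓ`, so that `0 < |x| < 1` means `ℓ.re < 0`.  Powers of `x` are `x ^ a = exp (a * ℓ)`. -/

/-- The power `x ^ a`, where `x = exp ℓ`. -/
def pw (ℓ a : ℂ) : ℂ := Complex.exp (a * ℓ)

/-- The `q`-number `[a]_x = (x ^ a - x ^ (-a)) / (x - x⁻¹)`. -/
def qn (ℓ a : ℂ) : ℂ := (pw ℓ a - pw ℓ (-a)) / (pw ℓ 1 - pw ℓ (-1))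

/-- `s₁`, a square root of `q₁ = x ^ (2 r)`. -/
def s₁ (ℓ : ℂ) (r : ℝ) : ℂ := -pw ℓ r

/-- `s₂ = x⁻¹`, a square root of `q₂ = x ^ (-2)`. -/
def s₂ (ℓ : ℂ) : ℂ := pw ℓ (-1)

/-- `s₃`, a square root of `q₃ = x ^ (2 (1 - r))`.  The signs of `s₁` and `s₃` are such that
`s₁ s₂ s₃ = 1` and that `k₂ᴮ / b₂ = [r - 1/2]_x / [1/2]_x`. -/
def s₃ (ℓ : ℂ) (r : ℝ) : ℂ := -pw ℓ (1 - r)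

/-- `q₁ = x ^ (2 r)`. -/
def q₁ (ℓ : ℂ) (r : ℝ) : ℂ := pw ℓ (2 * r)

/-- `q₂ = x ^ (-2)`. -/
def q₂ (ℓ : ℂ) : ℂ := pw ℓ (-2)

/-- `q₃ = x ^ (2 (1 - r))`. -/
def q₃ (ℓ : ℂ) (r : ℝ) : ℂ := pw ℓ (2 * (1 - r))

/-- `κ_m = (1 - q₁ ^ m) (1 - q₂ ^ m) (1 - q₃ ^ m)`. -/
def kap (ℓ : ℂ) (r : ℝ) (m : ℕ) : ℂ := (1 - q₁ ℓ r ^ m) * (1 - q₂ ℓ ^ m) * (1 - q₃ ℓ r ^ m)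

/-- `b₂ = -(s₂ - s₂⁻¹) / κ₁`. -/
def b₂ (ℓ : ℂ) (r : ℝ) : ℂ := -(s₂ ℓ - (s₂ ℓ)⁻¹) / kap ℓ r 1

/-- `k₂ᴮ = (1 + s₂) (s₃ - s₁) / κ₁`. -/
def k₂B (ℓ : ℂ) (r : ℝ) : ℂ := (1 + s₂ ℓ) * (s₃ ℓ r - s₁ ℓ r) / kap ℓ r 1

/-- The spectral shifts `a_k = x ^ (N - k + 1/2)`, `1 ≤ k ≤ N`; here `k = j + 1`. -/
def av (N : ℕ) (ℓ : ℂ) (j : Fin N) : ℂ := pw ℓ (N - ((j : ℕ) + 1) + 1 / 2)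

/-- `c(x, r) = [r]_x [r - 1]_x (x - x⁻¹)`. -/
def cst (ℓ : ℂ) (r : ℝ) : ℂ := qn ℓ r * qn ℓ (r - 1) * (pw ℓ 1 - pw ℓ (-1))

/-- `d(z) = (1 - x ^ (2r-1) z) (1 - x ^ (-2r+1) z) / ((1 - x z) (1 - x⁻¹ z))`. -/
def dfun (ℓ : ℂ) (r : ℝ) (z : ℂ) : ℂ :=
  ((1 - pw ℓ (2 * r - 1) * z) * (1 - pw ℓ (-2 * r + 1) * z)) /
    ((1 - pw ℓ 1 * z) * (1 - pw ℓ (-1) * z))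

/-- `exp (∑_{m ≥ 1} g m z ^ m)` as a formal power series (the value `g 0` is not used). -/
def expSeries {A : Type*} [CommRing A] [Algebra ℂ A] (g : ℕ → A) : PowerSeries A :=
  PowerSeries.mk fun n =>
    ∑ k ∈ Finset.range (n + 1), ((k.factorial : ℂ)⁻¹) •
      PowerSeries.coeff n ((PowerSeries.mk fun m => if m = 0 then 0 else g m) ^ k)

/-- The structure function `f_{i,j}(z)`. -/
def fser (N : ℕ) (ℓ : ℂ) (r : ℝ) (i j : ℕ) : PowerSeries ℂ :=
  expSeries fun m : ℕ =>
    -((1 / (m : ℂ)) * qn ℓ ((r - 1) * m) * qn ℓ (r * m) * (pw ℓ 1 - pw ℓ (-1)) ^ 2 *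
      ((qn ℓ ((min i j : ℕ) * m) *
          (qn ℓ (((N : ℂ) + 1 - (max i j : ℕ)) * m) - qn ℓ (((N : ℂ) - (max i j : ℕ)) * m))) /
        (qn ℓ m * (qn ℓ (((N : ℂ) + 1) * m) - qn ℓ ((N : ℂ) * m)))))

/-! ### The Fock space

The bosons are indexed by `Option (Fin N)`: `some j` is the Heisenberg algebra `h_m` acting on the
`(j+1)`-st Fock module of colour 2, `none` is the Heisenberg algebra `H_m` acting on the boundary
Fock module of colour 2.  Creation operators are multiplications by the variables
`X (b, m)`, `m ≥ 1`. -/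

/-- The tensor product of the `N` Fock modules and of the boundary Fock module. -/
abbrev FullFock (N : ℕ) : Type := MvPolynomial (Option (Fin N) × ℕ+) ℂ

/-- The central value of the commutator `[b_m, b_{-m}]` for `m ≥ 1`: `(s₂ ^ m - s₂ ^ (-m)) / (m κ_m)`
for `h`, and `-κ_m (1 + s₂ ^ m) / m` for `H`. -/
def br (N : ℕ) (ℓ : ℂ) (r : ℝ) : Option (Fin N) → ℕ → ℂ
  | some _, m => (s₂ ℓ ^ m - (s₂ ℓ)⁻¹ ^ m) / ((m : ℂ) * kap ℓ r m)
  | none, m => -(kap ℓ r m * (1 + s₂ ℓ ^ m)) / m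

/-- The exponents of a normally ordered exponential of the bosons: the vertex operator
`const * exp (∑_{b, m ≥ 1} cr b m * b_{-m} z ^ m) * exp (∑_{b, m ≥ 1} an b m * b_m z ^ (-m))`. -/
structure VOData (N : ℕ) where
  const : ℂ
  cr : Option (Fin N) → ℕ → ℂ
  an : Option (Fin N) → ℕ → ℂ

/-- The exponents of `Δ K^-(z) = exp (∑_{m ≥ 1} Δ H_{-m} z ^ m)`, which is
`ψ^-(a_1⁻¹ z)⁻¹ ⊗ ⋯ ⊗ ψ^-(a_N⁻¹ z)⁻¹ ⊗ K^-(z)`. -/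
def dHcr (N : ℕ) (ℓ : ℂ) (r : ℝ) : Option (Fin N) → ℕ → ℂ
  | some l, m => -(kap ℓ r m * (av N ℓ l)⁻¹ ^ m)
  | none, _ => 1

/-- The exponents of `Δ K^+(z) = exp (∑_{m ≥ 1} Δ H_m z ^ (-m))`, which is
`ψ^+(s₂⁻¹ a_1 z) ⊗ ⋯ ⊗ ψ^+(s₂⁻¹ a_N z) ⊗ K^+(z)`. -/
def dHan (N : ℕ) (ℓ : ℂ) (r : ℝ) : Option (Fin N) → ℕ → ℂ
  | some l, m => kap ℓ r m * ((s₂ ℓ)⁻¹ * av N ℓ l)⁻¹ ^ m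
  | none, _ => 1

/-- The exponents of `Δ K_μ^+(z)`, the solution of `K_μ^+(z) K_μ^+(x ^ (2N+1) z) = K^+(z)`, that is
`Δ K_μ^+(z) = exp (∑_{m ≥ 1} (1 + x ^ (-(2N+1) m))⁻¹ Δ H_m z ^ (-m))`. -/
def dKmu (N : ℕ) (ℓ : ℂ) (r : ℝ) (b : Option (Fin N)) (m : ℕ) : ℂ :=
  (1 + pw ℓ (-((2 * (N : ℂ) + 1) * m)))⁻¹ * dHan N ℓ r b m

/-- `Λ_k(z) = 1 ⊗ ⋯ ⊗ V₂(a_k z; u_k) ⊗ ψ^+(s₂⁻¹ a_{k+1} z) ⊗ ⋯ ⊗ ψ^+(s₂⁻¹ a_N z) ⊗ K^+(z)`. -/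
def lamPlus (N : ℕ) (ℓ : ℂ) (r : ℝ) (u : Fin N → ℂ) (k : Fin N) : VOData N where
  const := u k
  cr
    | some l, m => if l = k then kap ℓ r m / (1 - q₂ ℓ ^ m) * av N ℓ k ^ m else 0
    | none, _ => 0
  an
    | some l, m =>
        if l = k then kap ℓ r m / (1 - q₂ ℓ ^ m) * s₂ ℓ ^ m * (av N ℓ k)⁻¹ ^ m
        else if k < l then kap ℓ r m * ((s₂ ℓ)⁻¹ * av N ℓ l)⁻¹ ^ m
        else 0
    | none, _ => 1

/-- `Λ_0(z) = 1 ⊗ ⋯ ⊗ 1 ⊗ :K̃₂^-(z) K̃₂^+(s₂ z):`. -/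
def lamZero (N : ℕ) (ℓ : ℂ) : VOData N where
  const := 1
  cr
    | some _, _ => 0
    | none, m => (1 + s₂ ℓ ^ m)⁻¹
  an
    | some _, _ => 0
    | none, m => (1 + (s₂ ℓ)⁻¹ ^ m)⁻¹ * (s₂ ℓ)⁻¹ ^ m

/-- `Λ_k̄(z) = 1 ⊗ ⋯ ⊗ :V₂(a_k⁻¹ z; u_k)⁻¹: ⊗ ψ^-(a_{k+1}⁻¹ z)⁻¹ ⊗ ⋯ ⊗ ψ^-(a_N⁻¹ z)⁻¹ ⊗ K^-(z)`. -/
def lamMinus (N : ℕ) (ℓ : ℂ) (r : ℝ) (u : Fin N → ℂ) (k : Fin N) : VOData N where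
  const := (u k)⁻¹
  cr
    | some l, m =>
        if l = k then -(kap ℓ r m / (1 - q₂ ℓ ^ m) * (av N ℓ k)⁻¹ ^ m)
        else if k < l then -(kap ℓ r m * (av N ℓ l)⁻¹ ^ m)
        else 0
    | none, _ => 1
  an
    | some l, m =>
        if l = k then -(kap ℓ r m / (1 - q₂ ℓ ^ m) * s₂ ℓ ^ m * av N ℓ k ^ m) else 0
    | none, _ => 0

/-- The dressed current `Λ(z) * Δ K_μ^+(z)⁻¹`. -/
def VOData.dressed {N : ℕ} (E : VOData N) (ℓ : ℂ) (r : ℝ) : VOData N where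
  const := E.const
  cr := E.cr
  an b m := E.an b m - dKmu N ℓ r b m

/-- The creation operator `Δ H_{-m}`, `m ≥ 1` (acting by multiplication). -/
def dH (N : ℕ) (ℓ : ℂ) (r : ℝ) (m : ℕ+) : FullFock N :=
  ∑ b : Option (Fin N), MvPolynomial.C (dHcr N ℓ r b m) * MvPolynomial.X (b, m)

/-- The subspace `∑_{m ≥ 1} Δ H_{-m} 𝓕` of the full Fock space. -/
def dHIdeal (N : ℕ) (ℓ : ℂ) (r : ℝ) : Ideal (FullFock N) := Ideal.span (Set.range (dH N ℓ r))

/-- The Fock space on which the `W`-currents act: the full Fock space modulo the images of the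
operators `Δ H_{-m}`, `m ≥ 1`, with which the dressed currents commute. -/
def Fock (N : ℕ) (ℓ : ℂ) (r : ℝ) : Type := FullFock N ⧸ dHIdeal N ℓ r

instance instCommRingFock (N : ℕ) (ℓ : ℂ) (r : ℝ) : CommRing (Fock N ℓ r) :=
  inferInstanceAs (CommRing (FullFock N ⧸ dHIdeal N ℓ r))

instance instAlgebraFock (N : ℕ) (ℓ : ℂ) (r : ℝ) : Algebra ℂ (Fock N ℓ r) :=
  inferInstanceAs (Algebra ℂ (FullFock N ⧸ dHIdeal N ℓ r))

/-- The projection of the full Fock space. -/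
def toFock (N : ℕ) (ℓ : ℂ) (r : ℝ) : FullFock N →+* Fock N ℓ r :=
  Ideal.Quotient.mk (dHIdeal N ℓ r)

/-- `[E(z), Δ H_{-m}] = 0` for all `m ≥ 1`. -/
def VOData.Commutes {N : ℕ} (E : VOData N) (ℓ : ℂ) (r : ℝ) : Prop :=
  ∀ m : ℕ+, ∑ b : Option (Fin N), dHcr N ℓ r b m * (E.an b m * br N ℓ r b m) = 0

/-- The embedding of the scalars into the Laurent series over the Fock space. -/
def scal (N : ℕ) (ℓ : ℂ) (r : ℝ) : ℂ →+* LaurentSeries (Fock N ℓ r) :=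
  (HahnSeries.C : Fock N ℓ r →+* LaurentSeries (Fock N ℓ r)).comp (algebraMap ℂ (Fock N ℓ r))

/-- The action of `exp (∑_{b, m} an b m * b_m z ^ (-m))`: since `[b_m, b_{-m}]` is central, it is the
translation `b_{-m} ↦ b_{-m} + an b m * [b_m, b_{-m}] z ^ (-m)` of the variables. -/
def VOData.shift {N : ℕ} (E : VOData N) (ℓ : ℂ) (r : ℝ) :
    FullFock N →+* LaurentSeries (Fock N ℓ r) :=
  MvPolynomial.eval₂Hom (scal N ℓ r) fun p : Option (Fin N) × ℕ+ =>
    HahnSeries.C (toFock N ℓ r (MvPolynomial.X p)) +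
      HahnSeries.single (-((p.2 : ℕ) : ℤ))
        (algebraMap ℂ (Fock N ℓ r) (E.an p.1 p.2 * br N ℓ r p.1 p.2))

theorem VOData.shift_eq_zero {N : ℕ} {E : VOData N} {ℓ : ℂ} {r : ℝ} (hE : E.Commutes ℓ r)
    (a : FullFock N) (ha : a ∈ dHIdeal N ℓ r) : E.shift ℓ r a = 0 := by
  have hle : dHIdeal N ℓ r ≤ RingHom.ker (E.shift ℓ r) := by
    refine Ideal.span_le.2 ?_
    rintro _ ⟨m, rfl⟩
    have h0 : toFock N ℓ r (dH N ℓ r m) = 0 :=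
      Ideal.Quotient.eq_zero_iff_mem.2 (Ideal.subset_span ⟨m, rfl⟩)
    have h1 : ∀ c : ℂ, toFock N ℓ r (MvPolynomial.C c) =
        algebraMap ℂ (Fock N ℓ r) c := fun _ => rfl
    simp only [dH, map_sum, map_mul, h1] at h0
    have h2 : ∀ b : Option (Fin N),
        E.shift ℓ r (MvPolynomial.C (dHcr N ℓ r b m) * MvPolynomial.X (b, m)) =
          HahnSeries.C (algebraMap ℂ (Fock N ℓ r) (dHcr N ℓ r b m) *
            toFock N ℓ r (MvPolynomial.X (b, m))) +
          HahnSeries.single (-((m : ℕ) : ℤ)) (algebraMap ℂ (Fock N ℓ r)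
            (dHcr N ℓ r b m * (E.an b m * br N ℓ r b m))) := by
      intro b
      rw [map_mul, VOData.shift, MvPolynomial.coe_eval₂Hom, MvPolynomial.eval₂_C,
        MvPolynomial.eval₂_X, scal, RingHom.comp_apply, mul_add, ← map_mul]
      congr 1
      rw [HahnSeries.C_apply, HahnSeries.single_mul_single, zero_add,
        ← map_mul (algebraMap ℂ (Fock N ℓ r))]
    have h3 := hE m
    have h4 : ∑ b : Option (Fin N), HahnSeries.single (-((m : ℕ) : ℤ)) (algebraMap ℂ (Fock N ℓ r)
        (dHcr N ℓ r b m * (E.an b m * br N ℓ r b m))) = 0 := by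
      ext n
      rw [HahnSeries.coeff_sum]
      by_cases hn : n = -((m : ℕ) : ℤ)
      · subst hn
        simp only [HahnSeries.coeff_single_same, HahnSeries.coeff_zero]
        rw [← map_sum, h3, map_zero]
      · simp [HahnSeries.coeff_single_of_ne hn]
    rw [SetLike.mem_coe, RingHom.mem_ker, dH, map_sum]
    simp only [h2]
    rw [Finset.sum_add_distrib, h4, ← map_sum, h0, map_zero, add_zero]
  exact hle ha

/-- The creation part `exp (∑_{b, m} cr b m * b_{-m} z ^ m)`. -/
def VOData.creation {N : ℕ} (E : VOData N) (ℓ : ℂ) (r : ℝ) : PowerSeries (Fock N ℓ r) :=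
  expSeries fun m : ℕ =>
    if h : 0 < m then
      ∑ b : Option (Fin N), E.cr b m •
        toFock N ℓ r (MvPolynomial.X (b, (⟨m, h⟩ : ℕ+)))
    else 0

/-- The annihilation part `exp (∑_{b, m} an b m * b_m z ^ (-m))` on the Fock space. -/
def VOData.annihilation {N : ℕ} (E : VOData N) (ℓ : ℂ) (r : ℝ) (hE : E.Commutes ℓ r) :
    Fock N ℓ r →+* LaurentSeries (Fock N ℓ r) :=
  Ideal.Quotient.lift (dHIdeal N ℓ r) (E.shift ℓ r) (VOData.shift_eq_zero hE)

/-- The vertex operator with exponents `E`, acting on the Fock space. -/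
def VOData.toVertexOperator {N : ℕ} (E : VOData N) (ℓ : ℂ) (r : ℝ) (hE : E.Commutes ℓ r) :
    VertexOperator ℂ (Fock N ℓ r) where
  toFun v := HahnModule.of ℂ (scal N ℓ r E.const *
    (HahnSeries.ofPowerSeries ℤ (Fock N ℓ r) (E.creation ℓ r) *
      E.annihilation ℓ r hE v))
  map_add' v w := by
    rw [map_add, mul_add, mul_add]; rfl
  map_smul' c v := by
    have h : E.annihilation ℓ r hE (c • v) = scal N ℓ r c * E.annihilation ℓ r hE v := by
      rw [Algebra.smul_def, map_mul]
      congr 1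
      exact MvPolynomial.eval₂_C _ _ _
    have h' : ∀ y : LaurentSeries (Fock N ℓ r), HahnModule.of ℂ (scal N ℓ r c * y) =
        c • HahnModule.of ℂ y := by
      intro y
      ext n
      change (HahnSeries.C (algebraMap ℂ (Fock N ℓ r) c) * y).coeff n = c • y.coeff n
      rw [HahnSeries.C_mul_eq_smul, HahnSeries.coeff_smul, algebraMap_smul]
    rw [h, mul_left_comm _ (scal N ℓ r c), mul_left_comm _ (scal N ℓ r c), h', RingHom.id_apply]

theorem pw_add (ℓ a b : ℂ) : pw ℓ (a + b) = pw ℓ a * pw ℓ b := by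
  simp [pw, add_mul, Complex.exp_add]

theorem pw_ne_zero (ℓ a : ℂ) : pw ℓ a ≠ 0 := Complex.exp_ne_zero _

theorem pw_neg (ℓ a : ℂ) : pw ℓ (-a) = (pw ℓ a)⁻¹ := by
  simp [pw, Complex.exp_neg]

theorem pw_pow (ℓ a : ℂ) (m : ℕ) : pw ℓ a ^ m = pw ℓ (a * m) := by
  rw [pw, pw, ← Complex.exp_nat_mul]; ring_nf

theorem pw_ne_of_re {ℓ : ℂ} (hℓ : ℓ.re < 0) {a b : ℝ} (h : a ≠ b) :
    ‖pw ℓ a‖ ≠ ‖pw ℓ b‖ := by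
  simp only [pw, Complex.norm_exp, Complex.re_ofReal_mul]
  intro h'
  exact h (mul_right_cancel₀ hℓ.ne (Real.exp_injective h'))

theorem one_add_pw_ne_zero {ℓ : ℂ} (hℓ : ℓ.re < 0) {a : ℝ} (h : a ≠ 0) : 1 + pw ℓ a ≠ 0 := by
  intro h'
  have h1 : pw ℓ a = -pw ℓ (0 : ℝ) := by
    have : pw ℓ (0 : ℝ) = 1 := by simp [pw]
    rw [this]; linear_combination h'
  exact pw_ne_of_re hℓ h (by rw [h1, norm_neg])

theorem one_sub_pw_ne_zero {ℓ : ℂ} (hℓ : ℓ.re < 0) {a : ℝ} (h : a ≠ 0) : 1 - pw ℓ a ≠ 0 := by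
  intro h'
  have h1 : pw ℓ a = pw ℓ (0 : ℝ) := by
    have : pw ℓ (0 : ℝ) = 1 := by simp [pw]
    rw [this]; linear_combination -h'
  exact pw_ne_of_re hℓ h (by rw [h1])

theorem kap_ne_zero {ℓ : ℂ} (hℓ : ℓ.re < 0) {r : ℝ} (hr : 1 < r) (m : ℕ+) : kap ℓ r m ≠ 0 := by
  have hm : (0 : ℝ) < (m : ℕ) := by exact_mod_cast m.pos
  unfold kap q₁ q₂ q₃
  rw [pw_pow, pw_pow, pw_pow]
  refine mul_ne_zero (mul_ne_zero ?_ ?_) ?_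
  · have := one_sub_pw_ne_zero hℓ (a := 2 * r * (m : ℕ)) (by positivity)
    push_cast at this; exact this
  · have := one_sub_pw_ne_zero hℓ (a := -2 * (m : ℕ)) (by linarith)
    push_cast at this; exact this
  · have := one_sub_pw_ne_zero hℓ (a := 2 * (1 - r) * (m : ℕ)) (by nlinarith)
    push_cast at this; exact this

/-- The exponents `x ^ (-(2 (N - j) + 1) m)`. -/
def ev (N : ℕ) (ℓ : ℂ) (m j : ℕ) : ℂ := pw ℓ (-((2 * ((N : ℂ) - j) + 1) * m))

theorem ev_last (N : ℕ) (ℓ : ℂ) (m : ℕ) : ev N ℓ m N = s₂ ℓ ^ m := by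
  rw [ev, s₂, pw_pow]; congr 1; ring

theorem av_sq (N : ℕ) (ℓ : ℂ) (m : ℕ) (l : Fin N) :
    (av N ℓ l)⁻¹ ^ m * (av N ℓ l)⁻¹ ^ m = ev N ℓ m (l + 1) := by
  rw [ev, av, ← pw_neg, pw_pow, ← pw_add]; congr 1; push_cast; ring

theorem av_sq_s₂ (N : ℕ) (ℓ : ℂ) (m : ℕ) (l : Fin N) :
    ev N ℓ m (l + 1) * (s₂ ℓ ^ m * s₂ ℓ ^ m) = ev N ℓ m l := by
  rw [ev, ev, s₂, pw_pow, ← pw_add, ← pw_add]; congr 1; push_cast; ring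

theorem s₂_ne_zero (ℓ : ℂ) : s₂ ℓ ≠ 0 := pw_ne_zero _ _

theorem term_psi (N : ℕ) {ℓ : ℂ} (hℓ : ℓ.re < 0) {r : ℝ} (hr : 1 < r) (m : ℕ+) (l : Fin N) :
    dHcr N ℓ r (some l) m *
      ((kap ℓ r m * ((s₂ ℓ)⁻¹ * av N ℓ l)⁻¹ ^ (m : ℕ)) * br N ℓ r (some l) m) =
    -(kap ℓ r m / m) * (ev N ℓ m l - ev N ℓ m (l + 1)) := by
  have hk := kap_ne_zero hℓ hr m
  have hs := s₂_ne_zero ℓ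
  have hm : ((m : ℕ) : ℂ) ≠ 0 := by exact_mod_cast m.pos.ne'
  rw [← av_sq_s₂, ← av_sq]
  simp only [dHcr, br, mul_inv, mul_pow, inv_inv, inv_pow]
  have ha : av N ℓ l ≠ 0 := pw_ne_zero _ _
  field_simp

theorem sum_dHan (N : ℕ) {ℓ : ℂ} (hℓ : ℓ.re < 0) {r : ℝ} (hr : 1 < r) (m : ℕ+) :
    ∑ b : Option (Fin N), dHcr N ℓ r b m * (dHan N ℓ r b m * br N ℓ r b m) =
      -(kap ℓ r m / m) * (1 + pw ℓ (-((2 * (N : ℂ) + 1) * (m : ℕ)))) := by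
  rw [Fintype.sum_option]
  simp only [dHan, term_psi N hℓ hr m]
  rw [← Finset.mul_sum, Fin.sum_univ_eq_sum_range (fun l => ev N ℓ m l - ev N ℓ m (l + 1)),
    Finset.sum_range_sub', ev_last]
  simp only [dHcr, br, ev, Nat.cast_zero, sub_zero]
  ring

theorem dressed_commutes {N : ℕ} {ℓ : ℂ} (hℓ : ℓ.re < 0) {r : ℝ} (hr : 1 < r) (E : VOData N)
    (h : ∀ m : ℕ+, ∑ b : Option (Fin N), dHcr N ℓ r b m * (E.an b m * br N ℓ r b m) =
      -(kap ℓ r m / m)) : (E.dressed ℓ r).Commutes ℓ r := by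
  intro m
  have hD : 1 + pw ℓ (-((2 * (N : ℂ) + 1) * (m : ℕ))) ≠ 0 := by
    have hm : (0 : ℝ) < (m : ℕ) := by exact_mod_cast m.pos
    have := one_add_pw_ne_zero hℓ (a := -((2 * (N : ℝ) + 1) * (m : ℕ))) (by
      have : 0 < (2 * (N : ℝ) + 1) * (m : ℕ) := by positivity
      linarith)
    push_cast at this; exact this
  have h1 := sum_dHan N hℓ hr m
  have h2 : ∀ b : Option (Fin N),
      dHcr N ℓ r b m * ((E.dressed ℓ r).an b m * br N ℓ r b m) =
        dHcr N ℓ r b m * (E.an b m * br N ℓ r b m) -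
          (1 + pw ℓ (-((2 * (N : ℂ) + 1) * (m : ℕ))))⁻¹ *
            (dHcr N ℓ r b m * (dHan N ℓ r b m * br N ℓ r b m)) := by
    intro b; simp only [VOData.dressed, dKmu]; ring
  simp only [h2, Finset.sum_sub_distrib, ← Finset.mul_sum, h m, h1]
  rw [mul_left_comm, inv_mul_cancel₀ hD]
  ring

theorem lamZero_commutes (N : ℕ) {ℓ : ℂ} (hℓ : ℓ.re < 0) {r : ℝ} (hr : 1 < r) :
    ((lamZero N ℓ).dressed ℓ r).Commutes ℓ r := by
  refine dressed_commutes hℓ hr _ fun m => ?_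
  have hs := s₂_ne_zero ℓ
  have hm : (0 : ℝ) < (m : ℕ) := by exact_mod_cast m.pos
  have h1 : 1 + s₂ ℓ ^ (m : ℕ) ≠ 0 := by
    have := one_add_pw_ne_zero hℓ (a := -1 * (m : ℕ)) (by linarith)
    push_cast at this; rw [s₂, pw_pow]; exact this
  have h2 : 1 + (s₂ ℓ)⁻¹ ^ (m : ℕ) = (s₂ ℓ)⁻¹ ^ (m : ℕ) * (1 + s₂ ℓ ^ (m : ℕ)) := by
    rw [mul_add, ← mul_pow, inv_mul_cancel₀ hs]; ring
  rw [Fintype.sum_option]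
  simp only [lamZero, zero_mul, mul_zero, Finset.sum_const_zero, add_zero, dHcr, br, h2]
  field_simp

theorem one_sub_q₂_ne_zero {ℓ : ℂ} (hℓ : ℓ.re < 0) (m : ℕ+) : 1 - q₂ ℓ ^ (m : ℕ) ≠ 0 := by
  have hm : (0 : ℝ) < (m : ℕ) := by exact_mod_cast m.pos
  have := one_sub_pw_ne_zero hℓ (a := -2 * (m : ℕ)) (by linarith)
  push_cast at this; rw [q₂, pw_pow]; exact this

theorem q₂_eq (ℓ : ℂ) (m : ℕ) : q₂ ℓ ^ m = s₂ ℓ ^ m * s₂ ℓ ^ m := by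
  rw [q₂, s₂, pw_pow, pw_pow, ← pw_add]; congr 1; ring

theorem lamMinus_commutes (N : ℕ) {ℓ : ℂ} (hℓ : ℓ.re < 0) {r : ℝ} (hr : 1 < r) (u : Fin N → ℂ)
    (k : Fin N) : ((lamMinus N ℓ r u k).dressed ℓ r).Commutes ℓ r := by
  refine dressed_commutes hℓ hr _ fun m => ?_
  have hk := kap_ne_zero hℓ hr m
  have hs := s₂_ne_zero ℓ
  have ha : av N ℓ k ≠ 0 := pw_ne_zero _ _
  have hm : ((m : ℕ) : ℂ) ≠ 0 := by exact_mod_cast m.pos.ne'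
  have hq := one_sub_q₂_ne_zero hℓ m
  rw [q₂_eq] at hq
  rw [Fintype.sum_option, Finset.sum_eq_single k]
  · simp only [lamMinus, if_true, dHcr, br, q₂_eq, inv_pow]
    have hq' : 1 - (s₂ ℓ ^ (m : ℕ)) ^ 2 ≠ 0 := by rwa [sq]
    field_simp
    ring
  · intro l _ hl
    simp [lamMinus, hl]
  · simp

theorem lamPlus_commutes (N : ℕ) {ℓ : ℂ} (hℓ : ℓ.re < 0) {r : ℝ} (hr : 1 < r) (u : Fin N → ℂ)
    (k : Fin N) : ((lamPlus N ℓ r u k).dressed ℓ r).Commutes ℓ r := by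
  refine dressed_commutes hℓ hr _ fun m => ?_
  have hk := kap_ne_zero hℓ hr m
  have hs := s₂_ne_zero ℓ
  have hm : ((m : ℕ) : ℂ) ≠ 0 := by exact_mod_cast m.pos.ne'
  have hq := one_sub_q₂_ne_zero hℓ m
  let g : ℕ → ℂ := fun j => if j ≤ (k : ℕ) then 0 else ev N ℓ m j
  have key : ∀ l : Fin N, dHcr N ℓ r (some l) m *
      ((lamPlus N ℓ r u k).an (some l) m * br N ℓ r (some l) m) =
      -(kap ℓ r m / m) * (g l - g (l + 1)) := by
    intro l
    rcases lt_trichotomy l k with h | h | h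
    · have h1 : (l : ℕ) ≤ k := by omega
      have h2 : (l : ℕ) + 1 ≤ k := by omega
      simp [lamPlus, h.ne, h.not_gt, g, h1, h2]
    · subst h
      have h2 : ¬ (l : ℕ) + 1 ≤ l := by omega
      simp only [lamPlus, g, if_true, le_refl, h2, if_false]
      rw [← av_sq]
      rw [q₂_eq] at hq ⊢
      simp only [dHcr, br, inv_pow]
      have ha : av N ℓ l ≠ 0 := pw_ne_zero _ _
      have hq' : 1 - (s₂ ℓ ^ (m : ℕ)) ^ 2 ≠ 0 := by rwa [sq]
      field_simp
      ring
    · have h1 : ¬ (l : ℕ) ≤ k := by omega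
      have h2 : ¬ (l : ℕ) + 1 ≤ k := by omega
      simp only [lamPlus, g, h.ne', h, h1, h2, if_false, if_true]
      exact term_psi N hℓ hr m l
  rw [Fintype.sum_option]
  simp only [key]
  rw [← Finset.mul_sum, Fin.sum_univ_eq_sum_range (fun l => g l - g (l + 1)),
    Finset.sum_range_sub']
  have h3 : ¬ N ≤ (k : ℕ) := by omega
  simp only [g, h3, Nat.zero_le, if_true, if_false, ev_last, lamPlus, dHcr, br]
  ring

/-- The basic `W`-current `T₁(z) = ∑_k 𝚲_k(z) + (k₂ᴮ / b₂) 𝚲_0(z) + ∑_k 𝚲_k̄(z)`. -/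
def basicCurrent (N : ℕ) {ℓ : ℂ} (hℓ : ℓ.re < 0) {r : ℝ} (hr : 1 < r) (u : Fin N → ℂ) :
    VertexOperator ℂ (Fock N ℓ r) :=
  ∑ k : Fin N,
      ((lamPlus N ℓ r u k).dressed ℓ r).toVertexOperator ℓ r (lamPlus_commutes N hℓ hr u k) +
    (k₂B ℓ r / b₂ ℓ r) •
      ((lamZero N ℓ).dressed ℓ r).toVertexOperator ℓ r (lamZero_commutes N hℓ hr) +
    ∑ k : Fin N,
      ((lamMinus N ℓ r u k).dressed ℓ r).toVertexOperator ℓ r (lamMinus_commutes N hℓ hr u k)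

/-- The constant `k₂ᴮ / b₂` is `[r - 1/2]_x / [1/2]_x`. -/
theorem k₂B_div_b₂ {ℓ : ℂ} (hℓ : ℓ.re < 0) {r : ℝ} (hr : 1 < r) :
    k₂B ℓ r / b₂ ℓ r = qn ℓ (r - 1 / 2) / qn ℓ (1 / 2) := by
  have hk : kap ℓ r 1 ≠ 0 := kap_ne_zero hℓ hr 1
  have h1 : 1 - pw ℓ 1 ≠ 0 := by
    have := one_sub_pw_ne_zero hℓ (a := 1) one_ne_zero
    simpa using this
  have h2 : 1 + pw ℓ 1 ≠ 0 := by
    have := one_add_pw_ne_zero hℓ (a := 1) one_ne_zero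
    simpa using this
  have hp : pw ℓ (1 / 2) * pw ℓ (1 / 2) = pw ℓ 1 := by rw [← pw_add]; norm_num
  set p := pw ℓ (1 / 2) with hpdef
  set y := pw ℓ (r - 1 / 2) with hy
  have hp0 : p ≠ 0 := pw_ne_zero _ _
  have hy0 : y ≠ 0 := pw_ne_zero _ _
  have e1 : pw ℓ r = y * p := by rw [hy, hpdef, ← pw_add]; congr 1; ring
  have e2 : pw ℓ (1 - r) = y⁻¹ * p := by rw [hy, ← pw_neg, hpdef, ← pw_add]; congr 1; ring
  have e3 : pw ℓ (-(r - 1 / 2)) = y⁻¹ := by rw [pw_neg]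
  have e4 : pw ℓ (-(1 / 2)) = p⁻¹ := by rw [pw_neg]
  have e5 : pw ℓ (-1) = (p * p)⁻¹ := by rw [pw_neg, hp]
  rw [← hp] at h1 h2
  have h3 : p - p⁻¹ ≠ 0 := by
    intro h; apply h1; field_simp at h; linear_combination -h
  have h4 : p * p - (p * p)⁻¹ ≠ 0 := by
    intro h
    have : (1 - p * p) * (1 + p * p) = 0 := by field_simp at h; linear_combination -h
    exact mul_ne_zero h1 h2 this
  have h5 : (p * p)⁻¹ - p * p ≠ 0 := fun h => h4 (by linear_combination -h)
  have h6 : -((p * p)⁻¹ - ((p * p)⁻¹)⁻¹) ≠ 0 := by rw [inv_inv]; exact neg_ne_zero.2 h5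
  simp only [k₂B, b₂, qn, s₁, s₂, s₃, e1, e2, e3, e4, e5, ← hp]
  rw [← hy, div_div_div_cancel_right₀ hk, div_div_div_cancel_right₀ h4, div_eq_div_iff h6 h3]
  clear_value y p
  field_simp
  ring

/-! ### Fusion -/

/-- Put `w = z₂ / z₁`.  The matrix coefficient of `f(z₂ / z₁) A(z₁) B(z₂)` between the vector `v` and
the functional `φ` is `∑_n z₂ ^ n ∑_l (prodCoeff f A B v φ n l) w ^ l`.  The sum that defines the
coefficient is finite, since `B(z) v` is a Laurent series. -/
def prodCoeff {V : Type*} [AddCommGroup V] [Module ℂ V] (f : PowerSeries ℂ)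
    (A B : VertexOperator ℂ V) (v : V) (φ : Module.Dual ℂ V) (n l : ℤ) : ℂ :=
  ∑ᶠ k : ℕ, PowerSeries.coeff k f *
    φ (HVertexOperator.coeff A (k - l) (HVertexOperator.coeff B (n + l - k) v))

/-- The Laurent series `∑_l G l w ^ l` converges for all small `w ≠ 0`, its sum continues to a
meromorphic function `Φ` on `ℂ \ {0}`, and `(1 - w / w₀) Φ(w) → L` as `w → w₀`. -/
def HasFusionLimit (G : ℤ → ℂ) (w₀ L : ℂ) : Prop :=
  ∃ Φ : ℂ → ℂ, MeromorphicOn Φ {0}ᶜ ∧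
    (∀ᶠ w in 𝓝[≠] (0 : ℂ), HasSum (fun l : ℤ => G l * w ^ l) (Φ w)) ∧
    Tendsto (fun w => (1 - w / w₀) * Φ w) (𝓝[≠] w₀) (𝓝 L)

/-- The family `T_i(z)`, `i ∈ ℕ`, consists of the `W`-currents: `T_0(z) = 1`, `T_1(z)` is the basic
current, and for all `i, j ≥ 1` and both signs `ε`
`lim_{z₁ → x ^ (ε (i + j)) z₂} (1 - x ^ (ε (i + j)) z₂ / z₁) f_{i,j}(z₂ / z₁) T_i(z₁) T_j(z₂)`
`= -ε c(x, r) ∏_{l = 1}^{min(i,j) - 1} d(x ^ (2 l + 1)) T_{i+j}(x ^ (ε i) z₂)`,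
as an identity of all matrix coefficients of all coefficients of powers of `z₂`. -/
structure IsWCurrents (N : ℕ) {ℓ : ℂ} (hℓ : ℓ.re < 0) {r : ℝ} (hr : 1 < r) (u : Fin N → ℂ)
    (T : ℕ → VertexOperator ℂ (Fock N ℓ r)) : Prop where
  zero : ∀ v : Fock N ℓ r, T 0 v = HahnModule.of ℂ (HahnSeries.single 0 v)
  one : T 1 = basicCurrent N hℓ hr u
  fusion : ∀ i j : ℕ, 1 ≤ i → 1 ≤ j → ∀ ε : ℤ, ε = 1 ∨ ε = -1 →
    ∀ (v : Fock N ℓ r) (φ : Module.Dual ℂ (Fock N ℓ r)) (n : ℤ),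
      HasFusionLimit (prodCoeff (fser N ℓ r i j) (T i) (T j) v φ n)
        (pw ℓ (-(ε * (i + j))))
        (-ε * cst ℓ r * (∏ l ∈ Finset.Icc 1 (min i j - 1), dfun ℓ r (pw ℓ (2 * l + 1))) *
          (pw ℓ (ε * i) ^ n * φ (HVertexOperator.coeff (T (i + j)) n v)))

end

end DeformedW

/-!
The proof rests on an explicit formula for the currents.  Number the indices
`1, …, N, 0, N̄, …, 1̄` by the positions `0, …, 2N`, so that the bar involution is `q ↦ 2N - q`, and
let `𝚲_q(z)` (`current`) be the dressed current at the position `q`.  For a set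
`Ω = {q_1 < ⋯ < q_j}` of positions let `fused Ω` be the normally ordered product
`:∏_l 𝚲_{q_l}(x ^ (2 l - j - 1) z):`.  Then
`T_j(z) = ∑_{|Ω| = j} coef Ω • fused Ω` (`explicitCurrent`), where `coef Ω` contains the factor
`[r - 1/2]_x / [1/2]_x` if `N ∈ Ω`, and a factor `d(x ^ (2 e))` for each `q < N` such that `q` and
`2N - q` both lie in `Ω`; here `e - 1 = walk N Ω q` is the number of elements of `Ω` strictly
between `q` and `2N - q`, minus `N - q`.

*The formula.*  Fusing `T_1` with `T_j` determines `T_{j+1}`.  The contraction of `𝚲_s(z₁)` with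
`fused Ω (z₂)`, times `f_{1,j}(z₂ / z₁)`, is a product of at most two shifted functions `d`: one if
`s ∉ Ω` and one if `2N - s ∈ Ω` (`fser_mul_contraction`).  It has a pole at `z₂ / z₁ = x ^ (j + 1)`
only if `s` precedes all elements of `Ω` (`tendsto_pairing`), and then the normally ordered product
at that point is `fused (insert s Ω)` (`normal_current_fused`).  As every matrix coefficient is a
power series times a Laurent polynomial (`exists_conv_contraction`), the meromorphic continuation
is explicit, and the sum of the residues over pairs `(s, Ω)` is the formula for `T_{j+1}`
(`eq_explicitCurrent_succ`).  There are only `2N + 1` positions, so `T_j = 0` for `j ≥ 2N + 2`.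

*Duality.*  On the quotient by the images of `ΔH_{-m}`, the operators `fused Ω` and
`fused (dual N Ω)` coincide, where `dual N Ω` is the bar image of the complement of `Ω`
(`fusedOp_dual`).  Indeed `H_{-m}` can be eliminated, the action on `H_{-m}` is determined by
commutation with `ΔH_{-m}`, and the equality of the exponents of the remaining bosons is a
telescoping sum over all positions (`sum_crMode_dual`, `sum_anMode_dressed_dual`).  The
coefficients of `Ω` and `dual N Ω` are compared by following `walk` from the middle position
outwards: it goes up, with a factor for `Ω`, if `q` and `2N - q` both lie in `Ω`, and down, with a
factor for the dual, if neither does.  As `d(z⁻¹) = d(z)` and `d(1) = ([r - 1/2]_x / [1/2]_x) ^ 2`,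
the ratio of the two coefficients depends only on the end point `|Ω| - N - 1` of the walk
(`coef_dual`).
-/

namespace DeformedW

open Filter Topology

/-! ### Exponentials of power series -/

section ExpSeries

variable {A B : Type*} [CommRing A] [CommRing B]

/-- The exponent `∑_{m ≥ 1} g m z ^ m` of `expSeries g`. -/
noncomputable def expArg (g : ℕ → A) : PowerSeries A :=
  PowerSeries.mk fun m => if m = 0 then 0 else g m

theorem expArg_congr {g h : ℕ → A} (H : ∀ m, 0 < m → g m = h m) : expArg g = expArg h := by
  ext m
  rcases Nat.eq_zero_or_pos m with rfl | hm
  · simp [expArg]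
  · simp [expArg, H m hm]

theorem coeff_expArg_pow_eq_zero (g : ℕ → A) {n k : ℕ} (h : n < k) :
    PowerSeries.coeff n (expArg g ^ k) = 0 := by
  have h1 : PowerSeries.X ∣ expArg g := by
    rw [PowerSeries.X_dvd_iff, ← PowerSeries.coeff_zero_eq_constantCoeff_apply]
    simp [expArg]
  exact PowerSeries.X_pow_dvd_iff.1 (pow_dvd_pow_of_dvd h1 k) n h

theorem expArg_add (g h : ℕ → A) : expArg (fun m => g m + h m) = expArg g + expArg h := by
  ext m
  simp only [expArg, PowerSeries.coeff_mk, map_add]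
  split_ifs <;> simp

variable [Algebra ℂ A] [Algebra ℂ B]

theorem expSeries_congr {g h : ℕ → A} (H : ∀ m, 0 < m → g m = h m) :
    expSeries g = expSeries h := by
  have := expArg_congr H
  unfold expArg at this
  unfold expSeries
  rw [this]

/-- Every truncation of the exponential beyond the order `n` has the right `n`-th coefficient. -/
theorem coeff_expSeries (g : ℕ → A) {n M : ℕ} (h : n < M) :
    PowerSeries.coeff n (expSeries g) =
      PowerSeries.coeff n (∑ k ∈ Finset.range M, ((k.factorial : ℂ)⁻¹) • expArg g ^ k) := by
  rw [expSeries, PowerSeries.coeff_mk, map_sum]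
  simp only [PowerSeries.coeff_smul]
  refine Finset.sum_subset (Finset.range_mono h) fun k _ hk => ?_
  rw [Finset.mem_range, not_lt] at hk
  change _ • PowerSeries.coeff n (expArg g ^ k) = 0
  rw [coeff_expArg_pow_eq_zero g hk, smul_zero]

theorem coeff_zero_expSeries (g : ℕ → A) : PowerSeries.coeff 0 (expSeries g) = 1 := by
  rw [coeff_expSeries g Nat.zero_lt_one]
  simp

theorem derivative_expSeries (g : ℕ → A) :
    PowerSeries.derivative A (expSeries g) =
      expSeries g * PowerSeries.derivative A (expArg g) := by
  have key : ∀ M : ℕ, PowerSeries.derivative A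
      (∑ k ∈ Finset.range (M + 1), ((k.factorial : ℂ)⁻¹) • expArg g ^ k) =
      (∑ k ∈ Finset.range M, ((k.factorial : ℂ)⁻¹) • expArg g ^ k) *
        PowerSeries.derivative A (expArg g) := by
    intro M
    rw [Finset.sum_range_succ', map_add, map_sum, Finset.sum_mul]
    have h0 : PowerSeries.derivative A (((Nat.factorial 0 : ℂ)⁻¹) • expArg g ^ 0) = 0 := by
      simp
    rw [h0, add_zero]
    refine Finset.sum_congr rfl fun k _ => ?_
    have h1 : ∀ (c : ℂ) (F : PowerSeries A), PowerSeries.derivative A (c • F) =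
        c • PowerSeries.derivative A F := by
      intro c F
      ext n
      simp [PowerSeries.coeff_derivative]
    rw [h1, PowerSeries.derivative_pow, Nat.add_sub_cancel, smul_mul_assoc, mul_assoc,
      ← nsmul_eq_mul, ← Nat.cast_smul_eq_nsmul ℂ, smul_smul]
    congr 1
    have : ((k + 1 : ℕ) : ℂ) ≠ 0 := by exact_mod_cast k.succ_ne_zero
    have : ((k.factorial : ℕ) : ℂ) ≠ 0 := by exact_mod_cast k.factorial_ne_zero
    rw [Nat.factorial_succ]
    push_cast at *
    field_simp
  ext n
  rw [PowerSeries.coeff_derivative, coeff_expSeries g (Nat.lt_succ_self (n + 1)),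
    ← PowerSeries.coeff_derivative, key, PowerSeries.coeff_mul, PowerSeries.coeff_mul]
  refine Finset.sum_congr rfl fun p hp => ?_
  rw [coeff_expSeries g (M := n + 1)]
  have := Finset.HasAntidiagonal.mem_antidiagonal.1 hp
  omega

/-- The exponential is the only solution of `F' = F G'`, `F(0) = 1`. -/
theorem eq_expSeries {F : PowerSeries A} {g : ℕ → A} (h0 : PowerSeries.coeff 0 F = 1)
    (h : PowerSeries.derivative A F = F * PowerSeries.derivative A (expArg g)) :
    F = expSeries g := by
  ext n
  induction n using Nat.strong_induction_on with
  | _ n ih =>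
    rcases n with _ | n
    · rw [h0, coeff_zero_expSeries]
    · have h1 := congrArg (PowerSeries.coeff n) h
      have h2 := congrArg (PowerSeries.coeff n) (derivative_expSeries g)
      rw [PowerSeries.coeff_derivative, PowerSeries.coeff_mul] at h1 h2
      have h3 : PowerSeries.coeff (n + 1) F * ((n : A) + 1) =
          PowerSeries.coeff (n + 1) (expSeries g) * ((n : A) + 1) := by
        rw [h1, h2]
        refine Finset.sum_congr rfl fun p hp => ?_
        have := Finset.HasAntidiagonal.mem_antidiagonal.1 hp
        rw [ih p.1 (by omega)]
      have h4 : ((n : A) + 1) = algebraMap ℂ A ((n : ℂ) + 1) := by simp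
      have h5 : ((n : ℂ) + 1) ≠ 0 := by exact_mod_cast n.succ_ne_zero
      have h6 : ((n : A) + 1) * algebraMap ℂ A (((n : ℂ) + 1)⁻¹) = 1 := by
        rw [h4, ← map_mul, mul_inv_cancel₀ h5, map_one]
      calc _ = PowerSeries.coeff (n + 1) F * ((n : A) + 1) *
            algebraMap ℂ A (((n : ℂ) + 1)⁻¹) := by rw [mul_assoc, h6, mul_one]
        _ = _ := by rw [h3, mul_assoc, h6, mul_one]

theorem expSeries_add (g h : ℕ → A) :
    expSeries (fun m => g m + h m) = expSeries g * expSeries h := by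
  symm
  refine eq_expSeries ?_ ?_
  · simp [PowerSeries.coeff_mul, coeff_zero_expSeries]
  · rw [Derivation.leibniz, derivative_expSeries, derivative_expSeries, expArg_add, map_add]
    simp only [smul_eq_mul]
    ring

theorem expSeries_zero : expSeries (fun _ => (0 : A)) = 1 := by
  symm
  refine eq_expSeries (by simp) ?_
  have : expArg (fun _ => (0 : A)) = 0 := by ext m; simp [expArg]
  rw [this]
  simp

theorem map_expSeries (f : A →+* B) (hf : ∀ (c : ℂ) (a : A), f (c • a) = c • f a) (g : ℕ → A) :
    PowerSeries.map f (expSeries g) = expSeries (fun m => f (g m)) := by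
  have h : PowerSeries.map f (expArg g) = expArg (fun m => f (g m)) := by
    ext m
    simp only [expArg, PowerSeries.coeff_map, PowerSeries.coeff_mk]
    split_ifs <;> simp
  ext n
  rw [PowerSeries.coeff_map, coeff_expSeries g (Nat.lt_succ_self n),
    coeff_expSeries _ (Nat.lt_succ_self n)]
  simp only [map_sum, PowerSeries.coeff_smul, hf, ← h, ← map_pow, PowerSeries.coeff_map]

theorem rescale_expSeries (c : A) (g : ℕ → A) :
    PowerSeries.rescale c (expSeries g) = expSeries (fun m => c ^ m * g m) := by
  have h : PowerSeries.rescale c (expArg g) = expArg (fun m => c ^ m * g m) := by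
    ext m
    simp only [expArg, PowerSeries.coeff_rescale, PowerSeries.coeff_mk]
    split_ifs <;> simp
  ext n
  rw [PowerSeries.coeff_rescale, coeff_expSeries g (Nat.lt_succ_self n),
    coeff_expSeries _ (Nat.lt_succ_self n)]
  simp only [map_sum, PowerSeries.coeff_smul, ← h, ← map_pow, PowerSeries.coeff_rescale,
    Finset.mul_sum, mul_smul_comm]

theorem one_sub_mul_mk_pow (α : ℂ) :
    (1 - PowerSeries.C α * PowerSeries.X) * PowerSeries.mk (fun n => α ^ n) = 1 := by
  ext n
  rw [sub_mul, one_mul, mul_assoc, map_sub, PowerSeries.coeff_C_mul]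
  rcases n with _ | n
  · simp
  · rw [PowerSeries.coeff_succ_X_mul]
    simp [PowerSeries.coeff_one, pow_succ']

theorem expSeries_neg_pow_div (α : ℂ) :
    expSeries (fun m => -(α ^ m / (m : ℂ))) = 1 - PowerSeries.C α * PowerSeries.X := by
  symm
  refine eq_expSeries (by simp) ?_
  have h : PowerSeries.derivative ℂ (expArg fun m : ℕ => -(α ^ m / (m : ℂ))) =
      -(PowerSeries.C α * PowerSeries.mk fun n => α ^ n) := by
    ext n
    have : ((n : ℂ) + 1) ≠ 0 := by exact_mod_cast n.succ_ne_zero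
    rw [PowerSeries.coeff_derivative, map_neg, PowerSeries.coeff_C_mul]
    simp only [expArg, PowerSeries.coeff_mk, Nat.succ_ne_zero, if_false]
    push_cast
    field_simp
    ring
  rw [h, mul_neg, mul_left_comm, one_sub_mul_mk_pow]
  simp

theorem expSeries_pow_div (α : ℂ) :
    expSeries (fun m => α ^ m / (m : ℂ)) = PowerSeries.mk fun n => α ^ n := by
  have h1 : expSeries (fun m : ℕ => -(α ^ m / (m : ℂ))) * expSeries (fun m => α ^ m / (m : ℂ)) =
      1 := by
    rw [← expSeries_add]
    simpa using expSeries_zero (A := ℂ)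
  rw [expSeries_neg_pow_div] at h1
  calc _ = (1 - PowerSeries.C α * PowerSeries.X) * PowerSeries.mk (fun n => α ^ n) *
        expSeries (fun m => α ^ m / (m : ℂ)) := by rw [one_sub_mul_mk_pow, one_mul]
    _ = _ := by rw [mul_right_comm, h1, one_mul]

end ExpSeries

/-! ### Action of a vertex operator -/

section

/-- The coefficients of a power series, extended by zero to negative indices. -/
noncomputable def lext {A : Type*} [CommRing A] (F : PowerSeries A) (n : ℤ) : A :=
  if 0 ≤ n then PowerSeries.coeff n.toNat F else 0

section Lext

variable {A : Type*} [CommRing A]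

theorem lext_natCast (F : PowerSeries A) (n : ℕ) : lext F n = PowerSeries.coeff n F := by
  simp [lext]

theorem lext_of_neg (F : PowerSeries A) {n : ℤ} (h : n < 0) : lext F n = 0 := by
  simp [lext, h]

theorem coeff_ofPowerSeries (F : PowerSeries A) (n : ℤ) :
    (HahnSeries.ofPowerSeries ℤ A F).coeff n = lext F n := by
  rw [PowerSeries.coeff_coe, lext]
  rcases lt_or_ge n 0 with h | h
  · simp [h]
  · have : n.natAbs = n.toNat := by omega
    simp [h, h.not_gt, this]

end Lext

variable {N : ℕ} {ℓ : ℂ} {r : ℝ}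

/-- The vector `b_{-m}`, `p = (b, m)`, of the Fock space. -/
noncomputable def gen (N : ℕ) (ℓ : ℂ) (r : ℝ) (p : Option (Fin N) × ℕ+) : Fock N ℓ r :=
  toFock N ℓ r (MvPolynomial.X p)

theorem fock_induction {P : Fock N ℓ r → Prop} (one : P 1)
    (add : ∀ v w, P v → P w → P (v + w)) (smul : ∀ (c : ℂ) v, P v → P (c • v))
    (mul : ∀ p v, P v → P (gen N ℓ r p * v)) (v : Fock N ℓ r) : P v := by
  obtain ⟨f, rfl⟩ := Ideal.Quotient.mk_surjective v
  change P (toFock N ℓ r f)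
  induction f using MvPolynomial.induction_on with
  | C a =>
    have : toFock N ℓ r (MvPolynomial.C a) = a • (1 : Fock N ℓ r) := by
      rw [Algebra.smul_def, mul_one]; rfl
    rw [this]
    exact smul a 1 one
  | add f g hf hg => rw [map_add]; exact add _ _ hf hg
  | mul_X f p hf => rw [map_mul, mul_comm]; exact mul p _ hf

theorem VOData.creation_eq (E : VOData N) :
    E.creation ℓ r = expSeries fun m : ℕ =>
      ∑ b : Option (Fin N), E.cr b m • gen N ℓ r (b, m.toPNat') := by
  refine expSeries_congr fun m hm => ?_
  have h : (⟨m, hm⟩ : ℕ+) = m.toPNat' := PNat.eq (by simp [hm])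
  simp only [dif_pos hm, h]
  rfl

theorem coeff_toVertexOperator (E : VOData N) (hE : E.Commutes ℓ r) (n : ℤ) (v : Fock N ℓ r) :
    HVertexOperator.coeff (E.toVertexOperator ℓ r hE) n v =
      E.const • (HahnSeries.ofPowerSeries ℤ (Fock N ℓ r) (E.creation ℓ r) *
        E.annihilation ℓ r hE v).coeff n := by
  change (HahnSeries.C (algebraMap ℂ (Fock N ℓ r) E.const) *
    (_ : LaurentSeries (Fock N ℓ r))).coeff n = _
  rw [HahnSeries.C_mul_eq_smul, HahnSeries.coeff_smul, algebraMap_smul]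

theorem coeff_toVertexOperator_one (E : VOData N) (hE : E.Commutes ℓ r) (n : ℤ) :
    HVertexOperator.coeff (E.toVertexOperator ℓ r hE) n 1 =
      E.const • lext (E.creation ℓ r) n := by
  rw [coeff_toVertexOperator, map_one, mul_one, coeff_ofPowerSeries]

theorem VOData.annihilation_gen (E : VOData N) (hE : E.Commutes ℓ r)
    (p : Option (Fin N) × ℕ+) :
    E.annihilation ℓ r hE (gen N ℓ r p) = HahnSeries.C (gen N ℓ r p) +
      HahnSeries.single (-((p.2 : ℕ) : ℤ))
        (algebraMap ℂ (Fock N ℓ r) (E.an p.1 p.2 * br N ℓ r p.1 p.2)) := by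
  change E.shift ℓ r (MvPolynomial.X p) = _
  rw [VOData.shift, MvPolynomial.coe_eval₂Hom, MvPolynomial.eval₂_X]
  rfl

theorem VOData.annihilation_smul (E : VOData N) (hE : E.Commutes ℓ r) (c : ℂ) (v : Fock N ℓ r) :
    E.annihilation ℓ r hE (c • v) = scal N ℓ r c * E.annihilation ℓ r hE v := by
  rw [Algebra.smul_def, map_mul]
  congr 1
  exact MvPolynomial.eval₂_C _ _ _

theorem scal_mul_C (c : ℂ) (a : Fock N ℓ r) :
    scal N ℓ r c * HahnSeries.C a = HahnSeries.C (c • a) := by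
  rw [scal, RingHom.comp_apply, ← map_mul, Algebra.smul_def]

theorem algebraMap_laurentSeries (c : ℂ) :
    algebraMap ℂ (LaurentSeries (Fock N ℓ r)) c = scal N ℓ r c := by
  rw [HahnSeries.algebraMap_apply', PowerSeries.algebraMap_apply, HahnSeries.ofPowerSeries_C, scal,
    RingHom.comp_apply]

theorem coeff_mul_translate {A : Type*} [CommRing A] [Algebra ℂ A] (G Y : LaurentSeries A) (g : A)
    (c : ℂ) (m n : ℤ) :
    (G * ((HahnSeries.C g + HahnSeries.single (-m) (algebraMap ℂ A c)) * Y)).coeff n =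
      g * (G * Y).coeff n + c • (G * Y).coeff (n + m) := by
  rw [mul_left_comm, add_mul, HahnSeries.coeff_add, HahnSeries.C_mul_eq_smul,
    HahnSeries.coeff_smul, HahnSeries.coeff_single_mul, sub_neg_eq_add, smul_eq_mul,
    Algebra.smul_def c]

/-- The commutation relation of a vertex operator with a creation operator. -/
theorem coeff_toVertexOperator_gen_mul (E : VOData N) (hE : E.Commutes ℓ r) (n : ℤ)
    (p : Option (Fin N) × ℕ+) (v : Fock N ℓ r) :
    HVertexOperator.coeff (E.toVertexOperator ℓ r hE) n (gen N ℓ r p * v) =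
      gen N ℓ r p * HVertexOperator.coeff (E.toVertexOperator ℓ r hE) n v +
      (E.an p.1 p.2 * br N ℓ r p.1 p.2) •
        HVertexOperator.coeff (E.toVertexOperator ℓ r hE) (n + (p.2 : ℕ)) v := by
  rw [coeff_toVertexOperator, coeff_toVertexOperator, coeff_toVertexOperator,
    map_mul (E.annihilation ℓ r hE), VOData.annihilation_gen, coeff_mul_translate, smul_add,
    mul_smul_comm, smul_comm E.const]

/-- A vertex operator is determined by its constant, its creation part and the action of its
annihilation part on the generators. -/
theorem toVertexOperator_congr {E E' : VOData N} (hE : E.Commutes ℓ r) (hE' : E'.Commutes ℓ r)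
    (h0 : E.const = E'.const) (h1 : E.creation ℓ r = E'.creation ℓ r)
    (h2 : ∀ (b : Option (Fin N)) (m : ℕ+), E.an b m * br N ℓ r b m = E'.an b m * br N ℓ r b m) :
    E.toVertexOperator ℓ r hE = E'.toVertexOperator ℓ r hE' := by
  have key : ∀ (v : Fock N ℓ r) (n : ℤ), HVertexOperator.coeff (E.toVertexOperator ℓ r hE) n v =
      HVertexOperator.coeff (E'.toVertexOperator ℓ r hE') n v := by
    intro v
    induction v using fock_induction with
    | one => intro n; rw [coeff_toVertexOperator_one, coeff_toVertexOperator_one, h0, h1]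
    | add v w hv hw => intro n; rw [map_add, map_add, hv, hw]
    | smul c v hv => intro n; rw [map_smul, map_smul, hv]
    | mul p v hv =>
      intro n
      rw [coeff_toVertexOperator_gen_mul, coeff_toVertexOperator_gen_mul, hv, hv, h2]
  refine HVertexOperator.coeff_inj ?_
  ext n v
  exact key v n

/-! ### Products of two vertex operators -/

/-- The vertex operator `E(c z)`. -/
noncomputable def VOData.rescale (E : VOData N) (c : ℂ) : VOData N where
  const := E.const
  cr b m := c ^ m * E.cr b m
  an b m := c⁻¹ ^ m * E.an b m

/-- The normally ordered product `:E(z) F(z):`. -/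
noncomputable def VOData.normal (E F : VOData N) : VOData N where
  const := E.const * F.const
  cr b m := E.cr b m + F.cr b m
  an b m := E.an b m + F.an b m

theorem VOData.Commutes.rescale {E : VOData N} (hE : E.Commutes ℓ r) (c : ℂ) :
    (E.rescale c).Commutes ℓ r := by
  intro m
  rw [← mul_zero (c⁻¹ ^ (m : ℕ)), ← hE m, Finset.mul_sum]
  refine Finset.sum_congr rfl fun b _ => ?_
  simp only [VOData.rescale]
  ring

theorem VOData.Commutes.normal {E F : VOData N} (hE : E.Commutes ℓ r) (hF : F.Commutes ℓ r) :
    (E.normal F).Commutes ℓ r := by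
  intro m
  rw [← add_zero (0 : ℂ)]
  nth_rw 1 [← hE m]
  rw [← hF m, ← Finset.sum_add_distrib]
  refine Finset.sum_congr rfl fun b _ => ?_
  simp only [VOData.normal]
  ring

theorem VOData.creation_rescale (E : VOData N) (c : ℂ) :
    (E.rescale c).creation ℓ r =
      PowerSeries.rescale (algebraMap ℂ (Fock N ℓ r) c) (E.creation ℓ r) := by
  rw [VOData.creation_eq, VOData.creation_eq, rescale_expSeries]
  refine expSeries_congr fun m hm => ?_
  simp only [VOData.rescale, ← map_pow, ← Algebra.smul_def, Finset.smul_sum, mul_smul]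

theorem VOData.creation_normal (E F : VOData N) :
    (E.normal F).creation ℓ r = E.creation ℓ r * F.creation ℓ r := by
  rw [VOData.creation_eq, VOData.creation_eq, VOData.creation_eq, ← expSeries_add]
  refine expSeries_congr fun m hm => ?_
  simp only [VOData.normal, add_smul, Finset.sum_add_distrib]

theorem coeff_toVertexOperator_rescale (E : VOData N) (hE : E.Commutes ℓ r) {c : ℂ} (hc : c ≠ 0)
    (v : Fock N ℓ r) (n : ℤ) :
    HVertexOperator.coeff ((E.rescale c).toVertexOperator ℓ r (hE.rescale c)) n v =
      c ^ n • HVertexOperator.coeff (E.toVertexOperator ℓ r hE) n v := by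
  induction v using fock_induction generalizing n with
  | one =>
    rw [coeff_toVertexOperator_one, coeff_toVertexOperator_one, VOData.creation_rescale, smul_comm]
    congr 1
    rcases lt_or_ge n 0 with h | h
    · simp [lext_of_neg _ h]
    · lift n to ℕ using h
      rw [lext_natCast, lext_natCast, PowerSeries.coeff_rescale, ← map_pow, ← Algebra.smul_def,
        zpow_natCast]
  | add v w hv hw => rw [map_add, map_add, hv, hw, smul_add]
  | smul a v hv => rw [map_smul, map_smul, hv, smul_comm]
  | mul p v hv =>
    rw [coeff_toVertexOperator_gen_mul, coeff_toVertexOperator_gen_mul, hv, hv, smul_add,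
      mul_smul_comm, smul_smul, smul_smul]
    congr 2
    simp only [VOData.rescale]
    rw [zpow_add₀ hc, zpow_natCast]
    have : c ^ (p.2 : ℕ) ≠ 0 := pow_ne_zero _ hc
    rw [inv_pow]
    field_simp

/-- The exponents of the contraction of `E(z₁)` and `F(z₂)`, a power series in `z₂ / z₁`. -/
noncomputable def VOData.contraction (E F : VOData N) (ℓ : ℂ) (r : ℝ) (m : ℕ) : ℂ :=
  ∑ b : Option (Fin N), E.an b m * br N ℓ r b m * F.cr b m

/-- Moving the annihilation part of `E(z₁)` through the creation part of `F(z₂)`. -/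
theorem map_annihilation_creation (E F : VOData N) (hE : E.Commutes ℓ r) :
    PowerSeries.map (E.annihilation ℓ r hE) (F.creation ℓ r) =
      PowerSeries.map HahnSeries.C (F.creation ℓ r) *
        PowerSeries.rescale (HahnSeries.single (-1 : ℤ) (1 : Fock N ℓ r))
          (PowerSeries.map (scal N ℓ r) (expSeries (E.contraction F ℓ r))) := by
  rw [VOData.creation_eq, map_expSeries (E.annihilation ℓ r hE),
    map_expSeries (HahnSeries.C : Fock N ℓ r →+* LaurentSeries (Fock N ℓ r)),
    map_expSeries (scal N ℓ r), rescale_expSeries, ← expSeries_add]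
  · refine expSeries_congr fun m hm => ?_
    have hm' : ((m.toPNat' : ℕ+) : ℕ) = m := by simp [hm]
    simp only [map_sum, VOData.annihilation_smul, VOData.annihilation_gen, mul_add,
      Finset.sum_add_distrib, scal_mul_C, hm']
    congr 1
    rw [HahnSeries.single_pow, one_pow, VOData.contraction, map_sum, Finset.mul_sum]
    refine Finset.sum_congr rfl fun b _ => ?_
    rw [scal, RingHom.comp_apply, RingHom.comp_apply, HahnSeries.C_apply, HahnSeries.C_apply,
      HahnSeries.single_mul_single, HahnSeries.single_mul_single, add_zero, zero_add, one_mul,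
      ← map_mul, mul_comm]
    simp
  · intro c a
    rw [Algebra.smul_def c (scal N ℓ r a), algebraMap_laurentSeries, smul_eq_mul, map_mul]
  · intro c a
    rw [Algebra.smul_def c (HahnSeries.C a), algebraMap_laurentSeries, scal_mul_C]
  · intro c a
    rw [VOData.annihilation_smul, ← algebraMap_laurentSeries, ← Algebra.smul_def]

theorem annihilation_coeff_creation (E F : VOData N) (hE : E.Commutes ℓ r) (n : ℕ) :
    E.annihilation ℓ r hE (PowerSeries.coeff n (F.creation ℓ r)) =
      ∑ p ∈ Finset.HasAntidiagonal.antidiagonal n, HahnSeries.single (-(p.1 : ℤ))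
        (PowerSeries.coeff p.1 (expSeries (E.contraction F ℓ r)) •
          PowerSeries.coeff p.2 (F.creation ℓ r)) := by
  have := congrArg (PowerSeries.coeff n) (map_annihilation_creation E F hE)
  rw [PowerSeries.coeff_map, mul_comm, PowerSeries.coeff_mul] at this
  rw [this]
  refine Finset.sum_congr rfl fun p _ => ?_
  rw [PowerSeries.coeff_rescale, PowerSeries.coeff_map, PowerSeries.coeff_map,
    HahnSeries.single_pow, one_pow, smul_neg, nsmul_one]
  change _ * HahnSeries.C (algebraMap ℂ (Fock N ℓ r) _) * HahnSeries.C _ = _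
  rw [HahnSeries.C_apply, HahnSeries.C_apply, HahnSeries.single_mul_single,
    HahnSeries.single_mul_single, add_zero, add_zero, one_mul, Algebra.smul_def]

/-- The product of two vertex operators on the vacuum. -/
theorem coeff_mul_vacuum (E F : VOData N) (hE : E.Commutes ℓ r) (hF : F.Commutes ℓ r)
    (a : ℤ) (n : ℕ) :
    HVertexOperator.coeff (E.toVertexOperator ℓ r hE) a
        (HVertexOperator.coeff (F.toVertexOperator ℓ r hF) n 1) =
      ∑ p ∈ Finset.HasAntidiagonal.antidiagonal n,
        PowerSeries.coeff p.1 (expSeries (E.contraction F ℓ r)) •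
          (E.const * F.const) • (lext (E.creation ℓ r) (a + p.1) *
            PowerSeries.coeff p.2 (F.creation ℓ r)) := by
  rw [coeff_toVertexOperator_one, map_smul, coeff_toVertexOperator, lext_natCast,
    annihilation_coeff_creation, Finset.mul_sum, HahnSeries.coeff_sum, Finset.smul_sum,
    Finset.smul_sum]
  refine Finset.sum_congr rfl fun p _ => ?_
  rw [HahnSeries.coeff_mul_single, coeff_ofPowerSeries, sub_neg_eq_add, mul_smul_comm]
  simp only [smul_smul]
  congr 1
  ring

end

/-! ### Products of vertex operators as Laurent series -/

section

/-- The product of a power series with a Laurent polynomial, as a family of coefficients. -/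
noncomputable def conv (F : PowerSeries ℂ) (P : ℤ →₀ ℂ) (l : ℤ) : ℂ :=
  P.sum fun j c => c * lext F (l - j)

/-- The value of a Laurent polynomial. -/
noncomputable def leval (P : ℤ →₀ ℂ) (w : ℂ) : ℂ := P.sum fun j c => c * w ^ j

theorem conv_zero (F : PowerSeries ℂ) (l : ℤ) : conv F 0 l = 0 := Finsupp.sum_zero_index

theorem conv_add (F : PowerSeries ℂ) (P Q : ℤ →₀ ℂ) (l : ℤ) :
    conv F (P + Q) l = conv F P l + conv F Q l :=
  Finsupp.sum_add_index' (fun _ => zero_mul _) fun _ _ _ => add_mul _ _ _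

theorem conv_smul (F : PowerSeries ℂ) (a : ℂ) (P : ℤ →₀ ℂ) (l : ℤ) :
    conv F (a • P) l = a * conv F P l := by
  rw [conv, conv, Finsupp.sum_smul_index fun _ => zero_mul _, Finsupp.mul_sum]
  simp only [mul_assoc]

theorem conv_single (F : PowerSeries ℂ) (j : ℤ) (a : ℂ) (l : ℤ) :
    conv F (Finsupp.single j a) l = a * lext F (l - j) :=
  Finsupp.sum_single_index (zero_mul _)

theorem conv_sum (F : PowerSeries ℂ) {ι : Type*} (s : Finset ι) (P : ι → ℤ →₀ ℂ) (l : ℤ) :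
    conv F (∑ i ∈ s, P i) l = ∑ i ∈ s, conv F (P i) l := by
  classical
  induction s using Finset.induction_on with
  | empty => simp [conv_zero]
  | insert a s ha ih => rw [Finset.sum_insert ha, Finset.sum_insert ha, conv_add, ih]

theorem conv_mapDomain (F : PowerSeries ℂ) (m : ℤ) (P : ℤ →₀ ℂ) (l : ℤ) :
    conv F (P.mapDomain (· + m)) l = conv F P (l - m) := by
  rw [conv, Finsupp.sum_mapDomain_index (fun _ => zero_mul _) fun _ _ _ => add_mul _ _ _, conv]
  simp only [sub_sub, add_comm m]

theorem leval_zero (w : ℂ) : leval 0 w = 0 := Finsupp.sum_zero_index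

theorem leval_add (P Q : ℤ →₀ ℂ) (w : ℂ) : leval (P + Q) w = leval P w + leval Q w :=
  Finsupp.sum_add_index' (fun _ => zero_mul _) fun _ _ _ => add_mul _ _ _

theorem leval_smul (a : ℂ) (P : ℤ →₀ ℂ) (w : ℂ) : leval (a • P) w = a * leval P w := by
  rw [leval, leval, Finsupp.sum_smul_index fun _ => zero_mul _, Finsupp.mul_sum]
  simp only [mul_assoc]

theorem leval_single (j : ℤ) (a w : ℂ) : leval (Finsupp.single j a) w = a * w ^ j :=
  Finsupp.sum_single_index (zero_mul _)

theorem leval_sum {ι : Type*} (s : Finset ι) (P : ι → ℤ →₀ ℂ) (w : ℂ) :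
    leval (∑ i ∈ s, P i) w = ∑ i ∈ s, leval (P i) w := by
  classical
  induction s using Finset.induction_on with
  | empty => simp [leval_zero]
  | insert a s ha ih => rw [Finset.sum_insert ha, Finset.sum_insert ha, leval_add, ih]

theorem leval_mapDomain (m : ℤ) (P : ℤ →₀ ℂ) {w : ℂ} (hw : w ≠ 0) :
    leval (P.mapDomain (· + m)) w = w ^ m * leval P w := by
  rw [leval, Finsupp.sum_mapDomain_index (fun _ => zero_mul _) fun _ _ _ => add_mul _ _ _, leval,
    Finsupp.mul_sum]
  refine Finsupp.sum_congr fun j _ => ?_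
  rw [zpow_add₀ hw]
  ring

/-- A convolution sum over an antidiagonal, as a sum over the second index. -/
theorem sum_antidiagonal_eq_sum_lext {A : Type*} [CommRing A] (F : PowerSeries A) (h : ℕ → A)
    {k M : ℕ} (hM : k < M) :
    ∑ p ∈ Finset.HasAntidiagonal.antidiagonal k, PowerSeries.coeff p.1 F * h p.2 =
      ∑ i ∈ Finset.range M, lext F ((k : ℤ) - i) * h i := by
  rw [← Finset.Nat.sum_antidiagonal_swap, Finset.Nat.sum_antidiagonal_eq_sum_range_succ_mk]
  rw [← Finset.sum_subset (Finset.range_mono (Nat.succ_le_of_lt hM))]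
  · refine Finset.sum_congr rfl fun i hi => ?_
    have hi' : i ≤ k := Nat.lt_succ_iff.1 (Finset.mem_range.1 hi)
    have : ((k : ℤ) - i) = ((k - i : ℕ) : ℤ) := by omega
    rw [this, lext_natCast]
    simp
  · intro i _ hi
    have hi' : ¬ i < k + 1 := fun h => hi (Finset.mem_range.2 h)
    rw [lext_of_neg _ (by omega), zero_mul]

theorem coeff_mul_eq_sum_lext {A : Type*} [CommRing A] (F H : PowerSeries A)
    {k M : ℕ} (hM : k < M) :
    PowerSeries.coeff k (F * H) =
      ∑ i ∈ Finset.range M, lext F ((k : ℤ) - i) * PowerSeries.coeff i H := by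
  rw [PowerSeries.coeff_mul]
  exact sum_antidiagonal_eq_sum_lext F (fun i => PowerSeries.coeff i H) hM

theorem lext_mul_eq_sum {A : Type*} [CommRing A] (F H : PowerSeries A)
    {k : ℤ} {M : ℕ} (hM : k < M) :
    lext (F * H) k = ∑ i ∈ Finset.range M, lext F (k - i) * PowerSeries.coeff i H := by
  rcases lt_or_ge k 0 with h | h
  · rw [lext_of_neg _ h, Finset.sum_eq_zero]
    intro i _
    rw [lext_of_neg _ (by omega), zero_mul]
  · lift k to ℕ using h
    rw [lext_natCast, coeff_mul_eq_sum_lext F H (M := M) (by omega)]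

variable {N : ℕ} {ℓ : ℂ} {r : ℝ}

theorem coeff_toVertexOperator_one_of_neg (E : VOData N) (hE : E.Commutes ℓ r) {n : ℤ}
    (h : n < 0) : HVertexOperator.coeff (E.toVertexOperator ℓ r hE) n 1 = 0 := by
  rw [coeff_toVertexOperator_one, lext_of_neg _ h, smul_zero]

theorem lext_creation_normal_rescale (E F : VOData N) (w : ℂ) {n : ℤ} {M : ℕ} (hM : n < M) :
    lext (((E.rescale w⁻¹).normal F).creation ℓ r) n =
      ∑ i ∈ Finset.range M, w ^ (i - n) • (lext (E.creation ℓ r) (n - i) *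
        PowerSeries.coeff i (F.creation ℓ r)) := by
  rw [VOData.creation_normal, lext_mul_eq_sum _ _ hM]
  refine Finset.sum_congr rfl fun i _ => ?_
  rw [VOData.creation_rescale]
  rcases lt_or_ge (n - i) 0 with h | h
  · rw [lext_of_neg _ h, lext_of_neg _ h, zero_mul, smul_zero]
  · have h2 : (i : ℤ) - n = -(n - i) := by ring
    rw [h2]
    generalize n - (i : ℤ) = k at h
    lift k to ℕ using h
    rw [lext_natCast, lext_natCast, PowerSeries.coeff_rescale, ← map_pow, ← smul_mul_assoc,
      ← Algebra.smul_def, inv_pow, zpow_neg, zpow_natCast]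

/-- A matrix coefficient of `E(z₁) F(z₂)`, at a fixed total power of `z₂` when expressed through
`w = z₂ / z₁` and `z₂`, is the contraction times a Laurent polynomial in `w`.  The values of that
polynomial are the matrix coefficients of the normally ordered product. -/
theorem exists_conv_contraction (E F : VOData N) (hE : E.Commutes ℓ r) (hF : F.Commutes ℓ r)
    (v : Fock N ℓ r) (φ : Module.Dual ℂ (Fock N ℓ r)) (n : ℤ) :
    ∃ P : ℤ →₀ ℂ,
      (∀ l : ℤ, φ (HVertexOperator.coeff (E.toVertexOperator ℓ r hE) (-l)
        (HVertexOperator.coeff (F.toVertexOperator ℓ r hF) (n + l) v)) =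
          conv (expSeries (E.contraction F ℓ r)) P l) ∧
      ∀ w : ℂ, w ≠ 0 → leval P w = φ (HVertexOperator.coeff
        (((E.rescale w⁻¹).normal F).toVertexOperator ℓ r ((hE.rescale w⁻¹).normal hF)) n v) := by
  induction v using fock_induction generalizing φ n with
  | one =>
    -- beyond the contraction only creation parts remain, so that only finitely many terms have the
    -- total power `n`
    obtain ⟨M, hM⟩ : ∃ M : ℕ, n < M := ⟨n.toNat + 1, by omega⟩
    set P : ℤ →₀ ℂ := ∑ i ∈ Finset.range M, Finsupp.single ((i : ℤ) - n)
      (φ ((E.const * F.const) • (lext (E.creation ℓ r) (n - i) *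
        PowerSeries.coeff i (F.creation ℓ r)))) with hP
    refine ⟨P, fun l => ?_, fun w hw => ?_⟩
    · rw [hP, conv_sum]
      simp only [conv_single]
      rcases lt_or_ge (n + l) 0 with h | h
      · rw [coeff_toVertexOperator_one_of_neg F hF h, map_zero, map_zero, Finset.sum_eq_zero]
        intro i _
        rw [lext_of_neg (expSeries _) (by omega), mul_zero]
      · obtain ⟨k, hk⟩ : ∃ k : ℕ, (k : ℤ) = n + l := ⟨(n + l).toNat, by omega⟩
        have h1 := sum_antidiagonal_eq_sum_lext (expSeries (E.contraction F ℓ r))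
          (fun i => φ ((E.const * F.const) • (lext (E.creation ℓ r) (n - i) *
            PowerSeries.coeff i (F.creation ℓ r)))) (k := k) (M := M + k)
        rw [← hk, coeff_mul_vacuum, map_sum]
        rcases Nat.eq_zero_or_pos M with h0 | h0
        · subst h0
          rw [Finset.range_zero, Finset.sum_empty, Finset.sum_eq_zero]
          intro p hp
          have := Finset.HasAntidiagonal.mem_antidiagonal.1 hp
          rw [lext_of_neg _ (by omega), zero_mul, smul_zero, smul_zero, map_zero]
        trans ∑ p ∈ Finset.HasAntidiagonal.antidiagonal k,
          PowerSeries.coeff p.1 (expSeries (E.contraction F ℓ r)) *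
            φ ((E.const * F.const) • (lext (E.creation ℓ r) (n - p.2) *
              PowerSeries.coeff p.2 (F.creation ℓ r)))
        · refine Finset.sum_congr rfl fun p hp => ?_
          have := Finset.HasAntidiagonal.mem_antidiagonal.1 hp
          have h2 : -l + (p.1 : ℤ) = n - p.2 := by omega
          rw [map_smul, h2, smul_eq_mul]
        · rw [h1 (by omega)]
          symm
          refine (Finset.sum_subset (Finset.range_mono (Nat.le_add_right M k)) ?_).trans ?_
          · intro i _ hi
            have hi' : ¬ i < M := fun h => hi (Finset.mem_range.2 h)
            rw [lext_of_neg (E.creation ℓ r) (by omega), zero_mul, smul_zero, map_zero, zero_mul]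
          · refine Finset.sum_congr rfl fun i _ => ?_
            have h2 : l - ((i : ℤ) - n) = k - i := by omega
            rw [h2, mul_comm]
    · rw [hP, leval_sum, coeff_toVertexOperator_one, lext_creation_normal_rescale E F w hM,
        Finset.smul_sum, map_sum]
      refine Finset.sum_congr rfl fun i _ => ?_
      have h1 : ((E.rescale w⁻¹).normal F).const = E.const * F.const := rfl
      rw [leval_single, h1]
      simp only [map_smul, smul_eq_mul]
      ring
  | add v v' hv hv' =>
    obtain ⟨P, h1, h2⟩ := hv φ n
    obtain ⟨P', h1', h2'⟩ := hv' φ n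
    refine ⟨P + P', fun l => ?_, fun w hw => ?_⟩
    · rw [conv_add, ← h1, ← h1', map_add, map_add, map_add]
    · rw [leval_add, h2 w hw, h2' w hw, map_add, map_add]
  | smul c v hv =>
    obtain ⟨P, h1, h2⟩ := hv φ n
    refine ⟨c • P, fun l => ?_, fun w hw => ?_⟩
    · rw [conv_smul, ← h1, map_smul, map_smul, map_smul, smul_eq_mul]
    · rw [leval_smul, h2 w hw, map_smul, map_smul, smul_eq_mul]
  | mul p v hv =>
    -- moving the creation operator to the left shifts the total power of `z₂`
    obtain ⟨P₁, h1, h1'⟩ := hv (φ ∘ₗ LinearMap.mulLeft ℂ (gen N ℓ r p)) n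
    obtain ⟨P₂, h2, h2'⟩ := hv φ (n + (p.2 : ℕ))
    refine ⟨P₁ + ((E.an p.1 p.2 * br N ℓ r p.1 p.2) • P₂.mapDomain (· + ((p.2 : ℕ) : ℤ)) +
      (F.an p.1 p.2 * br N ℓ r p.1 p.2) • P₂), fun l => ?_, fun w hw => ?_⟩
    · rw [conv_add, conv_add, conv_smul, conv_smul, conv_mapDomain, ← h1, ← h2, ← h2,
        coeff_toVertexOperator_gen_mul, map_add, map_smul, coeff_toVertexOperator_gen_mul, map_add,
        map_add, map_smul, map_smul, smul_eq_mul, smul_eq_mul, LinearMap.comp_apply,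
        LinearMap.mulLeft_apply, add_assoc]
      have e1 : n + (p.2 : ℕ) + (l - (p.2 : ℕ)) = n + l := by ring
      have e2 : -(l - ((p.2 : ℕ) : ℤ)) = -l + (p.2 : ℕ) := by ring
      have e3 : n + (p.2 : ℕ) + l = n + l + (p.2 : ℕ) := by ring
      rw [e1, e2, e3]
    · rw [leval_add, leval_add, leval_smul, leval_smul, leval_mapDomain _ _ hw, h1' w hw,
        h2' w hw, coeff_toVertexOperator_gen_mul, map_add, map_smul, smul_eq_mul,
        LinearMap.comp_apply, LinearMap.mulLeft_apply]
      simp only [VOData.normal, VOData.rescale, inv_inv, zpow_natCast]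
      ring

end

/-! ### Evaluation of fusion limits -/

section

theorem eventually_conv_mul (f F : PowerSeries ℂ) (P : ℤ →₀ ℂ) (l : ℤ) :
    ∀ᶠ M : ℕ in atTop, (∀ i : ℕ, M ≤ i → conv F P (l - i) = 0) ∧
      ∑ i ∈ Finset.range M, PowerSeries.coeff i f * conv F P (l - i) = conv (f * F) P l := by
  have h : ∀ᶠ M : ℕ in atTop, ∀ j ∈ P.support, l - j < M := by
    rw [Filter.eventually_all_finset]
    intro j _
    filter_upwards [eventually_gt_atTop (l - j).toNat] with M hM
    omega
  filter_upwards [h] with M hM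
  refine ⟨fun i hi => Finset.sum_eq_zero fun j hj => ?_, ?_⟩
  · have := hM j hj
    change _ * lext F _ = 0
    rw [lext_of_neg _ (by omega), mul_zero]
  · simp only [conv, Finsupp.sum, Finset.mul_sum]
    rw [Finset.sum_comm]
    refine Finset.sum_congr rfl fun j hj => ?_
    rw [mul_comm f, lext_mul_eq_sum F f (hM j hj), Finset.mul_sum]
    refine Finset.sum_congr rfl fun i _ => ?_
    have : l - (i : ℤ) - j = l - j - i := by ring
    rw [this]
    ring

/-- The finite sums in `prodCoeff` multiply each Laurent series `conv (F i) (P i)` by `f`. -/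
theorem finsum_coeff_mul_sum_conv {ι : Type*} (S : Finset ι) (a : ι → ℂ) (f : PowerSeries ℂ)
    (F : ι → PowerSeries ℂ) (P : ι → ℤ →₀ ℂ) (l : ℤ) :
    ∑ᶠ k : ℕ, PowerSeries.coeff k f * ∑ i ∈ S, a i * conv (F i) (P i) (l - k) =
      ∑ i ∈ S, a i * conv (f * F i) (P i) l := by
  have h := (Filter.eventually_all_finset S).2 fun i _ => eventually_conv_mul f (F i) (P i) l
  obtain ⟨M, hM⟩ := h.exists
  rw [finsum_eq_sum_of_support_subset (s := Finset.range M)]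
  · simp only [Finset.mul_sum]
    rw [Finset.sum_comm]
    refine Finset.sum_congr rfl fun i hi => ?_
    rw [← (hM i hi).2, Finset.mul_sum]
    refine Finset.sum_congr rfl fun k _ => ?_
    ring
  · intro k hk
    by_contra hk'
    have hk'' : M ≤ k := by simpa using hk'
    refine hk ?_
    simp only
    rw [Finset.sum_eq_zero, mul_zero]
    intro i hi
    rw [(hM i hi).1 k hk'', mul_zero]

theorem hasSum_lext {F : PowerSeries ℂ} {w s : ℂ}
    (h : HasSum (fun n : ℕ => PowerSeries.coeff n F * w ^ n) s) :
    HasSum (fun l : ℤ => lext F l * w ^ l) s := by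
  have hinj : Function.Injective (Nat.cast : ℕ → ℤ) := Nat.cast_injective
  rw [← hinj.hasSum_iff]
  · convert h using 2 with n
    simp [lext_natCast]
  · intro l hl
    have : l < 0 := by
      by_contra h'
      exact hl ⟨l.toNat, by simp at h'; simp [h']⟩
    rw [lext_of_neg _ this, zero_mul]

/-- The Laurent series with coefficients `conv F P` has the sum `F(w) P(w)`. -/
theorem hasSum_conv {F : PowerSeries ℂ} {w s : ℂ} (hw : w ≠ 0) (P : ℤ →₀ ℂ)
    (h : HasSum (fun n : ℕ => PowerSeries.coeff n F * w ^ n) s) :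
    HasSum (fun l : ℤ => conv F P l * w ^ l) (s * leval P w) := by
  have h1 : ∀ j : ℤ, HasSum (fun l : ℤ => P j * lext F (l - j) * w ^ l) (s * (P j * w ^ j)) := by
    intro j
    have h2 := ((Equiv.subRight j).hasSum_iff (f := fun l : ℤ => lext F l * w ^ l)).2
      (hasSum_lext h)
    have h3 : (fun l : ℤ => P j * lext F (l - j) * w ^ l) = fun l : ℤ =>
        ((fun l : ℤ => lext F l * w ^ l) ∘ Equiv.subRight j) l * (P j * w ^ j) := by
      funext l
      simp only [Function.comp_apply, Equiv.subRight_apply, zpow_sub₀ hw]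
      have : w ^ j ≠ 0 := zpow_ne_zero j hw
      field_simp
    rw [h3]
    exact h2.mul_right (P j * w ^ j)
  have h2 := hasSum_sum (s := P.support) fun j _ => h1 j
  rw [← Finset.mul_sum] at h2
  simpa only [conv, leval, Finsupp.sum, Finset.sum_mul] using h2

/-- Two meromorphic functions on `ℂ \ {0}` that agree near `0` agree near every point. -/
theorem eventuallyEq_of_meromorphicOn {Φ Ψ : ℂ → ℂ} (hΦ : MeromorphicOn Φ {0}ᶜ)
    (hΨ : MeromorphicOn Ψ {0}ᶜ) (h : ∀ᶠ w in 𝓝[≠] (0 : ℂ), Φ w = Ψ w) {w₀ : ℂ} (hw₀ : w₀ ≠ 0) :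
    ∀ᶠ w in 𝓝[≠] w₀, Φ w = Ψ w := by
  have hconn : IsPreconnected ({0}ᶜ : Set ℂ) :=
    (isConnected_compl_singleton_of_one_lt_rank (by simp) 0).isPreconnected
  obtain ⟨w₁, hw₁, hw₁'⟩ : ∃ w₁ : ℂ, w₁ ≠ 0 ∧ ∀ᶠ w in 𝓝 w₁, Φ w - Ψ w = 0 := by
    obtain ⟨U, hU, hUo, hU0⟩ := eventually_nhds_iff.1 (eventually_nhdsWithin_iff.1 h)
    obtain ⟨w₁, hw₁⟩ := ((eventually_nhdsWithin_of_eventually_nhds (hUo.mem_nhds hU0)).and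
      (eventually_mem_nhdsWithin (a := (0 : ℂ)) (s := {0}ᶜ))).exists
    refine ⟨w₁, hw₁.2, ?_⟩
    filter_upwards [hUo.mem_nhds hw₁.1, isOpen_compl_singleton.mem_nhds hw₁.2] with w h1 h2
    rw [hU w h1 h2, sub_self]
  have hsub : MeromorphicOn (fun w => Φ w - Ψ w) {0}ᶜ := fun w hw => (hΦ w hw).sub (hΨ w hw)
  have htop : meromorphicOrderAt (fun w => Φ w - Ψ w) w₁ = ⊤ :=
    meromorphicOrderAt_eq_top_iff.2 (hw₁'.filter_mono nhdsWithin_le_nhds)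
  have htop₀ : meromorphicOrderAt (fun w => Φ w - Ψ w) w₀ = ⊤ := by
    by_contra hne
    exact hsub.meromorphicOrderAt_ne_top_of_isPreconnected hconn hw₀ hw₁ hne htop
  filter_upwards [meromorphicOrderAt_eq_top_iff.1 htop₀] with w hw
  exact sub_eq_zero.1 hw

/-- A fusion limit can be read off from any explicit meromorphic continuation. -/
theorem HasFusionLimit.eq_sum {ι : Type*} {S : Finset ι} {a L : ι → ℂ} {F : ι → PowerSeries ℂ}
    {ρ : ι → ℂ → ℂ} {P : ι → ℤ →₀ ℂ} {G : ℤ → ℂ} {w₀ L' : ℂ} (hw₀ : w₀ ≠ 0)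
    (hF : ∀ i ∈ S, ∀ᶠ w in 𝓝 (0 : ℂ), HasSum (fun n : ℕ => PowerSeries.coeff n (F i) * w ^ n)
      (ρ i w))
    (hmer : ∀ i ∈ S, ∀ w, MeromorphicAt (ρ i) w)
    (hlim : ∀ i ∈ S, Tendsto (fun w => (1 - w / w₀) * ρ i w) (𝓝[≠] w₀) (𝓝 (L i)))
    (hG : ∀ l, G l = ∑ i ∈ S, a i * conv (F i) (P i) l) (h : HasFusionLimit G w₀ L') :
    L' = ∑ i ∈ S, a i * (L i * leval (P i) w₀) := by
  obtain ⟨Φ, hΦ, hsum, hL⟩ := h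
  set Ψ : ℂ → ℂ := fun w => ∑ i ∈ S, a i * (ρ i w * leval (P i) w) with hΨ
  have hleval : ∀ (P : ℤ →₀ ℂ) (w : ℂ), w ≠ 0 → AnalyticAt ℂ (leval P) w := by
    intro P w hw
    refine Finset.analyticAt_fun_sum _ fun j _ => ?_
    exact analyticAt_const.mul (analyticAt_id.zpow hw)
  have hΨm : MeromorphicOn Ψ {0}ᶜ := by
    intro w hw
    refine MeromorphicAt.fun_sum fun i hi => ?_
    exact (MeromorphicAt.const _ _).mul ((hmer i hi w).mul (hleval _ w hw).meromorphicAt)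
  have hnear : ∀ᶠ w in 𝓝[≠] (0 : ℂ), Φ w = Ψ w := by
    have h1 := (Filter.eventually_all_finset S).2 hF
    filter_upwards [hsum, eventually_nhdsWithin_of_eventually_nhds h1, self_mem_nhdsWithin]
      with w hw1 hw2 hw3
    refine hw1.unique ?_
    have h2 := hasSum_sum (s := S) fun i hi => (hasSum_conv hw3 (P i) (hw2 i hi)).mul_left (a i)
    simpa only [hG, Finset.sum_mul, mul_assoc] using h2
  have hat := eventuallyEq_of_meromorphicOn hΦ hΨm hnear hw₀
  have hL2 : Tendsto (fun w => (1 - w / w₀) * Ψ w) (𝓝[≠] w₀)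
      (𝓝 (∑ i ∈ S, a i * (L i * leval (P i) w₀))) := by
    have h1 := tendsto_finsetSum S fun i hi =>
      ((hlim i hi).mul ((hleval (P i) w₀ hw₀).continuousAt.tendsto.mono_left
        nhdsWithin_le_nhds)).const_mul (a i)
    refine h1.congr fun w => ?_
    rw [hΨ, Finset.mul_sum]
    refine Finset.sum_congr rfl fun i _ => ?_
    ring
  refine tendsto_nhds_unique (hL.congr' ?_) hL2
  filter_upwards [hat] with w hw
  rw [hw]

variable {N : ℕ} {ℓ : ℂ} {r : ℝ}

/-- The fusion limit of two finite linear combinations of vertex operators. -/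
theorem HasFusionLimit.eq_sum_normal {ι : Type*} {S : Finset ι} {a L : ι → ℂ}
    {E F : ι → VOData N} (hE : ∀ i, (E i).Commutes ℓ r) (hF : ∀ i, (F i).Commutes ℓ r)
    {A B : VertexOperator ℂ (Fock N ℓ r)}
    {f : PowerSeries ℂ} {ρ : ι → ℂ → ℂ} {w₀ L' : ℂ} (hw₀ : w₀ ≠ 0)
    {v : Fock N ℓ r} {φ : Module.Dual ℂ (Fock N ℓ r)} {n : ℤ}
    (hAB : ∀ k l : ℤ, HVertexOperator.coeff A k (HVertexOperator.coeff B l v) =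
      ∑ i ∈ S, a i • HVertexOperator.coeff ((E i).toVertexOperator ℓ r (hE i)) k
        (HVertexOperator.coeff ((F i).toVertexOperator ℓ r (hF i)) l v))
    (hρ : ∀ i ∈ S, ∀ᶠ w in 𝓝 (0 : ℂ), HasSum (fun n : ℕ => PowerSeries.coeff n
      (f * expSeries ((E i).contraction (F i) ℓ r)) * w ^ n) (ρ i w))
    (hmer : ∀ i ∈ S, ∀ w, MeromorphicAt (ρ i) w)
    (hlim : ∀ i ∈ S, Tendsto (fun w => (1 - w / w₀) * ρ i w) (𝓝[≠] w₀) (𝓝 (L i)))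
    (h : HasFusionLimit (prodCoeff f A B v φ n) w₀ L') :
    L' = ∑ i ∈ S, a i * (L i * φ (HVertexOperator.coeff
      ((((E i).rescale w₀⁻¹).normal (F i)).toVertexOperator ℓ r
        (((hE i).rescale w₀⁻¹).normal (hF i))) n v)) := by
  choose P hP hP' using fun i => exists_conv_contraction (E i) (F i) (hE i) (hF i) v φ n
  rw [HasFusionLimit.eq_sum (a := a) (P := P) hw₀ hρ hmer hlim ?_ h]
  · exact Finset.sum_congr rfl fun i _ => by rw [hP' i w₀ hw₀]
  · intro l
    rw [← finsum_coeff_mul_sum_conv, prodCoeff]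
    refine finsum_congr fun k => ?_
    rw [hAB, map_sum]
    congr 1
    refine Finset.sum_congr rfl fun i _ => ?_
    have h1 : (k : ℤ) - l = -(l - k) := by ring
    have h2 : n + l - k = n + (l - k) := by ring
    rw [← hP, map_smul, smul_eq_mul, h1, h2]

end

/-! ### Identities for a single mode -/

section Mode

variable (N : ℕ) (t : ℂ)

/-- The coefficient of `h^{(l+1)}_{-m}` in the `q`-th current modulo `ΔH_{-m}`, without the factor
`(1 - q₁ ^ m) (1 - q₃ ^ m) a_{l+1} ^ (-m)`; here `t = x ^ m`. -/
noncomputable def crMode (q l : ℕ) : ℂ :=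
  if q < N then if l = q then t ^ (2 * (N : ℤ) - 2 * l - 1) else 0
  else if q = N then 1 - t⁻¹
  else if l < 2 * N - q then 1 - t⁻¹ ^ 2 else if l = 2 * N - q then -t⁻¹ ^ 2 else 0

/-- The coefficient of `h^{(l+1)}_m` in the `q`-th undressed current, without the factor
`(1 - q₁ ^ m) (1 - q₃ ^ m) (x a_{l+1}) ^ (-m)`. -/
noncomputable def anMode (q l : ℕ) : ℂ :=
  if q < N then if l = q then 1 else if q < l then 1 - t⁻¹ ^ 2 else 0
  else if q = N then 0
  else if l = 2 * N - q then -t ^ (2 * (N : ℤ) - 2 * l - 1) else 0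

/-- The exponent of the factor of the exchange function that only depends on the order of the two
currents. -/
noncomputable def orderMode (s q : ℕ) : ℂ := if s < q then t⁻¹ else if q < s then t else 0

/-- The telescoping form of `∑_{l' ≥ l} (1 - t⁻²) p_{l'} R_q(l')`, `p_l = t ^ (2 l + 1 - 2 N)`. -/
noncomputable def tailMode (q l : ℕ) : ℂ :=
  if q < N then if l ≤ q then 1 - t⁻¹ ^ 2 else 0
  else if q = N then (1 - t⁻¹) * (t⁻¹ - t ^ (2 * (l : ℤ) - 1 - 2 * N))
  else if l ≤ 2 * N - q then -((1 - t⁻¹ ^ 2) * t ^ (2 * (l : ℤ) - 1 - 2 * N)) else 0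

variable {N t}

theorem tailMode_sub (ht : t ≠ 0) {q l : ℕ} (hl : l < N) :
    t ^ (2 * (l : ℤ) + 1 - 2 * N) * (1 - t⁻¹ ^ 2) * crMode N t q l =
      tailMode N t q l - tailMode N t q (l + 1) := by
  have e1 : t ^ (2 * (l : ℤ) - 1 - 2 * N) = t ^ (2 * (l : ℤ) + 1 - 2 * N) * t⁻¹ ^ 2 := by
    rw [← zpow_natCast, inv_zpow', ← zpow_add₀ ht]; congr 1; push_cast; ring
  have e2 : 2 * ((l + 1 : ℕ) : ℤ) - 1 - 2 * N = 2 * (l : ℤ) + 1 - 2 * N := by push_cast; ring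
  have e3 : t ^ (2 * (N : ℤ) - 2 * l - 1) * t ^ (2 * (l : ℤ) + 1 - 2 * N) = 1 := by
    rw [← zpow_add₀ ht, ← zpow_zero t]; congr 1; ring
  simp only [tailMode, crMode, e2, e1]
  generalize t ^ (2 * (l : ℤ) + 1 - 2 * N) = p at *
  rcases lt_trichotomy q N with h | h | h
  · rcases lt_trichotomy l q with h' | h' | h'
    · simp [h, h'.ne, h'.le, Nat.succ_le_of_lt h']
    · subst h'
      simp only [h, if_true, le_refl, Nat.not_succ_le_self, if_false]
      linear_combination (1 - t⁻¹ ^ 2) * e3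
    · simp [h, h'.ne', h'.not_ge, (h'.trans (Nat.lt_succ_self l)).not_ge]
  · subst h
    simp only [lt_irrefl, if_false, if_true]
    ring
  · have h1 : ¬ q < N := by omega
    have h2 : ¬ q = N := by omega
    simp only [h1, h2, if_false]
    rcases lt_trichotomy l (2 * N - q) with h' | h' | h'
    · have h3 : l ≤ 2 * N - q := h'.le
      have h4 : l + 1 ≤ 2 * N - q := h'
      simp only [h', h3, h4, if_true]
      ring
    · have h3 : l ≤ 2 * N - q := h'.le
      have h4 : ¬ l < 2 * N - q := by omega
      have h5 : ¬ l + 1 ≤ 2 * N - q := by omega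
      rw [if_neg h4, if_pos h', if_pos h3, if_neg h5]
      ring
    · have h3 : ¬ l ≤ 2 * N - q := by omega
      have h4 : ¬ l < 2 * N - q := by omega
      have h5 : ¬ l + 1 ≤ 2 * N - q := by omega
      have h6 : ¬ l = 2 * N - q := by omega
      simp [h3, h4, h5, h6]

theorem tailMode_last {q : ℕ} (hq : q ≤ 2 * N) : tailMode N t q N = 0 := by
  have e : 2 * (N : ℤ) - 1 - 2 * N = -1 := by ring
  simp only [tailMode, e, zpow_neg_one, sub_self, mul_zero]
  split_ifs <;> first | rfl | omega

theorem sum_tail_crMode (ht : t ≠ 0) {q : ℕ} (hq : q ≤ 2 * N) :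
    ∑ l ∈ Finset.range N, t ^ (2 * (l : ℤ) + 1 - 2 * N) * (1 - t⁻¹ ^ 2) * crMode N t q l =
      tailMode N t q 0 := by
  rw [Finset.sum_congr rfl fun l hl => tailMode_sub ht (Finset.mem_range.1 hl),
    Finset.sum_range_sub', tailMode_last hq, sub_zero]

theorem sum_anMode_crMode_of_lt (ht : t ≠ 0) {s q : ℕ} (hs : s < N) (hq : q ≤ 2 * N) :
    ∑ l ∈ Finset.range N, t ^ (2 * (l : ℤ) + 1 - 2 * N) * anMode N t s l * crMode N t q l =
      t ^ (2 * (s : ℤ) + 1 - 2 * N) * crMode N t q s + tailMode N t q (s + 1) := by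
  set V : ℕ → ℂ := fun l => if l ≤ s then
    t ^ (2 * (s : ℤ) + 1 - 2 * N) * crMode N t q s + tailMode N t q (s + 1) else tailMode N t q l
    with hV
  have hN0 : V N = 0 := by simp [hV, hs.not_ge, tailMode_last hq]
  have key : ∀ l ∈ Finset.range N,
      t ^ (2 * (l : ℤ) + 1 - 2 * N) * anMode N t s l * crMode N t q l = V l - V (l + 1) := by
    intro l hl
    simp only [hV, anMode, hs, if_true]
    rcases lt_trichotomy l s with h | h | h
    · simp [h.ne, h.le, h.not_gt, Nat.succ_le_of_lt h]
    · subst h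
      simp
    · rw [if_neg h.ne', if_pos h, if_neg h.not_ge, if_neg (by omega),
        tailMode_sub ht (Finset.mem_range.1 hl)]
  rw [Finset.sum_congr rfl key, Finset.sum_range_sub', hN0, sub_zero]
  simp [hV]

theorem sum_anMode_crMode_of_gt (ht : t ≠ 0) {s : ℕ} (hs : N < s) (hs' : s ≤ 2 * N) (q : ℕ) :
    ∑ l ∈ Finset.range N, t ^ (2 * (l : ℤ) + 1 - 2 * N) * anMode N t s l * crMode N t q l =
      -crMode N t q (2 * N - s) := by
  rw [Finset.sum_eq_single (2 * N - s)]
  · have h1 : ¬ s < N := by omega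
    have h2 : ¬ s = N := by omega
    simp only [anMode, h1, h2, if_false, if_true]
    generalize (2 * N - s) = l
    rw [mul_neg, ← zpow_add₀ ht]
    have : 2 * (l : ℤ) + 1 - 2 * N + (2 * N - 2 * l - 1) = 0 := by ring
    rw [this, zpow_zero]
    ring
  · intro l _ hl
    have h1 : ¬ s < N := by omega
    have h2 : ¬ s = N := by omega
    simp [anMode, h1, h2, hl]
  · intro h
    exact absurd (Finset.mem_range.2 (by omega)) h

/-- The contraction of two undressed currents, together with the total factor of the dressing. -/
theorem sum_anMode_crMode (ht : t ≠ 0) (hD : 1 + t ^ (-(2 * (N : ℤ) + 1)) ≠ 0) {s q : ℕ}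
    (hs : s ≤ 2 * N) (hq : q ≤ 2 * N) :
    t * ∑ l ∈ Finset.range N, t ^ (2 * (l : ℤ) + 1 - 2 * N) *
      (anMode N t s l - (1 - t⁻¹ ^ 2) / (1 + t ^ (-(2 * (N : ℤ) + 1)))) * crMode N t q l =
    (t⁻¹ + t ^ (-(2 * (N : ℤ)))) / (1 + t ^ (-(2 * (N : ℤ) + 1))) -
      (orderMode t s q + if s + q = 2 * N then t ^ ((s : ℤ) - q) else 0) := by
  have h1 : ∑ l ∈ Finset.range N, t ^ (2 * (l : ℤ) + 1 - 2 * N) *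
      (anMode N t s l - (1 - t⁻¹ ^ 2) / (1 + t ^ (-(2 * (N : ℤ) + 1)))) * crMode N t q l =
      ∑ l ∈ Finset.range N, t ^ (2 * (l : ℤ) + 1 - 2 * N) * anMode N t s l * crMode N t q l -
        (1 + t ^ (-(2 * (N : ℤ) + 1)))⁻¹ * tailMode N t q 0 := by
    rw [← sum_tail_crMode ht hq, Finset.mul_sum, ← Finset.sum_sub_distrib]
    refine Finset.sum_congr rfl fun l _ => ?_
    ring
  have e1 : t ^ (-(2 * (N : ℤ) + 1)) = t ^ (-(2 * (N : ℤ))) * t⁻¹ := by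
    rw [← zpow_neg_one, ← zpow_add₀ ht]; congr 1; ring
  have e2 : t ^ (2 * ((0 : ℕ) : ℤ) - 1 - 2 * N) = t ^ (-(2 * (N : ℤ))) * t⁻¹ := by
    rw [← zpow_neg_one, ← zpow_add₀ ht]; congr 1; push_cast; ring
  have hti : t * t⁻¹ = 1 := mul_inv_cancel₀ ht
  -- the common contribution of the dressing and of the structure function
  have h2 : t * ((1 + t ^ (-(2 * (N : ℤ) + 1)))⁻¹ * tailMode N t q 0) +
      (t⁻¹ + t ^ (-(2 * (N : ℤ)))) / (1 + t ^ (-(2 * (N : ℤ) + 1))) =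
      if q < N then t else if q = N then 1 else t⁻¹ := by
    rw [div_eq_inv_mul, mul_left_comm, ← mul_add, inv_mul_eq_iff_eq_mul₀ hD]
    simp only [tailMode, e2, e1, Nat.zero_le, if_true]
    generalize t ^ (-(2 * (N : ℤ))) = T
    split_ifs
    · linear_combination (-t⁻¹ - T) * hti
    · linear_combination (t⁻¹ - t⁻¹ - T + 1 + T * t⁻¹ - t⁻¹) * hti
    · linear_combination (t⁻¹ ^ 2 * T - T) * hti
  rw [h1, mul_sub, sub_eq_iff_eq_add]
  have h3 : t * ∑ l ∈ Finset.range N, t ^ (2 * (l : ℤ) + 1 - 2 * N) * anMode N t s l *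
      crMode N t q l = (if q < N then t else if q = N then 1 else t⁻¹) -
      (orderMode t s q + if s + q = 2 * N then t ^ ((s : ℤ) - q) else 0) := by
    have e3 : 2 * ((s + 1 : ℕ) : ℤ) - 1 - 2 * N = 2 * (s : ℤ) + 1 - 2 * N := by push_cast; ring
    rcases lt_trichotomy s N with h | h | h
    · rw [sum_anMode_crMode_of_lt ht h hq]
      have e4 : t ^ (2 * (s : ℤ) + 1 - 2 * N) * t ^ (2 * (N : ℤ) - 2 * s - 1) = 1 := by
        rw [← zpow_add₀ ht, ← zpow_zero t]; congr 1; ring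
      simp only [crMode, tailMode, e3, orderMode]
      rcases lt_trichotomy q N with hqN | hqN | hqN
      · have h4 : ¬ s + q = 2 * N := by omega
        rcases lt_trichotomy s q with h5 | h5 | h5
        · simp only [hqN, if_true, h4, if_false, h5.ne, h5, Nat.succ_le_of_lt h5]
          linear_combination (-t⁻¹) * hti
        · subst h5
          simp only [hqN, if_true, h4, if_false, lt_irrefl, Nat.not_succ_le_self]
          linear_combination t * e4
        · have h6 : ¬ s + 1 ≤ q := by omega
          simp [hqN, h4, h5, h5.ne', h5.not_gt, h6]
      · subst hqN
        have h4 : ¬ s + q = 2 * q := by omega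
        simp only [lt_irrefl, if_false, if_true, h4, h]
        linear_combination (1 - t⁻¹) * hti
      · have h4 : ¬ q < N := by omega
        have h5 : ¬ q = N := by omega
        have h6 : s < q := by omega
        simp only [h4, h5, h6, if_false, if_true]
        rcases lt_trichotomy s (2 * N - q) with h7 | h7 | h7
        · have h8 : ¬ s + q = 2 * N := by omega
          simp only [h7, h8, Nat.succ_le_of_lt h7, if_true, if_false]
          ring
        · have h8 : s + q = 2 * N := by omega
          have h9 : ¬ s + 1 ≤ 2 * N - q := by omega
          have e5 : t ^ ((s : ℤ) - q) = t ^ (2 * (s : ℤ) + 1 - 2 * N) * t⁻¹ := by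
            rw [← zpow_neg_one, ← zpow_add₀ ht]; congr 1; omega
          rw [if_neg h7.not_lt, if_pos h7, if_neg h9, if_pos h8, e5]
          linear_combination (-t⁻¹ * t ^ (2 * (s : ℤ) + 1 - 2 * N)) * hti
        · have h8 : ¬ s + q = 2 * N := by omega
          have h9 : ¬ s + 1 ≤ 2 * N - q := by omega
          simp [h8, h9, h7.not_gt, h7.ne']
    · subst h
      have h4 : ∀ l, anMode s t s l = 0 := fun l => by simp [anMode]
      simp only [h4, mul_zero, zero_mul, Finset.sum_const_zero, orderMode]
      rcases lt_trichotomy q s with h5 | h5 | h5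
      · have h6 : ¬ s + q = 2 * s := by omega
        simp [h5, h5.not_gt, h6]
      · subst h5
        simp [two_mul]
      · have h6 : ¬ s + q = 2 * s := by omega
        simp [h5, h5.not_gt, h6, h5.ne']
    · rw [sum_anMode_crMode_of_gt ht h hs]
      simp only [crMode, orderMode]
      rcases lt_trichotomy q N with hqN | hqN | hqN
      · have h4 : ¬ s < q := by omega
        have h5 : q < s := by omega
        simp only [hqN, if_true, h4, h5, if_false]
        by_cases h6 : s + q = 2 * N
        · have h7 : 2 * N - s = q := by omega
          have e5 : t ^ ((s : ℤ) - q) = t * t ^ (2 * (N : ℤ) - 2 * q - 1) := by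
            rw [← zpow_one_add₀ ht]; congr 1; omega
          rw [if_pos h7, if_pos h6, e5, h7]
          ring
        · have h7 : ¬ 2 * N - s = q := by omega
          simp [h6, h7]
      · subst hqN
        have h4 : ¬ s + q = 2 * q := by omega
        simp only [lt_irrefl, if_false, if_true, h4, h, h.not_gt]
        linear_combination hti
      · have h4 : ¬ q < N := by omega
        have h5 : ¬ q = N := by omega
        have h6 : ¬ s + q = 2 * N := by omega
        simp only [h4, h5, h6, if_false]
        rcases lt_trichotomy s q with h7 | h7 | h7
        · have h8 : ¬ 2 * N - s < 2 * N - q := by omega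
          have h9 : ¬ 2 * N - s = 2 * N - q := by omega
          simp [h7, h8, h9]
        · subst h7
          simp only [lt_irrefl, if_false, if_true]
          linear_combination t⁻¹ * hti
        · have h8 : 2 * N - s < 2 * N - q := by omega
          simp only [h7, h8, h7.not_gt, if_false, if_true]
          linear_combination t⁻¹ * hti
  rw [h3, ← h2]
  ring

end Mode

/-! ### Sums over sets of positions -/

section

/-- The number of elements of `Ω` before the position `q`. -/
def rank (Ω : Finset ℕ) (q : ℕ) : ℕ := (Ω.filter (· < q)).card

/-- The number of elements of `Ω` before `q` minus the number of elements at or after `q`. -/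
def gap (Ω : Finset ℕ) (q : ℕ) : ℤ := 2 * rank Ω q - Ω.card

theorem rank_zero (Ω : Finset ℕ) : rank Ω 0 = 0 := by simp [rank]

theorem rank_succ (Ω : Finset ℕ) (q : ℕ) :
    rank Ω (q + 1) = rank Ω q + if q ∈ Ω then 1 else 0 := by
  have h : Ω.filter (· < q + 1) = Ω.filter (· < q) ∪ Ω.filter (· = q) := by
    ext a; simp only [Finset.mem_filter, Finset.mem_union]; grind
  rw [rank, rank, h, Finset.card_union_of_disjoint]
  · congr 1
    rw [Finset.filter_eq']
    split_ifs <;> simp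
  · rw [Finset.disjoint_left]
    simp only [Finset.mem_filter]
    omega

theorem rank_of_subset_range {Ω : Finset ℕ} {M : ℕ} (h : Ω ⊆ Finset.range M) :
    rank Ω M = Ω.card := by
  rw [rank, Finset.filter_true_of_mem fun q hq => Finset.mem_range.1 (h hq)]

theorem gap_succ (Ω : Finset ℕ) (q : ℕ) :
    gap Ω (q + 1) = gap Ω q + if q ∈ Ω then 2 else 0 := by
  rw [gap, gap, rank_succ]
  split_ifs <;> push_cast <;> ring

theorem gap_zero (Ω : Finset ℕ) : gap Ω 0 = -(Ω.card : ℤ) := by simp [gap, rank_zero]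

theorem gap_of_subset_range {Ω : Finset ℕ} {M : ℕ} (h : Ω ⊆ Finset.range M) :
    gap Ω M = Ω.card := by
  rw [gap, rank_of_subset_range h]; ring

/-- Telescoping along the positions, with different terms inside and outside of `Ω`. -/
theorem sum_telescope {Ω : Finset ℕ} {M : ℕ} (hΩ : Ω ⊆ Finset.range M) (f g V : ℕ → ℂ)
    (h : ∀ q < M, (if q ∈ Ω then f q else -g q) = V (q + 1) - V q) :
    ∑ q ∈ Ω, f q - ∑ q ∈ Finset.range M \ Ω, g q = V M - V 0 := by
  rw [← Finset.sum_range_sub, ← Finset.sum_congr rfl fun q hq => h q (Finset.mem_range.1 hq),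
    Finset.sum_ite, Finset.sum_neg_distrib, sub_eq_add_neg]
  congr 1
  · rw [Finset.filter_mem_eq_inter, Finset.inter_eq_right.2 hΩ]
  · rw [Finset.filter_notMem_eq_sdiff]

variable {N : ℕ} {t : ℂ} {Ω : Finset ℕ} {M : ℕ}

theorem sum_zpow_gap (ht : t ≠ 0) (hΩ : Ω ⊆ Finset.range M) :
    (t - t⁻¹) * ∑ q ∈ Ω, t ^ (gap Ω q + 1) = t ^ (Ω.card : ℤ) - t ^ (-(Ω.card : ℤ)) := by
  have h := sum_telescope hΩ (fun q => (t - t⁻¹) * t ^ (gap Ω q + 1)) (fun _ => 0)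
    (fun q => t ^ gap Ω q) fun q _ => by
      rw [gap_succ]
      split_ifs
      · simp only [zpow_add₀ ht, zpow_one, zpow_two]
        field_simp
      · simp
  rw [Finset.mul_sum]
  simpa [gap_zero, gap_of_subset_range hΩ] using h

theorem sum_zpow_neg_gap (ht : t ≠ 0) (hΩ : Ω ⊆ Finset.range M) :
    (t - t⁻¹) * ∑ q ∈ Ω, t ^ (-(gap Ω q + 1)) = t ^ (Ω.card : ℤ) - t ^ (-(Ω.card : ℤ)) := by
  have h := sum_telescope hΩ (fun q => (t - t⁻¹) * t ^ (-(gap Ω q + 1))) (fun _ => 0)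
    (fun q => -t ^ (-gap Ω q)) fun q _ => by
      rw [gap_succ]
      split_ifs
      · simp only [zpow_add₀ ht, zpow_neg, zpow_one, zpow_two]
        field_simp
        ring
      · simp
  rw [Finset.mul_sum]
  rw [Finset.sum_const_zero, sub_zero, gap_zero, gap_of_subset_range hΩ, neg_neg] at h
  rw [h]; ring

/-- The exchange factors that depend on the order only, summed over the currents in `Ω`. -/
theorem sum_zpow_gap_orderMode (ht : t ≠ 0) (hΩ : Ω ⊆ Finset.range M) {s : ℕ} (hs : s < M) :
    (t - t⁻¹) * ∑ q ∈ Ω, t ^ (gap Ω q + 1) * orderMode t s q =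
      t ^ ((Ω.card : ℤ) - 1) - t ^ (1 - (Ω.card : ℤ)) +
        if s ∈ Ω then 0 else (t - t⁻¹) * t ^ gap Ω s := by
  have h := sum_telescope hΩ (fun q => (t - t⁻¹) * (t ^ (gap Ω q + 1) * orderMode t s q))
    (fun _ => 0) (fun q => if q ≤ s then t ^ (gap Ω q + 1) else t ^ (gap Ω q - 1) +
      if s ∈ Ω then 0 else (t - t⁻¹) * t ^ gap Ω s) fun q _ => by
      rw [gap_succ]
      rcases lt_trichotomy q s with h | h | h
      · simp only [orderMode, h.not_gt, h, h.le, Nat.succ_le_of_lt h, if_true, if_false]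
        split_ifs
        · simp only [zpow_add₀ ht, zpow_one, zpow_two]
          field_simp
        · simp
      · subst h
        simp only [orderMode, lt_irrefl, le_refl, Nat.not_succ_le_self, if_true, if_false]
        split_ifs
        · simp only [zpow_add₀ ht, zpow_sub₀ ht, zpow_one, zpow_two]
          field_simp
          ring
        · simp only [zpow_add₀ ht, zpow_sub₀ ht, zpow_one]
          field_simp
          ring
      · have h' : ¬ q + 1 ≤ s := by omega
        simp only [orderMode, h, h.not_ge, h', if_true, if_false]
        split_ifs
        · simp only [zpow_add₀ ht, zpow_sub₀ ht, zpow_one, zpow_two]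
          field_simp
          ring
        · simp only [zpow_add₀ ht, zpow_sub₀ ht, zpow_one, zpow_two]
          field_simp
          ring
        · simp
        · simp
  rw [Finset.mul_sum]
  rw [Finset.sum_const_zero, sub_zero] at h
  rw [h, if_pos (Nat.zero_le s), if_neg hs.not_ge, gap_zero, gap_of_subset_range hΩ]
  ring_nf

/-- The exponent of `t` at a position outside of `Ω`, read off from the dual set. -/
def dualGap (N : ℕ) (Ω : Finset ℕ) (q : ℕ) : ℤ := gap Ω q + 2 * N - 2 * q

theorem dualGap_succ (N : ℕ) (Ω : Finset ℕ) (q : ℕ) :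
    dualGap N Ω (q + 1) = dualGap N Ω q - if q ∈ Ω then 0 else 2 := by
  rw [dualGap, dualGap, gap_succ]
  split_ifs <;> push_cast <;> ring

theorem sum_zpow_neg_dualGap (ht : t ≠ 0) (hΩ : Ω ⊆ Finset.range (2 * N + 1)) :
    (t - t⁻¹) * ∑ q ∈ Finset.range (2 * N + 1) \ Ω, t ^ (-dualGap N Ω q) =
      t ^ (2 * (N : ℤ) + 1 - Ω.card) - t ^ ((Ω.card : ℤ) - 2 * N - 1) := by
  have h := sum_telescope hΩ (fun _ => 0) (fun q => (t - t⁻¹) * t ^ (-dualGap N Ω q))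
    (fun q => -t ^ (-dualGap N Ω q - 1)) fun q _ => by
      rw [dualGap_succ]
      split_ifs
      · simp
      · simp only [zpow_sub₀ ht, zpow_neg, zpow_one, zpow_two]
        field_simp
        ring
  rw [Finset.mul_sum]
  rw [Finset.sum_const_zero, zero_sub, dualGap, dualGap, gap_zero, gap_of_subset_range hΩ] at h
  have e1 : -((Ω.card : ℤ) + 2 * N - 2 * ((2 * N + 1 : ℕ) : ℤ)) - 1 = 2 * (N : ℤ) + 1 - Ω.card := by
    push_cast; ring
  have e2 : -(-(Ω.card : ℤ) + 2 * N - 2 * ((0 : ℕ) : ℤ)) - 1 = (Ω.card : ℤ) - 2 * N - 1 := by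
    push_cast; ring
  rw [e1, e2] at h
  linear_combination -h

/-- The creation exponents of the normally ordered products over `Ω` and over its dual agree. -/
theorem sum_crMode_dual (ht : t ≠ 0) (hΩ : Ω ⊆ Finset.range (2 * N + 1)) {l : ℕ} (hl : l < N) :
    ∑ q ∈ Ω, t ^ (gap Ω q + 1) * crMode N t q l =
      ∑ q ∈ Finset.range (2 * N + 1) \ Ω, t ^ dualGap N Ω q * crMode N t (2 * N - q) l := by
  -- the form of the partial sums changes at the positions `l`, `N` and `2N - l`
  have h := sum_telescope hΩ (fun q => t ^ (gap Ω q + 1) * crMode N t q l)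
    (fun q => t ^ dualGap N Ω q * crMode N t (2 * N - q) l)
    (fun q => if q ≤ l then 0 else if q ≤ N then t ^ dualGap N Ω q
      else if q ≤ 2 * N - l then t ^ (gap Ω q - 1) else 0) fun q hq => ?_
  · rw [if_pos (Nat.zero_le l), if_neg (by omega), if_neg (by omega), if_neg (by omega),
      sub_zero] at h
    exact sub_eq_zero.1 h
  · rw [gap_succ, dualGap_succ]
    simp only [crMode]
    rcases lt_trichotomy q N with h | h | h
    · have h1 : ¬ 2 * N - q < N := by omega
      have h2 : ¬ 2 * N - q = N := by omega
      have h3 : 2 * N - (2 * N - q) = q := by omega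
      have h4 : q + 1 ≤ N := h
      simp only [h, h1, h2, h3, h.le, h4, if_true, if_false]
      rcases lt_trichotomy q l with h5 | h5 | h5
      · have h6 : ¬ l < q := by omega
        have h7 : ¬ l = q := by omega
        have h8 : q + 1 ≤ l := h5
        simp [h6, h7, h8, h5.le]
      · subst h5
        simp only [lt_irrefl, le_refl, Nat.not_succ_le_self, if_true, if_false, dualGap]
        split_ifs
        · simp only [zpow_add₀ ht, zpow_sub₀ ht, zpow_one, zpow_zero]
          field_simp
          ring
        · simp only [zpow_add₀ ht, zpow_sub₀ ht, zpow_two]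
          field_simp
          ring
      · have h6 : ¬ l = q := by omega
        have h7 : ¬ q ≤ l := by omega
        have h8 : ¬ q + 1 ≤ l := by omega
        simp only [h5, h6, h7, h8, if_true, if_false]
        split_ifs
        · simp
        · simp only [zpow_sub₀ ht, zpow_two]
          field_simp
          ring
    · subst h
      have h1 : 2 * q - q = q := by omega
      have h2 : ¬ q ≤ l := by omega
      have h3 : ¬ q + 1 ≤ l := by omega
      have h4 : ¬ q + 1 ≤ q := by omega
      have h5 : q + 1 ≤ 2 * q - l := by omega
      have h6 : dualGap q Ω q = gap Ω q := by rw [dualGap]; ring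
      simp only [h1, h2, h3, h4, h5, h6, lt_irrefl, le_refl, if_true, if_false]
      split_ifs
      · simp only [zpow_add₀ ht, zpow_sub₀ ht, zpow_one, zpow_two]
        field_simp
      · simp only [zpow_add₀ ht, zpow_sub₀ ht, zpow_one, zpow_zero]
        field_simp
        ring
    · have h1 : 2 * N - q < N := by omega
      have h2 : ¬ q < N := by omega
      have h3 : ¬ q = N := by omega
      have h4 : ¬ q ≤ N := by omega
      have h5 : ¬ q + 1 ≤ N := by omega
      have h6 : ¬ q ≤ l := by omega
      have h7 : ¬ q + 1 ≤ l := by omega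
      simp only [h1, h2, h3, h4, h5, h6, h7, if_true, if_false]
      rcases lt_trichotomy l (2 * N - q) with h8 | h8 | h8
      · have h9 : q ≤ 2 * N - l := by omega
        have h10 : q + 1 ≤ 2 * N - l := by omega
        simp only [h8, h9, h10, h8.ne, if_true, if_false]
        split_ifs
        · simp only [zpow_add₀ ht, zpow_sub₀ ht, zpow_one, zpow_two]
          field_simp
        · simp
      · have h9 : q ≤ 2 * N - l := by omega
        have h10 : ¬ q + 1 ≤ 2 * N - l := by omega
        have h11 : ¬ l < 2 * N - q := by omega
        rw [if_neg h11, if_pos h8, if_pos h8, if_pos h9, if_neg h10]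
        split_ifs
        · simp only [zpow_add₀ ht, zpow_sub₀ ht, zpow_one]
          field_simp
          ring
        · have h12 : (l : ℤ) = 2 * N - q := by omega
          rw [dualGap, ← zpow_add₀ ht, h12, zero_sub]
          congr 2
          ring
      · have h9 : ¬ q ≤ 2 * N - l := by omega
        have h10 : ¬ q + 1 ≤ 2 * N - l := by omega
        simp [h9, h10, h8.not_gt, h8.ne']

theorem sum_anMode_dual (ht : t ≠ 0) (hΩ : Ω ⊆ Finset.range (2 * N + 1)) {l : ℕ} (hl : l < N) :
    ∑ q ∈ Ω, t ^ (-(gap Ω q + 1)) * anMode N t q l -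
      ∑ q ∈ Finset.range (2 * N + 1) \ Ω, t ^ (-dualGap N Ω q) * anMode N t (2 * N - q) l =
    t ^ ((Ω.card : ℤ) - 1) - t ^ (2 * (N : ℤ) - Ω.card) := by
  have h := sum_telescope hΩ (fun q => t ^ (-(gap Ω q + 1)) * anMode N t q l)
    (fun q => t ^ (-dualGap N Ω q) * anMode N t (2 * N - q) l)
    (fun q => if q ≤ l then -t ^ (-gap Ω q - 1) else if q ≤ 2 * N - l then 0
      else -t ^ (-dualGap N Ω q - 2)) fun q hq => ?_
  · rw [h, if_pos (Nat.zero_le l), if_neg (by omega), if_neg (by omega), dualGap, gap_zero,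
      gap_of_subset_range hΩ, neg_neg, sub_neg_eq_add, neg_add_eq_sub]
    congr 2
    push_cast
    ring
  · rw [gap_succ, dualGap_succ]
    simp only [anMode]
    rcases lt_trichotomy q N with h | h | h
    · have h1 : ¬ 2 * N - q < N := by omega
      have h2 : ¬ 2 * N - q = N := by omega
      have h3 : 2 * N - (2 * N - q) = q := by omega
      have h4 : q ≤ 2 * N - l := by omega
      have h5 : q + 1 ≤ 2 * N - l := by omega
      simp only [h, h1, h2, h3, h4, h5, if_true, if_false]
      rcases lt_trichotomy q l with h6 | h6 | h6
      · have h7 : ¬ l = q := by omega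
        have h8 : q + 1 ≤ l := h6
        simp only [h6, h7, h8, h6.le, if_true, if_false]
        split_ifs
        · simp only [zpow_add₀ ht, zpow_sub₀ ht, zpow_neg, zpow_one, zpow_two]
          field_simp
          ring
        · simp
      · subst h6
        simp only [le_refl, Nat.not_succ_le_self, if_true, if_false, dualGap]
        split_ifs
        · rw [neg_add']; ring
        · rw [mul_neg, neg_neg, ← zpow_add₀ ht, zero_sub, neg_neg]
          congr 1
          ring
      · have h7 : ¬ l = q := by omega
        have h8 : ¬ q ≤ l := by omega
        have h9 : ¬ q + 1 ≤ l := by omega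
        simp [h6.not_gt, h7, h8, h9]
    · subst h
      have h1 : 2 * q - q = q := by omega
      have h2 : ¬ q ≤ l := by omega
      have h3 : ¬ q + 1 ≤ l := by omega
      have h4 : q ≤ 2 * q - l := by omega
      have h5 : q + 1 ≤ 2 * q - l := by omega
      simp [h1, h2, h3, h4, h5]
    · have h1 : 2 * N - q < N := by omega
      have h2 : ¬ q < N := by omega
      have h3 : ¬ q = N := by omega
      have h6 : ¬ q ≤ l := by omega
      have h7 : ¬ q + 1 ≤ l := by omega
      simp only [h1, h2, h3, h6, h7, if_true, if_false]
      rcases lt_trichotomy l (2 * N - q) with h8 | h8 | h8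
      · have h9 : q ≤ 2 * N - l := by omega
        have h10 : q + 1 ≤ 2 * N - l := by omega
        simp [h9, h10, h8.not_gt, h8.ne]
      · have h9 : q ≤ 2 * N - l := by omega
        have h10 : ¬ q + 1 ≤ 2 * N - l := by omega
        rw [if_pos h8, if_pos h8, if_pos h9, if_neg h10]
        split_ifs
        · have h12 : (l : ℤ) = 2 * N - q := by omega
          rw [dualGap, mul_neg, ← zpow_add₀ ht, h12, sub_zero]
          congr 2
          ring
        · rw [sub_zero]
          simp only [mul_one]
          congr 2
          ring
      · have h9 : ¬ q ≤ 2 * N - l := by omega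
        have h10 : ¬ q + 1 ≤ 2 * N - l := by omega
        simp only [h9, h10, h8, h8.ne', if_true, if_false]
        split_ifs
        · simp
        · simp only [zpow_sub₀ ht, zpow_neg, zpow_two]
          field_simp
          ring

/-- The annihilation exponents of the dressed normally ordered products over `Ω` and over its dual
agree. -/
theorem sum_anMode_dressed_dual (ht : t ≠ 0)
    (hD : 1 + t ^ (-(2 * (N : ℤ) + 1)) ≠ 0) (hΩ : Ω ⊆ Finset.range (2 * N + 1)) {l : ℕ}
    (hl : l < N) :
    ∑ q ∈ Ω, t ^ (-(gap Ω q + 1)) *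
        (anMode N t q l - (1 - t⁻¹ ^ 2) / (1 + t ^ (-(2 * (N : ℤ) + 1)))) =
      ∑ q ∈ Finset.range (2 * N + 1) \ Ω, t ^ (-dualGap N Ω q) *
        (anMode N t (2 * N - q) l - (1 - t⁻¹ ^ 2) / (1 + t ^ (-(2 * (N : ℤ) + 1)))) := by
  have h1 := sum_anMode_dual ht hΩ hl
  have h2 := sum_zpow_neg_gap ht hΩ
  have h3 := sum_zpow_neg_dualGap ht hΩ
  simp only [mul_sub, Finset.sum_sub_distrib, ← Finset.sum_mul]
  set A := ∑ q ∈ Ω, t ^ (-(gap Ω q + 1))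
  set B := ∑ q ∈ Finset.range (2 * N + 1) \ Ω, t ^ (-dualGap N Ω q)
  have h4 : (A - B) * ((1 - t⁻¹ ^ 2) / (1 + t ^ (-(2 * (N : ℤ) + 1)))) =
      t ^ ((Ω.card : ℤ) - 1) - t ^ (2 * (N : ℤ) - Ω.card) := by
    rw [mul_div_assoc', div_eq_iff hD]
    have h5 : (A - B) * (1 - t⁻¹ ^ 2) = t⁻¹ * ((t - t⁻¹) * A - (t - t⁻¹) * B) := by
      field_simp
    rw [h5, h2, h3]
    simp only [zpow_add₀ ht, zpow_sub₀ ht, zpow_neg, zpow_one]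
    field_simp
    ring
  linear_combination h1 - h4

end

/-! ### The currents and their contractions -/

section

variable {N : ℕ} {ℓ : ℂ} {r : ℝ}

theorem norm_pw_one_lt (hℓ : ℓ.re < 0) : ‖pw ℓ 1‖ < 1 := by
  rw [pw, one_mul, Complex.norm_exp]
  simpa using hℓ

theorem norm_pw_one_pow_lt (hℓ : ℓ.re < 0) {m : ℕ} (hm : 0 < m) : ‖pw ℓ 1 ^ m‖ < 1 := by
  rw [norm_pow]
  exact pow_lt_one₀ (norm_nonneg _) (norm_pw_one_lt hℓ) hm.ne'

theorem norm_zpow_ne_one {t : ℂ} (ht : t ≠ 0) (ht' : ‖t‖ < 1) {k : ℤ} (hk : k ≠ 0) :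
    ‖t ^ k‖ ≠ 1 := by
  rw [norm_zpow]
  intro h
  exact hk (zpow_right_injective₀ (norm_pos_iff.2 ht) ht'.ne (by simpa using h))

theorem one_add_zpow_ne_zero {t : ℂ} (ht : t ≠ 0) (ht' : ‖t‖ < 1) {k : ℤ} (hk : k ≠ 0) :
    1 + t ^ k ≠ 0 := by
  intro h
  refine norm_zpow_ne_one ht ht' hk ?_
  rw [eq_neg_of_add_eq_zero_right h, norm_neg, norm_one]

theorem one_sub_zpow_ne_zero {t : ℂ} (ht : t ≠ 0) (ht' : ‖t‖ < 1) {k : ℤ} (hk : k ≠ 0) :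
    1 - t ^ k ≠ 0 := by
  intro h
  refine norm_zpow_ne_one ht ht' hk ?_
  rw [← sub_eq_zero.1 h, norm_one]

theorem pw_intCast (ℓ : ℂ) (k : ℤ) : pw ℓ k = pw ℓ 1 ^ k := by
  rw [pw, pw, one_mul, ← Complex.exp_int_mul]

theorem pw_int_mul (ℓ : ℂ) (k : ℤ) (m : ℕ) : pw ℓ (k * m) = (pw ℓ 1 ^ m) ^ k := by
  rw [← zpow_natCast, ← zpow_mul, ← pw_intCast, mul_comm (m : ℤ)]
  push_cast
  rfl

/-- The product `(1 - q₁ ^ m) (1 - q₃ ^ m)`. -/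
noncomputable def eta (ℓ : ℂ) (r : ℝ) (m : ℕ) : ℂ := (1 - q₁ ℓ r ^ m) * (1 - q₃ ℓ r ^ m)

theorem s₂_pow (ℓ : ℂ) (m : ℕ) : s₂ ℓ ^ m = (pw ℓ 1 ^ m)⁻¹ := by
  rw [s₂, pw_neg, inv_pow]

theorem kap_eq (ℓ : ℂ) (r : ℝ) (m : ℕ) : kap ℓ r m = eta ℓ r m * (1 - (pw ℓ 1 ^ m)⁻¹ ^ 2) := by
  rw [kap, eta, q₂_eq, s₂_pow]; ring

theorem eta_ne_zero (hℓ : ℓ.re < 0) (hr : 1 < r) {m : ℕ} (hm : 0 < m) : eta ℓ r m ≠ 0 := by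
  have h := kap_ne_zero hℓ hr ⟨m, hm⟩
  rw [PNat.mk_coe, kap_eq] at h
  exact left_ne_zero_of_mul h

theorem kap_div (hℓ : ℓ.re < 0) (r : ℝ) {m : ℕ} (hm : 0 < m) :
    kap ℓ r m / (1 - q₂ ℓ ^ m) = eta ℓ r m := by
  have := one_sub_q₂_ne_zero hℓ ⟨m, hm⟩
  rw [PNat.mk_coe] at this
  rw [kap, eta, div_eq_iff this]; ring

theorem av_sq_pow (N : ℕ) (ℓ : ℂ) (m : ℕ) (l : Fin N) :
    (av N ℓ l)⁻¹ ^ m * (av N ℓ l)⁻¹ ^ m = (pw ℓ 1 ^ m) ^ (2 * ((l : ℕ) : ℤ) + 1 - 2 * N) := by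
  rw [av_sq, ev, ← pw_int_mul]; congr 2; push_cast; ring

theorem av_pow_eq (N : ℕ) (ℓ : ℂ) (m : ℕ) (l : Fin N) :
    av N ℓ l ^ m =
      (av N ℓ l)⁻¹ ^ m * (pw ℓ 1 ^ m) ^ (2 * (N : ℤ) - 2 * ((l : ℕ) : ℤ) - 1) := by
  have h : av N ℓ l ^ m ≠ 0 := pow_ne_zero _ (pw_ne_zero _ _)
  have e : 2 * (N : ℤ) - 2 * ((l : ℕ) : ℤ) - 1 = -(2 * ((l : ℕ) : ℤ) + 1 - 2 * N) := by ring
  rw [e, zpow_neg, ← av_sq_pow, inv_pow]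
  field_simp

/-- The coefficient of `h^{(l+1)}_{-m}` in the creation part, after `H_{-m}` is eliminated by
`ΔH_{-m} = 0`. -/
noncomputable def VOData.redCr (E : VOData N) (ℓ : ℂ) (r : ℝ) (l : Fin N) (m : ℕ) : ℂ :=
  E.cr (some l) m + kap ℓ r m * (av N ℓ l)⁻¹ ^ m * E.cr none m

theorem gen_none (N : ℕ) (ℓ : ℂ) (r : ℝ) (m : ℕ+) :
    gen N ℓ r (none, m) = ∑ l : Fin N, (kap ℓ r m * (av N ℓ l)⁻¹ ^ (m : ℕ)) •
      gen N ℓ r (some l, m) := by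
  have h0 : toFock N ℓ r (dH N ℓ r m) = 0 :=
    Ideal.Quotient.eq_zero_iff_mem.2 (Ideal.subset_span ⟨m, rfl⟩)
  have h1 : ∀ c : ℂ, toFock N ℓ r (MvPolynomial.C c) = algebraMap ℂ (Fock N ℓ r) c := fun _ => rfl
  simp only [dH, map_add, map_sum, map_mul, h1, Fintype.sum_option, dHcr, map_one, one_mul, map_neg,
    neg_mul, Finset.sum_neg_distrib] at h0
  rw [gen, add_neg_eq_zero.1 h0]
  refine Finset.sum_congr rfl fun l _ => ?_
  rw [Algebra.smul_def, map_mul]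
  rfl

theorem VOData.creation_eq_redCr (E : VOData N) :
    E.creation ℓ r = expSeries fun m : ℕ =>
      ∑ l : Fin N, E.redCr ℓ r l m • gen N ℓ r (some l, m.toPNat') := by
  rw [VOData.creation_eq]
  refine expSeries_congr fun m hm => ?_
  have hm' : ((m.toPNat' : ℕ+) : ℕ) = m := by simp [hm]
  rw [Fintype.sum_option, gen_none, hm', Finset.smul_sum, ← Finset.sum_add_distrib]
  refine Finset.sum_congr rfl fun l _ => ?_
  rw [VOData.redCr, smul_smul, ← add_smul]
  congr 1
  ring

theorem VOData.Commutes.an_none_mul_br {E : VOData N} (hE : E.Commutes ℓ r) (m : ℕ+) :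
    E.an none m * br N ℓ r none m = ∑ l : Fin N, kap ℓ r m * (av N ℓ l)⁻¹ ^ (m : ℕ) *
      (E.an (some l) m * br N ℓ r (some l) m) := by
  have h := hE m
  simp only [Fintype.sum_option, dHcr, one_mul, neg_mul, Finset.sum_neg_distrib] at h
  exact add_neg_eq_zero.1 h

theorem VOData.contraction_eq_redCr {E : VOData N} (hE : E.Commutes ℓ r) (F : VOData N) {m : ℕ}
    (hm : 0 < m) : E.contraction F ℓ r m =
      ∑ l : Fin N, E.an (some l) m * br N ℓ r (some l) m * F.redCr ℓ r l m := by
  have h := hE.an_none_mul_br ⟨m, hm⟩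
  rw [PNat.mk_coe] at h
  rw [VOData.contraction, Fintype.sum_option, h, Finset.sum_mul, ← Finset.sum_add_distrib]
  refine Finset.sum_congr rfl fun l _ => ?_
  rw [VOData.redCr]
  ring

/-- Vertex operators that commute with all `ΔH_{-m}` are determined by their constants and by the
exponents of the bosons `h`. -/
theorem toVertexOperator_congr_redCr {E E' : VOData N} (hE : E.Commutes ℓ r)
    (hE' : E'.Commutes ℓ r) (h0 : E.const = E'.const)
    (h1 : ∀ l (m : ℕ), 0 < m → E.redCr ℓ r l m = E'.redCr ℓ r l m)
    (h2 : ∀ l (m : ℕ), 0 < m → E.an (some l) m = E'.an (some l) m) :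
    E.toVertexOperator ℓ r hE = E'.toVertexOperator ℓ r hE' := by
  refine toVertexOperator_congr hE hE' h0 ?_ ?_
  · rw [VOData.creation_eq_redCr, VOData.creation_eq_redCr]
    refine expSeries_congr fun m hm => ?_
    simp only [h1 _ m hm]
  · rintro (_ | l) m
    · rw [hE.an_none_mul_br, hE'.an_none_mul_br]
      simp only [h2 _ m m.pos]
    · rw [h2 l m m.pos]

/-- The dressed current at the position `q` in `1, …, N, 0, N̄, …, 1̄`, counted from `0`. -/
noncomputable def current (N : ℕ) (ℓ : ℂ) (r : ℝ) (u : Fin N → ℂ) (q : ℕ) : VOData N :=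
  (if h : q < N then lamPlus N ℓ r u ⟨q, h⟩
    else if h : 2 * N - q < N then lamMinus N ℓ r u ⟨2 * N - q, h⟩ else lamZero N ℓ).dressed ℓ r

theorem current_commutes (hℓ : ℓ.re < 0) (hr : 1 < r) (u : Fin N → ℂ) (q : ℕ) :
    (current N ℓ r u q).Commutes ℓ r := by
  unfold current
  split_ifs
  · exact lamPlus_commutes N hℓ hr u _
  · exact lamMinus_commutes N hℓ hr u _
  · exact lamZero_commutes N hℓ hr

theorem current_redCr (hℓ : ℓ.re < 0) (r : ℝ) (u : Fin N → ℂ) {q : ℕ} (hq : q ≤ 2 * N) (l : Fin N)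
    {m : ℕ} (hm : 0 < m) : (current N ℓ r u q).redCr ℓ r l m =
      eta ℓ r m * (av N ℓ l)⁻¹ ^ m * crMode N (pw ℓ 1 ^ m) q l := by
  have ht : pw ℓ 1 ^ m ≠ 0 := pow_ne_zero _ (pw_ne_zero _ _)
  have ht' := norm_pw_one_pow_lt hℓ hm
  rw [VOData.redCr, kap_eq]
  rcases lt_trichotomy q N with h | h | h
  · by_cases hl : l = ⟨q, h⟩
    · subst hl
      simp only [current, VOData.dressed, dif_pos h, lamPlus, if_true, mul_zero, add_zero,
        kap_div hℓ r hm, crMode, if_pos h]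
      rw [av_pow_eq]
      ring
    · have hl' : ¬ (l : ℕ) = q := fun h' => hl (Fin.ext h')
      simp [current, VOData.dressed, h, lamPlus, hl, crMode, hl']
  · subst h
    have h1 : ¬ 2 * q - q < q := by omega
    have h2 := one_add_zpow_ne_zero ht ht' (k := -1) (by norm_num)
    rw [zpow_neg_one] at h2
    simp only [current, VOData.dressed, lt_irrefl, dif_neg, not_false_eq_true, h1, lamZero,
      crMode, if_false, if_true, s₂_pow]
    rw [zero_add, ← div_eq_mul_inv, div_eq_iff h2]
    ring
  · have h1 : ¬ q < N := by omega
    have h2 : 2 * N - q < N := by omega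
    have h3 : ¬ q = N := by omega
    simp only [current, VOData.dressed, dif_neg h1, dif_pos h2, lamMinus, crMode, if_neg h1,
      if_neg h3, Fin.ext_iff, Fin.lt_def, kap_div hℓ r hm]
    simp only [kap_eq]
    rcases lt_trichotomy (l : ℕ) (2 * N - q) with h4 | h4 | h4
    · simp only [h4, h4.ne, h4.not_gt, if_true, if_false]
      ring
    · have h5 : (⟨2 * N - q, h2⟩ : Fin N) = l := Fin.ext h4.symm
      rw [if_pos h4, if_neg h4.not_lt, if_pos h4, h5]
      ring
    · simp only [h4, h4.ne', h4.not_gt, if_true, if_false]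
      ring

theorem current_an (hℓ : ℓ.re < 0) (r : ℝ) (u : Fin N → ℂ) {q : ℕ} (hq : q ≤ 2 * N) (l : Fin N)
    {m : ℕ} (hm : 0 < m) : (current N ℓ r u q).an (some l) m =
      eta ℓ r m * (pw ℓ 1 ^ m)⁻¹ * (av N ℓ l)⁻¹ ^ m * (anMode N (pw ℓ 1 ^ m) q l -
        (1 - (pw ℓ 1 ^ m)⁻¹ ^ 2) / (1 + (pw ℓ 1 ^ m) ^ (-(2 * (N : ℤ) + 1)))) := by
  have e1 : pw ℓ (-((2 * (N : ℂ) + 1) * m)) = (pw ℓ 1 ^ m) ^ (-(2 * (N : ℤ) + 1)) := by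
    rw [← pw_int_mul]; congr 1; push_cast; ring
  have e2 : ((s₂ ℓ)⁻¹ * av N ℓ l)⁻¹ ^ m = (pw ℓ 1 ^ m)⁻¹ * (av N ℓ l)⁻¹ ^ m := by
    rw [mul_inv, inv_inv, mul_pow, s₂_pow]
  have e3 : dKmu N ℓ r (some l) m = eta ℓ r m * (pw ℓ 1 ^ m)⁻¹ * (av N ℓ l)⁻¹ ^ m *
      ((1 - (pw ℓ 1 ^ m)⁻¹ ^ 2) / (1 + (pw ℓ 1 ^ m) ^ (-(2 * (N : ℤ) + 1)))) := by
    rw [dKmu, dHan, e1, e2, kap_eq, div_eq_mul_inv]; ring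
  rw [mul_sub, ← e3]
  rcases lt_trichotomy q N with h | h | h
  · simp only [current, VOData.dressed, dif_pos h, lamPlus, anMode, if_pos h, e2,
      kap_div hℓ r hm, s₂_pow, Fin.ext_iff, Fin.lt_def]
    simp only [kap_eq]
    rcases lt_trichotomy (l : ℕ) q with h4 | h4 | h4
    · simp [h4.ne, h4.not_gt]
    · have h5 : (⟨q, h⟩ : Fin N) = l := Fin.ext h4.symm
      rw [if_pos h4, if_pos h4, h5]
      ring
    · simp only [h4, h4.ne', if_true, if_false]
      ring
  · subst h
    have h1 : ¬ 2 * q - q < q := by omega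
    simp [current, VOData.dressed, h1, lamZero, anMode]
  · have h1 : ¬ q < N := by omega
    have h2 : 2 * N - q < N := by omega
    have h3 : ¬ q = N := by omega
    simp only [current, VOData.dressed, dif_neg h1, dif_pos h2, lamMinus, anMode, if_neg h1,
      if_neg h3, Fin.ext_iff, kap_div hℓ r hm, s₂_pow]
    by_cases h4 : (l : ℕ) = 2 * N - q
    · have h5 : (⟨2 * N - q, h2⟩ : Fin N) = l := Fin.ext h4.symm
      rw [if_pos h4, if_pos h4, h5, av_pow_eq]
      ring
    · simp [h4]

/-- The exponent `g m` for which `d(z) = exp (∑_{m ≥ 1} g m z ^ m)`. -/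
noncomputable def dExp (ℓ : ℂ) (r : ℝ) (m : ℕ) : ℂ := eta ℓ r m * (pw ℓ 1 ^ m)⁻¹ / m

/-- The contraction of two dressed currents: besides the common last term, there is a term that
depends on the order of the positions only, and one for pairs of bar images. -/
theorem contraction_current (hℓ : ℓ.re < 0) (hr : 1 < r) (u : Fin N → ℂ) {s q : ℕ}
    (hs : s ≤ 2 * N) (hq : q ≤ 2 * N) {m : ℕ} (hm : 0 < m) :
    (current N ℓ r u s).contraction (current N ℓ r u q) ℓ r m =
      dExp ℓ r m * ((orderMode (pw ℓ 1 ^ m) s q +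
          if s + q = 2 * N then (pw ℓ 1 ^ m) ^ ((s : ℤ) - q) else 0) -
        ((pw ℓ 1 ^ m)⁻¹ + (pw ℓ 1 ^ m) ^ (-(2 * (N : ℤ)))) /
          (1 + (pw ℓ 1 ^ m) ^ (-(2 * (N : ℤ) + 1)))) := by
  have ht : pw ℓ 1 ^ m ≠ 0 := pow_ne_zero _ (pw_ne_zero _ _)
  have ht' := norm_pw_one_pow_lt hℓ hm
  have hD := one_add_zpow_ne_zero ht ht' (k := -(2 * (N : ℤ) + 1)) (by omega)
  have hη := eta_ne_zero hℓ hr hm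
  have h2 := one_sub_zpow_ne_zero ht ht' (k := -2) (by norm_num)
  have e2 : (pw ℓ 1 ^ m) ^ (-2 : ℤ) = (pw ℓ 1 ^ m)⁻¹ ^ 2 := by
    rw [zpow_neg, inv_pow]; norm_cast
  rw [e2] at h2
  have hm' : (m : ℂ) ≠ 0 := by exact_mod_cast hm.ne'
  have key := sum_anMode_crMode ht hD hs hq
  rw [VOData.contraction_eq_redCr (current_commutes hℓ hr u s) _ hm]
  have h3 : ∀ l : Fin N, (current N ℓ r u s).an (some l) m * br N ℓ r (some l) m *
      (current N ℓ r u q).redCr ℓ r l m = -(dExp ℓ r m * (pw ℓ 1 ^ m *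
        ((pw ℓ 1 ^ m) ^ (2 * ((l : ℕ) : ℤ) + 1 - 2 * N) * (anMode N (pw ℓ 1 ^ m) s l -
          (1 - (pw ℓ 1 ^ m)⁻¹ ^ 2) / (1 + (pw ℓ 1 ^ m) ^ (-(2 * (N : ℤ) + 1)))) *
            crMode N (pw ℓ 1 ^ m) q l))) := by
    intro l
    rw [current_an hℓ r u hs l hm, current_redCr hℓ r u hq l hm, ← av_sq_pow]
    have hbr : br N ℓ r (some l) m = -(pw ℓ 1 ^ m) / (m * eta ℓ r m) := by
      rw [br, kap_eq, inv_pow, s₂_pow, inv_inv]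
      generalize pw ℓ 1 ^ m = t at *
      rw [div_eq_div_iff (mul_ne_zero hm' (mul_ne_zero hη h2)) (mul_ne_zero hm' hη)]
      field_simp
      ring
    rw [hbr, dExp]
    generalize anMode N (pw ℓ 1 ^ m) s l - (1 - (pw ℓ 1 ^ m)⁻¹ ^ 2) /
      (1 + (pw ℓ 1 ^ m) ^ (-(2 * (N : ℤ) + 1))) = S
    field_simp
  simp only [h3]
  rw [Finset.sum_neg_distrib, ← Finset.mul_sum, ← Finset.mul_sum, Fin.sum_univ_eq_sum_range
    (fun l : ℕ => (pw ℓ 1 ^ m) ^ (2 * (l : ℤ) + 1 - 2 * N) * (anMode N (pw ℓ 1 ^ m) s l -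
          (1 - (pw ℓ 1 ^ m)⁻¹ ^ 2) / (1 + (pw ℓ 1 ^ m) ^ (-(2 * (N : ℤ) + 1)))) *
            crMode N (pw ℓ 1 ^ m) q l), key]
  ring

end

/-! ### Normally ordered products of currents -/

section

variable {N : ℕ} {ℓ : ℂ} {r : ℝ}

/-- The normally ordered product `:∏_l 𝚲_{q_l}(x ^ (2 l - j - 1) z):` over a set
`Ω = {q_1 < ⋯ < q_j}` of positions. -/
noncomputable def fused (N : ℕ) (ℓ : ℂ) (r : ℝ) (u : Fin N → ℂ) (Ω : Finset ℕ) : VOData N where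
  const := ∏ q ∈ Ω, (current N ℓ r u q).const
  cr b m := ∑ q ∈ Ω, (pw ℓ 1 ^ m) ^ (gap Ω q + 1) * (current N ℓ r u q).cr b m
  an b m := ∑ q ∈ Ω, (pw ℓ 1 ^ m) ^ (-(gap Ω q + 1)) * (current N ℓ r u q).an b m

theorem fused_commutes (hℓ : ℓ.re < 0) (hr : 1 < r) (u : Fin N → ℂ) (Ω : Finset ℕ) :
    (fused N ℓ r u Ω).Commutes ℓ r := by
  intro m
  simp only [fused, Finset.sum_mul, Finset.mul_sum]
  rw [Finset.sum_comm, Finset.sum_eq_zero]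
  intro q _
  rw [← mul_zero ((pw ℓ 1 ^ (m : ℕ)) ^ (-(gap Ω q + 1))),
    ← current_commutes hℓ hr u q m, Finset.mul_sum]
  exact Finset.sum_congr rfl fun b _ => by ring

theorem contraction_fused (E : VOData N) (u : Fin N → ℂ) (Ω : Finset ℕ) (m : ℕ) :
    E.contraction (fused N ℓ r u Ω) ℓ r m = ∑ q ∈ Ω, (pw ℓ 1 ^ m) ^ (gap Ω q + 1) *
      E.contraction (current N ℓ r u q) ℓ r m := by
  simp only [VOData.contraction, fused, Finset.mul_sum]
  rw [Finset.sum_comm]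
  exact Finset.sum_congr rfl fun q _ => Finset.sum_congr rfl fun b _ => by ring

theorem redCr_fused (u : Fin N → ℂ) (Ω : Finset ℕ) (l : Fin N) (m : ℕ) :
    (fused N ℓ r u Ω).redCr ℓ r l m = ∑ q ∈ Ω, (pw ℓ 1 ^ m) ^ (gap Ω q + 1) *
      (current N ℓ r u q).redCr ℓ r l m := by
  simp only [VOData.redCr, fused, Finset.mul_sum]
  rw [← Finset.sum_add_distrib]
  exact Finset.sum_congr rfl fun q _ => by ring

theorem qn_int_mul (ℓ : ℂ) (k : ℤ) (m : ℕ) : qn ℓ (k * m) =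
    ((pw ℓ 1 ^ m) ^ k - (pw ℓ 1 ^ m) ^ (-k)) / (pw ℓ 1 - pw ℓ (-1)) := by
  have : -((k : ℂ) * m) = ((-k : ℤ) : ℂ) * m := by push_cast; ring
  rw [qn, this, pw_int_mul, pw_int_mul]

theorem pw_one_sub_ne_zero (hℓ : ℓ.re < 0) : pw ℓ 1 - pw ℓ (-1) ≠ 0 := by
  have h := one_sub_zpow_ne_zero (pw_ne_zero ℓ 1) (norm_pw_one_lt hℓ) (k := -2) (by norm_num)
  have h1 : pw ℓ (-1) = (pw ℓ 1)⁻¹ := pw_neg ℓ 1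
  have h0 := pw_ne_zero ℓ 1
  rw [h1]
  intro h2
  refine h ?_
  have h3 : pw ℓ 1 ^ (-2 : ℤ) = (pw ℓ 1)⁻¹ * (pw ℓ 1)⁻¹ := by
    rw [zpow_neg, ← mul_inv]; congr 1; exact zpow_two _
  rw [h3]
  linear_combination (pw ℓ 1)⁻¹ * h2 - mul_inv_cancel₀ h0

theorem dExp_eq (ℓ : ℂ) (r : ℝ) (m : ℕ) :
    dExp ℓ r m = -((pw ℓ ((r - 1) * m) - pw ℓ (-((r - 1) * m))) *
      (pw ℓ (r * m) - pw ℓ (-(r * m)))) / m := by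
  have e1 : q₁ ℓ r ^ m = pw ℓ (r * m) ^ 2 := by
    rw [q₁, pw_pow, pw_pow]; congr 1; push_cast; ring
  have e2 : q₃ ℓ r ^ m = (pw ℓ ((r - 1) * m))⁻¹ ^ 2 := by
    rw [q₃, ← pw_neg, pw_pow, pw_pow]; congr 1; push_cast; ring
  have e3 : pw ℓ (r * m) = pw ℓ ((r - 1) * m) * pw ℓ 1 ^ m := by
    rw [pw_pow, ← pw_add]; congr 1; ring
  have h1 := pw_ne_zero ℓ ((r - 1) * m)
  have h2 : pw ℓ 1 ^ m ≠ 0 := pow_ne_zero _ (pw_ne_zero _ _)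
  rw [dExp, eta, e1, e2, pw_neg, pw_neg, e3]
  congr 1
  field_simp
  ring

/-- The structure function `f_{1,j}` in terms of the exponents of `d`. -/
theorem fser_one_eq (hℓ : ℓ.re < 0) (r : ℝ) {j : ℕ} (hj : 1 ≤ j) :
    fser N ℓ r 1 j = expSeries fun m : ℕ => dExp ℓ r m *
      (((pw ℓ 1 ^ m) ^ (-(j : ℤ)) + (pw ℓ 1 ^ m) ^ ((j : ℤ) - 2 * N - 1)) /
        (1 + (pw ℓ 1 ^ m) ^ (-(2 * (N : ℤ) + 1)))) := by
  refine expSeries_congr fun m hm => ?_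
  have ht : pw ℓ 1 ^ m ≠ 0 := pow_ne_zero _ (pw_ne_zero _ _)
  have ht' := norm_pw_one_pow_lt hℓ hm
  have hD := one_add_zpow_ne_zero ht ht' (k := -(2 * (N : ℤ) + 1)) (by omega)
  have hx := pw_one_sub_ne_zero hℓ
  have h1 := one_sub_zpow_ne_zero ht ht' (k := 1) (by norm_num)
  have h2 := one_sub_zpow_ne_zero ht ht' (k := 2) (by norm_num)
  have hm' : (m : ℂ) ≠ 0 := by exact_mod_cast hm.ne'
  rw [min_eq_left hj, max_eq_right hj]
  have e1 : ((1 : ℕ) : ℂ) * m = ((1 : ℤ) : ℂ) * m := by norm_num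
  have e2 : ((N : ℂ) + 1 - j) * m = (((N : ℤ) + 1 - j : ℤ) : ℂ) * m := by push_cast; ring
  have e3 : ((N : ℂ) - j) * m = (((N : ℤ) - j : ℤ) : ℂ) * m := by push_cast; ring
  have e4 : ((N : ℂ) + 1) * m = (((N : ℤ) + 1 : ℤ) : ℂ) * m := by push_cast; ring
  have e5 : (N : ℂ) * m = ((N : ℤ) : ℂ) * m := by push_cast; ring
  have e6 : qn ℓ (m : ℂ) = qn ℓ (((1 : ℤ) : ℂ) * m) := by norm_num
  rw [e1, e2, e3, e4, e5, e6]
  simp only [qn_int_mul]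
  rw [dExp_eq, qn, qn]
  generalize pw ℓ ((r - 1) * m) - pw ℓ (-((r - 1) * m)) = A
  generalize pw ℓ (r * m) - pw ℓ (-(r * m)) = B
  generalize pw ℓ 1 ^ m = t at *
  generalize pw ℓ 1 - pw ℓ (-1) = D at *
  have e7 : ∀ k : ℤ, (t ^ (k + 1) - t ^ (-(k + 1))) / D - (t ^ k - t ^ (-k)) / D =
      (t - 1) / D * (t ^ k + t ^ (-k - 1)) := by
    intro k
    simp only [zpow_add₀ ht, zpow_sub₀ ht, neg_add, zpow_neg, zpow_one]
    field_simp
    ring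
  have e8 : (N : ℤ) + 1 - j = (N - j : ℤ) + 1 := by ring
  rw [e8, e7, e7]
  have h3 : t - 1 ≠ 0 := by
    rw [zpow_one] at h1
    intro h; exact h1 (by linear_combination -h)
  have h4 : t ^ (1 : ℤ) - t ^ (-1 : ℤ) ≠ 0 := by
    intro h
    refine h2 ?_
    rw [zpow_neg, zpow_one] at h
    have : t * t⁻¹ = 1 := mul_inv_cancel₀ ht
    rw [zpow_two]
    linear_combination (-t) * h - this
  have h5 : t ^ (N : ℤ) + t ^ (-(N : ℤ) - 1) = t ^ (N : ℤ) *
      (1 + t ^ (-(2 * (N : ℤ) + 1))) := by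
    rw [mul_add, mul_one, ← zpow_add₀ ht]; congr 2; ring
  have h6 : t ^ ((N : ℤ) - j) + t ^ (-((N : ℤ) - j) - 1) = t ^ (N : ℤ) *
      (t ^ (-(j : ℤ)) + t ^ ((j : ℤ) - 2 * N - 1)) := by
    rw [mul_add, ← zpow_add₀ ht, ← zpow_add₀ ht]; congr 2; ring
  rw [h5, h6]
  generalize t ^ (1 : ℤ) - t ^ (-1 : ℤ) = Q at *
  generalize t ^ (-(j : ℤ)) + t ^ ((j : ℤ) - 2 * N - 1) = J
  generalize 1 + t ^ (-(2 * (N : ℤ) + 1)) = K at *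
  have h7 : t ^ (N : ℤ) ≠ 0 := zpow_ne_zero _ ht
  generalize t ^ (N : ℤ) = L at *
  field_simp

/-- The expansion of `d(x ^ e w)` in powers of `w`. -/
noncomputable def dSeries (ℓ : ℂ) (r : ℝ) (e : ℤ) : PowerSeries ℂ :=
  expSeries fun m => dExp ℓ r m * (pw ℓ 1 ^ m) ^ e

/-- In the exponents, the terms of the dressing cancel those of the structure function, and the
terms that depend on the order of the positions telescope. -/
theorem fser_mul_contraction_exponent (hℓ : ℓ.re < 0) (hr : 1 < r) (u : Fin N → ℂ) {s : ℕ}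
    (hs : s ≤ 2 * N) {Ω : Finset ℕ} (hΩ : Ω ⊆ Finset.range (2 * N + 1)) {m : ℕ} (hm : 0 < m) :
    dExp ℓ r m * (((pw ℓ 1 ^ m) ^ (-(Ω.card : ℤ)) + (pw ℓ 1 ^ m) ^ ((Ω.card : ℤ) - 2 * N - 1)) /
        (1 + (pw ℓ 1 ^ m) ^ (-(2 * (N : ℤ) + 1)))) +
      (current N ℓ r u s).contraction (fused N ℓ r u Ω) ℓ r m =
    dExp ℓ r m * ((if s ∈ Ω then 0 else (pw ℓ 1 ^ m) ^ gap Ω s) +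
      if 2 * N - s ∈ Ω then
        (pw ℓ 1 ^ m) ^ (gap Ω (2 * N - s) + 1 + 2 * s - 2 * N) else 0) := by
  have ht : pw ℓ 1 ^ m ≠ 0 := pow_ne_zero _ (pw_ne_zero _ _)
  have ht' := norm_pw_one_pow_lt hℓ hm
  have hD := one_add_zpow_ne_zero ht ht' (k := -(2 * (N : ℤ) + 1)) (by omega)
  rw [contraction_fused, Finset.sum_congr rfl fun q hq => by
    rw [contraction_current hℓ hr u hs (by have := Finset.mem_range.1 (hΩ hq); omega) hm]]
  have h2 := one_sub_zpow_ne_zero ht ht' (k := 2) (by norm_num)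
  have h1 := sum_zpow_gap_orderMode ht hΩ (s := s) (by omega)
  have h3 := sum_zpow_gap ht hΩ
  have h4 : ∑ q ∈ Ω, (pw ℓ 1 ^ m) ^ (gap Ω q + 1) *
      (if s + q = 2 * N then (pw ℓ 1 ^ m) ^ ((s : ℤ) - q) else 0) =
      if 2 * N - s ∈ Ω then (pw ℓ 1 ^ m) ^ (gap Ω (2 * N - s) + 1 + 2 * s - 2 * N) else 0 := by
    rw [← Finset.sum_ite_eq' Ω (2 * N - s)
      fun q => (pw ℓ 1 ^ m) ^ (gap Ω q + 1 + 2 * s - 2 * N)]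
    refine Finset.sum_congr rfl fun q _ => ?_
    by_cases hq : s + q = 2 * N
    · rw [if_pos hq, if_pos (by omega), ← zpow_add₀ ht]
      congr 1
      omega
    · rw [if_neg hq, if_neg (by omega), mul_zero]
  generalize pw ℓ 1 ^ m = t at *
  rw [← h4]
  set c := (t⁻¹ + t ^ (-(2 * (N : ℤ)))) / (1 + t ^ (-(2 * (N : ℤ) + 1))) with hc
  have h5 : ∑ q ∈ Ω, t ^ (gap Ω q + 1) * (dExp ℓ r m * ((orderMode t s q +
      if s + q = 2 * N then t ^ ((s : ℤ) - q) else 0) - c)) =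
      dExp ℓ r m * (∑ q ∈ Ω, t ^ (gap Ω q + 1) * orderMode t s q +
        ∑ q ∈ Ω, t ^ (gap Ω q + 1) * (if s + q = 2 * N then t ^ ((s : ℤ) - q) else 0) -
        c * ∑ q ∈ Ω, t ^ (gap Ω q + 1)) := by
    rw [Finset.mul_sum, ← Finset.sum_add_distrib, ← Finset.sum_sub_distrib, Finset.mul_sum]
    exact Finset.sum_congr rfl fun q _ => by ring
  rw [h5]
  have h6 : t - t⁻¹ ≠ 0 := by
    intro h
    refine h2 ?_
    rw [zpow_two]
    have : t * t⁻¹ = 1 := mul_inv_cancel₀ ht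
    linear_combination (-t) * h - this
  refine mul_left_cancel₀ h6 ?_
  have h7 : (t - t⁻¹) * ((t ^ (-(Ω.card : ℤ)) + t ^ ((Ω.card : ℤ) - 2 * N - 1)) /
      (1 + t ^ (-(2 * (N : ℤ) + 1)))) - c * (t ^ (Ω.card : ℤ) - t ^ (-(Ω.card : ℤ))) +
      (t ^ ((Ω.card : ℤ) - 1) - t ^ (1 - (Ω.card : ℤ))) = 0 := by
    rw [hc, mul_div_assoc', div_mul_eq_mul_div, ← sub_div, div_add' _ _ _ hD, div_eq_zero_iff]
    left
    simp only [zpow_add₀ ht, zpow_sub₀ ht, zpow_neg, zpow_one]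
    field_simp
    ring
  by_cases h : s ∈ Ω
  · simp only [if_pos h] at h1 ⊢
    linear_combination dExp ℓ r m * (h1 - c * h3 + h7)
  · simp only [if_neg h] at h1 ⊢
    linear_combination dExp ℓ r m * (h1 - c * h3 + h7)

/-- The structure function cancels all factors of the contraction but at most two. -/
theorem fser_mul_contraction (hℓ : ℓ.re < 0) (hr : 1 < r) (u : Fin N → ℂ) {s : ℕ}
    (hs : s ≤ 2 * N) {Ω : Finset ℕ} (hΩ : Ω ⊆ Finset.range (2 * N + 1)) (hj : 1 ≤ Ω.card) :
    fser N ℓ r 1 Ω.card * expSeries ((current N ℓ r u s).contraction (fused N ℓ r u Ω) ℓ r) =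
      (if s ∈ Ω then 1 else dSeries ℓ r (gap Ω s)) *
        if 2 * N - s ∈ Ω then dSeries ℓ r (gap Ω (2 * N - s) + 1 + 2 * s - 2 * N) else 1 := by
  rw [fser_one_eq hℓ r hj, ← expSeries_add,
    expSeries_congr fun m hm => fser_mul_contraction_exponent hℓ hr u hs hΩ hm]
  simp only [mul_add, expSeries_add]
  congr 1
  · split_ifs
    · simpa using expSeries_zero (A := ℂ)
    · rfl
  · split_ifs
    · rfl
    · simpa using expSeries_zero (A := ℂ)

/-- The exponents of `d` are those of its linear factors. -/
theorem dSeries_eq (ℓ : ℂ) (r : ℝ) (e : ℤ) : dSeries ℓ r e =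
    ((1 - PowerSeries.C (pw ℓ (2 * r - 1) * pw ℓ e) * PowerSeries.X) *
      (1 - PowerSeries.C (pw ℓ (-2 * r + 1) * pw ℓ e) * PowerSeries.X)) *
    ((PowerSeries.mk fun n => (pw ℓ 1 * pw ℓ e) ^ n) *
      PowerSeries.mk fun n => (pw ℓ (-1) * pw ℓ e) ^ n) := by
  rw [← expSeries_neg_pow_div, ← expSeries_neg_pow_div, ← expSeries_pow_div, ← expSeries_pow_div,
    ← expSeries_add, ← expSeries_add, ← expSeries_add, dSeries]
  refine expSeries_congr fun m hm => ?_
  have hm' : (m : ℂ) ≠ 0 := by exact_mod_cast hm.ne'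
  have e1 : pw ℓ (2 * r - 1) * pw ℓ (-2 * r + 1) = 1 := by
    rw [← pw_add]; simp [pw]
  have e2 : q₁ ℓ r ^ m = pw ℓ (2 * r - 1) ^ m * pw ℓ 1 ^ m := by
    rw [← mul_pow, ← pw_add, q₁]; congr 2; ring
  have e3 : q₃ ℓ r ^ m = pw ℓ (-2 * r + 1) ^ m * pw ℓ 1 ^ m := by
    rw [← mul_pow, ← pw_add, q₃]; congr 2; ring
  have e4 : pw ℓ (2 * r - 1) ^ m * pw ℓ (-2 * r + 1) ^ m = 1 := by
    rw [← mul_pow, e1, one_pow]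
  have e5 : pw ℓ (-1) = (pw ℓ 1)⁻¹ := pw_neg ℓ 1
  have e6 : (pw ℓ 1 ^ m) ^ e = pw ℓ e ^ m := by
    rw [pw_intCast, ← zpow_natCast, ← zpow_natCast, ← zpow_mul, ← zpow_mul, mul_comm]
  have ht : pw ℓ 1 ^ m * (pw ℓ 1 ^ m)⁻¹ = 1 := mul_inv_cancel₀ (pow_ne_zero _ (pw_ne_zero _ _))
  rw [dExp, eta, e2, e3, e6, e5]
  simp only [mul_pow, inv_pow]
  generalize pw ℓ 1 ^ m = t at *
  generalize pw ℓ (2 * r - 1) ^ m = a at *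
  generalize pw ℓ (-2 * r + 1) ^ m = b at *
  have e7 : (1 - a * t) * (1 - b * t) * t⁻¹ = t⁻¹ - a - b + t := by
    linear_combination (-(a + b) + a * b * t) * ht + t * e4
  rw [e7]
  ring

end

/-! ### Convergence of the exchange functions -/

section

/-- The power series `F` converges absolutely to `ρ` near `0`. -/
def ConvergesTo (F : PowerSeries ℂ) (ρ : ℂ → ℂ) : Prop :=
  ∀ᶠ w in 𝓝 (0 : ℂ), Summable (fun n : ℕ => ‖PowerSeries.coeff n F * w ^ n‖) ∧
    HasSum (fun n : ℕ => PowerSeries.coeff n F * w ^ n) (ρ w)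

theorem ConvergesTo.mul {F H : PowerSeries ℂ} {ρ σ : ℂ → ℂ} (hF : ConvergesTo F ρ)
    (hH : ConvergesTo H σ) : ConvergesTo (F * H) (fun w => ρ w * σ w) := by
  filter_upwards [hF, hH] with w h1 h2
  have e : (fun n : ℕ => PowerSeries.coeff n (F * H) * w ^ n) = fun n : ℕ =>
      ∑ p ∈ Finset.HasAntidiagonal.antidiagonal n,
        (PowerSeries.coeff p.1 F * w ^ p.1) * (PowerSeries.coeff p.2 H * w ^ p.2) := by
    funext n
    rw [PowerSeries.coeff_mul, Finset.sum_mul]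
    refine Finset.sum_congr rfl fun p hp => ?_
    rw [← Finset.HasAntidiagonal.mem_antidiagonal.1 hp, pow_add]
    ring
  have hs := summable_norm_sum_mul_antidiagonal_of_summable_norm h1.1 h2.1
  refine ⟨?_, ?_⟩
  · refine (summable_congr fun n => ?_).2 hs
    exact congrArg norm (congrFun e n)
  · rw [e, ← h1.2.tsum_eq, ← h2.2.tsum_eq,
      tsum_mul_tsum_eq_tsum_sum_antidiagonal_of_summable_norm h1.1 h2.1]
    exact hs.of_norm.hasSum

theorem convergesTo_one_sub (α : ℂ) :
    ConvergesTo (1 - PowerSeries.C α * PowerSeries.X) fun w => 1 - α * w := by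
  refine Filter.Eventually.of_forall fun w => ?_
  have h : ∀ n ∉ Finset.range 2,
      PowerSeries.coeff n (1 - PowerSeries.C α * PowerSeries.X) * w ^ n = 0 := by
    intro n hn
    have h1 : n ≠ 0 := by rintro rfl; simp at hn
    have h2 : n ≠ 1 := by rintro rfl; simp at hn
    simp [PowerSeries.coeff_one, PowerSeries.coeff_X, h1, h2]
  refine ⟨summable_of_ne_finset_zero (s := Finset.range 2) fun n hn => by rw [h n hn, norm_zero],
    ?_⟩
  convert hasSum_sum_of_ne_finset_zero (L := SummationFilter.unconditional ℕ) h using 1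
  simp [Finset.sum_range_succ, PowerSeries.coeff_one, PowerSeries.coeff_X]
  ring

theorem convergesTo_one : ConvergesTo 1 fun _ => 1 := by
  simpa using convergesTo_one_sub 0

theorem convergesTo_mk_pow (α : ℂ) :
    ConvergesTo (PowerSeries.mk fun n => α ^ n) fun w => (1 - α * w)⁻¹ := by
  have h : ∀ᶠ w in 𝓝 (0 : ℂ), ‖α * w‖ < 1 := by
    have : ContinuousAt (fun w : ℂ => ‖α * w‖) 0 := by fun_prop
    exact this.eventually_lt continuousAt_const (by simp)
  filter_upwards [h] with w hw
  simp only [PowerSeries.coeff_mk, ← mul_pow]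
  refine ⟨?_, hasSum_geometric_of_norm_lt_one hw⟩
  simp only [norm_pow]
  exact summable_geometric_of_lt_one (norm_nonneg _) hw

theorem convergesTo_dSeries (ℓ : ℂ) (r : ℝ) (e : ℤ) :
    ConvergesTo (dSeries ℓ r e) fun w => dfun ℓ r (pw ℓ e * w) := by
  rw [dSeries_eq]
  have h := ((convergesTo_one_sub (pw ℓ (2 * r - 1) * pw ℓ e)).mul
    (convergesTo_one_sub (pw ℓ (-2 * r + 1) * pw ℓ e))).mul
    ((convergesTo_mk_pow (pw ℓ 1 * pw ℓ e)).mul (convergesTo_mk_pow (pw ℓ (-1) * pw ℓ e)))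
  convert h using 2 with w
  rw [dfun, div_eq_mul_inv, mul_inv]
  simp only [mul_assoc]

variable {ℓ : ℂ} {r : ℝ}

theorem meromorphicAt_dfun (ℓ : ℂ) (r : ℝ) (a w : ℂ) :
    MeromorphicAt (fun w => dfun ℓ r (a * w)) w := by
  unfold dfun
  fun_prop

/-- The function `d` has no pole at even powers of `x`. -/
theorem continuousAt_dfun (hℓ : ℓ.re < 0) (r : ℝ) {e k : ℤ} {n : ℤ} (h : e + k = n + n) :
    ContinuousAt (fun w => dfun ℓ r (pw ℓ e * w)) (pw ℓ k) := by
  have h0 := pw_ne_zero ℓ 1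
  have h1 : pw ℓ 1 * (pw ℓ e * pw ℓ k) = pw ℓ 1 ^ (n + n + 1) := by
    rw [pw_intCast, pw_intCast, ← zpow_add₀ h0, h, ← zpow_one_add₀ h0]; congr 1; ring
  have h2 : pw ℓ (-1) * (pw ℓ e * pw ℓ k) = pw ℓ 1 ^ (n + n - 1) := by
    rw [pw_intCast, pw_intCast, ← zpow_add₀ h0, h, pw_neg, ← zpow_neg_one, ← zpow_add₀ h0]
    congr 1; ring
  have h3 := one_sub_zpow_ne_zero h0 (norm_pw_one_lt hℓ) (k := n + n + 1) (by omega)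
  have h4 := one_sub_zpow_ne_zero h0 (norm_pw_one_lt hℓ) (k := n + n - 1) (by omega)
  unfold dfun
  refine ContinuousAt.div (by fun_prop) (by fun_prop) ?_
  rw [h1, h2]
  exact mul_ne_zero h3 h4

/-- The pole of `d(x ^ e w)` at `w = x ^ k`, for odd `e + k`: there is one only if `e + k = ±1`,
and at `e + k = 1` the residue factor is `c`. -/
theorem tendsto_mul_dfun (hℓ : ℓ.re < 0) (r : ℝ) {e k n : ℤ} (h : e + k = 2 * n + 1)
    (hn : 0 ≤ n) : Tendsto (fun w => (1 - w / pw ℓ k) * dfun ℓ r (pw ℓ e * w)) (𝓝[≠] (pw ℓ k))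
      (𝓝 (if n = 0 then cst ℓ r else 0)) := by
  have h0 := pw_ne_zero ℓ 1
  have hk := pw_ne_zero ℓ k
  have hx := norm_pw_one_lt hℓ
  have h2 : pw ℓ (-1) * (pw ℓ e * pw ℓ k) = pw ℓ 1 ^ (2 * n) := by
    rw [pw_intCast, pw_intCast, ← zpow_add₀ h0, h, pw_neg, ← zpow_neg_one, ← zpow_add₀ h0]
    congr 1; ring
  have h1 : pw ℓ 1 * (pw ℓ e * pw ℓ k) = pw ℓ 1 ^ (2 * n + 2) := by
    rw [pw_intCast, pw_intCast, ← zpow_add₀ h0, h, ← zpow_one_add₀ h0]; congr 1; ring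
  have h3 := one_sub_zpow_ne_zero h0 hx (k := 2 * n + 2) (by omega)
  split_ifs with hn0
  · subst hn0
    -- the pole cancels against `1 - w / x ^ k`
    have h5 : ∀ w, pw ℓ (-1) * (pw ℓ e * w) = w / pw ℓ k := by
      intro w
      rw [eq_div_iff hk]
      rw [mul_zero, zpow_zero] at h2
      linear_combination w * h2
    have h6 : (fun w => ((1 - pw ℓ (2 * r - 1) * (pw ℓ e * w)) *
        (1 - pw ℓ (-2 * r + 1) * (pw ℓ e * w))) / (1 - pw ℓ 1 * (pw ℓ e * w))) =ᶠ[𝓝[≠] (pw ℓ k)]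
        fun w => (1 - w / pw ℓ k) * dfun ℓ r (pw ℓ e * w) := by
      filter_upwards [self_mem_nhdsWithin] with w hw
      have h7 : 1 - w / pw ℓ k ≠ 0 := by
        rw [sub_ne_zero]
        intro h8
        rw [eq_div_iff hk, one_mul] at h8
        exact hw h8.symm
      rw [dfun, h5, ← mul_div_assoc, mul_comm (1 - w / pw ℓ k), mul_div_mul_right _ _ h7]
    refine Tendsto.congr' h6 ?_
    have hc : ContinuousAt (fun w => ((1 - pw ℓ (2 * r - 1) * (pw ℓ e * w)) *
        (1 - pw ℓ (-2 * r + 1) * (pw ℓ e * w))) / (1 - pw ℓ 1 * (pw ℓ e * w))) (pw ℓ k) := by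
      refine ContinuousAt.div (by fun_prop) (by fun_prop) ?_
      rw [h1]
      exact h3
    have hval : ((1 - pw ℓ (2 * r - 1) * (pw ℓ e * pw ℓ k)) *
        (1 - pw ℓ (-2 * r + 1) * (pw ℓ e * pw ℓ k))) / (1 - pw ℓ 1 * (pw ℓ e * pw ℓ k)) =
        cst ℓ r := by
      have h8 : pw ℓ e * pw ℓ k = pw ℓ 1 := by
        rw [pw_intCast, pw_intCast, ← zpow_add₀ h0, h, mul_zero, zero_add, zpow_one]
      have hD := pw_one_sub_ne_zero hℓ
      rw [h8, cst, qn, qn]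
      have e1 : pw ℓ (2 * r - 1) = pw ℓ r * pw ℓ (r - 1) := by rw [← pw_add]; congr 1; ring
      have e2 : pw ℓ (-2 * r + 1) = (pw ℓ r * pw ℓ (r - 1))⁻¹ := by
        rw [← pw_add, ← pw_neg]; congr 1; ring
      have e3 : pw ℓ r = pw ℓ (r - 1) * pw ℓ 1 := by rw [← pw_add]; congr 1; ring
      rw [h8] at h1
      rw [← h1] at h3
      have hA := pw_ne_zero ℓ (r - 1)
      have e4 : pw ℓ (-1) = (pw ℓ 1)⁻¹ := pw_neg ℓ 1
      rw [e1, e2, pw_neg ℓ r, pw_neg ℓ (r - 1), e3]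
      rw [e4] at hD ⊢
      generalize pw ℓ (r - 1) = A at *
      generalize pw ℓ 1 = x at *
      have h9 : 1 - x * x = -x * (x - x⁻¹) := by
        have := mul_inv_cancel₀ h0
        linear_combination -this
      rw [h9]
      generalize hgD : x - x⁻¹ = D at *
      field_simp
      ring
    have := hc.tendsto
    rw [hval] at this
    exact this.mono_left nhdsWithin_le_nhds
  · have h4 := one_sub_zpow_ne_zero h0 hx (k := 2 * n) (by omega)
    have hc : ContinuousAt (fun w => (1 - w / pw ℓ k) * dfun ℓ r (pw ℓ e * w)) (pw ℓ k) := by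
      unfold dfun
      refine ContinuousAt.mul (by fun_prop) (ContinuousAt.div (by fun_prop) (by fun_prop) ?_)
      rw [h1, h2]
      exact mul_ne_zero h3 h4
    have := hc.tendsto
    rw [div_self hk, sub_self, zero_mul] at this
    exact this.mono_left nhdsWithin_le_nhds

theorem cst_ne_zero (hℓ : ℓ.re < 0) (hr : 1 < r) : cst ℓ r ≠ 0 := by
  have h : ∀ a : ℝ, 0 < a → qn ℓ a ≠ 0 := by
    intro a ha
    refine div_ne_zero ?_ (pw_one_sub_ne_zero hℓ)
    rw [sub_ne_zero]
    intro h
    have := pw_ne_of_re hℓ (a := a) (b := -a) (by linarith)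
    push_cast at this
    exact this (by rw [h])
  have h1 := h r (by linarith)
  have h2 := h (r - 1) (by linarith)
  push_cast at h2
  exact mul_ne_zero (mul_ne_zero h1 h2) (pw_one_sub_ne_zero hℓ)

end

/-! ### Fusion of the currents -/

section

variable {N : ℕ} {ℓ : ℂ} {r : ℝ}

/-- The constant `[r - 1/2]_x / [1/2]_x`. -/
noncomputable def middleCoef (ℓ : ℂ) (r : ℝ) : ℂ := qn ℓ (r - 1 / 2) / qn ℓ (1 / 2)

/-- The number of elements of `Ω` strictly between `q` and its bar image `2N - q`, minus `N - q`. -/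
def walk (N : ℕ) (Ω : Finset ℕ) (q : ℕ) : ℤ :=
  rank Ω (2 * N - q) - rank Ω (q + 1) - ((N : ℤ) - q)

/-- The factor of the coefficient of `fused Ω` that comes from the pair `q`, `2N - q`. -/
noncomputable def pairFactor (N : ℕ) (ℓ : ℂ) (r : ℝ) (Ω : Finset ℕ) (q : ℕ) : ℂ :=
  if q ∈ Ω ∧ 2 * N - q ∈ Ω then dfun ℓ r (pw ℓ (2 * (walk N Ω q + 1) : ℤ)) else 1

/-- The coefficient of `fused Ω` in the `W`-current of degree `|Ω|`. -/
noncomputable def coef (N : ℕ) (ℓ : ℂ) (r : ℝ) (Ω : Finset ℕ) : ℂ :=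
  (if N ∈ Ω then middleCoef ℓ r else 1) * ∏ q ∈ Finset.range N, pairFactor N ℓ r Ω q

theorem rank_insert {Ω : Finset ℕ} {s : ℕ} (hs : ∀ q ∈ Ω, s < q) (q : ℕ) :
    rank (insert s Ω) q = rank Ω q + if s < q then 1 else 0 := by
  have hs' : s ∉ Ω := fun h => lt_irrefl _ (hs s h)
  rw [rank, rank, Finset.filter_insert]
  split_ifs
  · rw [Finset.card_insert_of_notMem (by simp [hs'])]
  · simp

theorem rank_eq_zero_iff {Ω : Finset ℕ} {s : ℕ} : rank Ω s = 0 ↔ ∀ q ∈ Ω, s ≤ q := by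
  simp [rank, Finset.filter_eq_empty_iff]

/-- A new first element `s` lies outside of the intervals that count for the other pairs, so it only
adds the factor of the pair `s`, `2N - s`. -/
theorem coef_insert {Ω : Finset ℕ} {s : ℕ} (hs : ∀ q ∈ Ω, s < q) (hsN : s ≤ 2 * N) :
    coef N ℓ r (insert s Ω) = (if s = N then middleCoef ℓ r else 1) * coef N ℓ r Ω *
      if 2 * N - s ∈ Ω then
        dfun ℓ r (pw ℓ (2 * (rank Ω (2 * N - s) + 1 - ((N : ℤ) - s)) : ℤ)) else 1 := by
  have hs' : s ∉ Ω := fun h => lt_irrefl _ (hs s h)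
  rcases lt_trichotomy s N with h | h | h
  · have h1 : N ∈ insert s Ω ↔ N ∈ Ω := by simp [h.ne']
    have h2 : ∀ q ∈ (Finset.range N).erase s,
        pairFactor N ℓ r (insert s Ω) q = pairFactor N ℓ r Ω q := by
      intro q hq
      obtain ⟨hqs, hqN⟩ := Finset.mem_erase.1 hq
      rw [Finset.mem_range] at hqN
      have h3 : q ∈ insert s Ω ↔ q ∈ Ω := by simp [hqs]
      have h4 : 2 * N - q ∈ insert s Ω ↔ 2 * N - q ∈ Ω := by
        have : 2 * N - q ≠ s := by omega
        simp [this]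
      simp only [pairFactor, h3, h4]
      by_cases hq' : q ∈ Ω ∧ 2 * N - q ∈ Ω
      · have h5 := hs q hq'.1
        have h6 := hs _ hq'.2
        have h7 : walk N (insert s Ω) q = walk N Ω q := by
          rw [walk, walk, rank_insert hs, rank_insert hs, if_pos h6, if_pos (by omega)]
          push_cast
          ring
        rw [if_pos hq', if_pos hq', h7]
      · rw [if_neg hq', if_neg hq']
    have h3 : rank Ω (s + 1) = 0 := rank_eq_zero_iff.2 fun q hq => hs q hq
    have h4 : walk N (insert s Ω) s + 1 = rank Ω (2 * N - s) + 1 - ((N : ℤ) - s) := by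
      rw [walk, rank_insert hs, rank_insert hs, h3, if_pos (by omega), if_pos (by omega)]
      push_cast
      ring
    have h5 : 2 * N - s ∈ insert s Ω ↔ 2 * N - s ∈ Ω := by
      have : 2 * N - s ≠ s := by omega
      simp [this]
    rw [coef, coef, ← Finset.mul_prod_erase _ _ (Finset.mem_range.2 h),
      ← Finset.mul_prod_erase (Finset.range N) (pairFactor N ℓ r Ω) (Finset.mem_range.2 h),
      Finset.prod_congr rfl h2]
    have h6 : pairFactor N ℓ r (insert s Ω) s = if 2 * N - s ∈ Ω then
        dfun ℓ r (pw ℓ (2 * (rank Ω (2 * N - s) + 1 - ((N : ℤ) - s)) : ℤ)) else 1 := by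
      simp only [pairFactor, h5, Finset.mem_insert_self, true_and, h4]
    have h7 : pairFactor N ℓ r Ω s = 1 := if_neg fun h' => hs' h'.1
    simp only [h1, h6, h7, h.ne, if_false]
    ring
  · subst h
    have h1 : ∀ q ∈ Finset.range s, pairFactor s ℓ r (insert s Ω) q = 1 := by
      intro q hq
      rw [Finset.mem_range] at hq
      refine if_neg fun h => ?_
      rcases Finset.mem_insert.1 h.1 with h2 | h2
      · omega
      · have := hs q h2; omega
    have h2 : ∀ q ∈ Finset.range s, pairFactor s ℓ r Ω q = 1 := by
      intro q hq
      rw [Finset.mem_range] at hq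
      refine if_neg fun h => ?_
      have := hs q h.1; omega
    have h3 : 2 * s - s = s := by omega
    rw [coef, coef, Finset.prod_eq_one h1, Finset.prod_eq_one h2, h3]
    simp [hs']
  · have h1 : ∀ q ∈ Finset.range N, pairFactor N ℓ r (insert s Ω) q = 1 := by
      intro q hq
      rw [Finset.mem_range] at hq
      refine if_neg fun h => ?_
      rcases Finset.mem_insert.1 h.1 with h2 | h2
      · omega
      · have := hs q h2; omega
    have h2 : ∀ q ∈ Finset.range N, pairFactor N ℓ r Ω q = 1 := by
      intro q hq
      rw [Finset.mem_range] at hq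
      refine if_neg fun h => ?_
      have := hs q h.1; omega
    have h3 : 2 * N - s ∉ Ω := fun h' => by have := hs _ h'; omega
    have h4 : N ∉ Ω := fun h' => by have := hs _ h'; omega
    rw [coef, coef, Finset.prod_eq_one h1, Finset.prod_eq_one h2]
    simp [h3, h4, h.ne, h.ne']

theorem coef_empty : coef N ℓ r ∅ = 1 := by simp [coef, pairFactor]

theorem gap_insert {Ω : Finset ℕ} {s : ℕ} (hs : ∀ q ∈ Ω, s < q) {q : ℕ} (hq : q ∈ Ω) :
    gap (insert s Ω) q = gap Ω q + 1 := by
  have hs' : s ∉ Ω := fun h => lt_irrefl _ (hs s h)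
  rw [gap, gap, rank_insert hs, if_pos (hs q hq), Finset.card_insert_of_notMem hs']
  push_cast
  ring

theorem gap_insert_self {Ω : Finset ℕ} {s : ℕ} (hs : ∀ q ∈ Ω, s < q) :
    gap (insert s Ω) s = -(Ω.card : ℤ) - 1 := by
  have hs' : s ∉ Ω := fun h => lt_irrefl _ (hs s h)
  rw [gap, rank_insert hs, if_neg (lt_irrefl s), Finset.card_insert_of_notMem hs',
    rank_eq_zero_iff.2 fun q hq => (hs q hq).le]
  push_cast
  ring

/-- Fusing a current in front of a normally ordered product. -/
theorem normal_current_fused (u : Fin N → ℂ) {Ω : Finset ℕ} {s : ℕ} (hs : ∀ q ∈ Ω, s < q) :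
    ((current N ℓ r u s).rescale (pw ℓ 1 ^ ((Ω.card : ℤ) + 1))⁻¹).normal (fused N ℓ r u Ω) =
      (fused N ℓ r u (insert s Ω)).rescale (pw ℓ 1)⁻¹ := by
  have hs' : s ∉ Ω := fun h => lt_irrefl _ (hs s h)
  have h0 := pw_ne_zero ℓ 1
  have e1 : ∀ m : ℕ, (pw ℓ 1)⁻¹ ^ m = (pw ℓ 1 ^ m) ^ (-1 : ℤ) := fun m => by
    rw [zpow_neg_one, inv_pow]
  have e2 : ∀ m : ℕ, (pw ℓ 1 ^ ((Ω.card : ℤ) + 1)) ^ m = (pw ℓ 1 ^ m) ^ ((Ω.card : ℤ) + 1) :=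
    fun m => by rw [← zpow_natCast, ← zpow_natCast, ← zpow_mul, ← zpow_mul, mul_comm]
  simp only [VOData.normal, VOData.rescale, fused, Finset.prod_insert hs', VOData.mk.injEq,
    Finset.sum_insert hs', true_and]
  refine ⟨funext fun b => funext fun m => ?_, funext fun b => funext fun m => ?_⟩
  · have hm : pw ℓ 1 ^ m ≠ 0 := pow_ne_zero _ h0
    rw [mul_add, Finset.mul_sum, inv_pow, e1, e2, gap_insert_self hs, ← mul_assoc,
      ← zpow_add₀ hm, ← zpow_neg]
    congr 1
    · congr 2; ring
    · refine Finset.sum_congr rfl fun q hq => ?_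
      rw [gap_insert hs hq, ← mul_assoc, ← zpow_add₀ hm]
      congr 2; ring
  · have hm : pw ℓ 1 ^ m ≠ 0 := pow_ne_zero _ h0
    have e3 : pw ℓ 1 ^ m = (pw ℓ 1 ^ m) ^ (1 : ℤ) := (zpow_one _).symm
    rw [mul_add, Finset.mul_sum, inv_inv, inv_inv, e2, gap_insert_self hs, ← mul_assoc]
    congr 1
    · nth_rw 2 [e3]
      rw [← zpow_add₀ hm]
      congr 2; ring
    · refine Finset.sum_congr rfl fun q hq => ?_
      rw [gap_insert hs hq, ← mul_assoc]
      nth_rw 2 [e3]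
      rw [← zpow_add₀ hm]
      congr 2; ring

/-- The vertex operator of a normally ordered product of currents. -/
noncomputable def fusedOp (hℓ : ℓ.re < 0) (hr : 1 < r) (u : Fin N → ℂ) (Ω : Finset ℕ) :
    VertexOperator ℂ (Fock N ℓ r) :=
  (fused N ℓ r u Ω).toVertexOperator ℓ r (fused_commutes hℓ hr u Ω)

/-- The explicit formula for the `W`-current of degree `j`. -/
noncomputable def explicitCurrent (hℓ : ℓ.re < 0) (hr : 1 < r) (u : Fin N → ℂ) (j : ℕ) :
    VertexOperator ℂ (Fock N ℓ r) :=
  ∑ Ω ∈ (Finset.range (2 * N + 1)).powersetCard j, coef N ℓ r Ω • fusedOp hℓ hr u Ω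

theorem toVertexOperator_congr_eq {E E' : VOData N} (h : E = E') (hE : E.Commutes ℓ r)
    (hE' : E'.Commutes ℓ r) : E.toVertexOperator ℓ r hE = E'.toVertexOperator ℓ r hE' := by
  subst h; rfl

theorem fused_singleton (u : Fin N → ℂ) (s : ℕ) :
    fused N ℓ r u {s} = current N ℓ r u s := by
  have : gap {s} s = -1 := by
    have := gap_insert_self (Ω := ∅) (s := s) (by simp)
    simpa using this
  simp [fused, this]

theorem coef_singleton {s : ℕ} (hs : s ≤ 2 * N) :
    coef N ℓ r {s} = if s = N then middleCoef ℓ r else 1 := by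
  have := coef_insert (N := N) (ℓ := ℓ) (r := r) (Ω := ∅) (s := s) (by simp) hs
  simpa [coef_empty] using this

theorem explicitCurrent_one_eq_sum (hℓ : ℓ.re < 0) (hr : 1 < r) (u : Fin N → ℂ) :
    explicitCurrent hℓ hr u 1 = ∑ s ∈ Finset.range (2 * N + 1),
      (if s = N then middleCoef ℓ r else 1) •
        (current N ℓ r u s).toVertexOperator ℓ r (current_commutes hℓ hr u s) := by
  rw [explicitCurrent, Finset.powersetCard_one, Finset.sum_map]
  refine Finset.sum_congr rfl fun s hs => ?_
  change coef N ℓ r {s} • fusedOp hℓ hr u {s} = _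
  rw [coef_singleton (by have := Finset.mem_range.1 hs; omega), fusedOp,
    toVertexOperator_congr_eq (fused_singleton u s)]

theorem basicCurrent_eq (hℓ : ℓ.re < 0) (hr : 1 < r) (u : Fin N → ℂ) :
    basicCurrent N hℓ hr u = explicitCurrent hℓ hr u 1 := by
  rw [explicitCurrent_one_eq_sum, basicCurrent, k₂B_div_b₂ hℓ hr]
  set f : ℕ → VertexOperator ℂ (Fock N ℓ r) := fun s =>
    (current N ℓ r u s).toVertexOperator ℓ r (current_commutes hℓ hr u s) with hf
  have h1 : ∀ k : Fin N, ((lamPlus N ℓ r u k).dressed ℓ r).toVertexOperator ℓ r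
      (lamPlus_commutes N hℓ hr u k) = f k := fun k =>
    toVertexOperator_congr_eq (by simp [current]) _ _
  have h2 : ((lamZero N ℓ).dressed ℓ r).toVertexOperator ℓ r (lamZero_commutes N hℓ hr) = f N :=
    toVertexOperator_congr_eq (by simp [current, two_mul]) _ _
  have h3 : ∀ k : Fin N, ((lamMinus N ℓ r u k).dressed ℓ r).toVertexOperator ℓ r
      (lamMinus_commutes N hℓ hr u k) = f (2 * N - k) := fun k => by
    refine toVertexOperator_congr_eq ?_ _ _
    have h4 : ¬ 2 * N - (k : ℕ) < N := by omega
    have h5 : 2 * N - (2 * N - (k : ℕ)) = k := by omega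
    simp [current, h4, h5]
  simp only [h1, h2, h3]
  rw [Fin.sum_univ_eq_sum_range f, Fin.sum_univ_eq_sum_range (fun k => f (2 * N - k))]
  have h4 : 2 * N + 1 = N + 1 + N := by ring
  rw [h4, Finset.sum_range_add, Finset.sum_range_succ]
  congr 1
  · congr 1
    · refine Finset.sum_congr rfl fun s hs => ?_
      rw [if_neg (Finset.mem_range.1 hs).ne, one_smul]
    · rw [if_pos rfl]; rfl
  · rw [← Finset.sum_range_reflect]
    refine Finset.sum_congr rfl fun s hs => ?_
    have h5 := Finset.mem_range.1 hs
    have h6 : 2 * N - (N - 1 - s) = N + 1 + s := by omega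
    rw [if_neg (by omega), one_smul, h6]

/-- A nonempty finite set of positions is split into its first element and the rest. -/
theorem sum_powersetCard_succ {A : Type*} [AddCommMonoid A] (R : Finset ℕ) (j : ℕ)
    (G : Finset ℕ → A) :
    ∑ p ∈ R ×ˢ R.powersetCard j, (if ∀ q ∈ p.2, p.1 < q then G (insert p.1 p.2) else 0) =
      ∑ Ω ∈ R.powersetCard (j + 1), G Ω := by
  rw [← Finset.sum_filter]
  refine Finset.sum_bij (fun p _ => insert p.1 p.2) ?_ ?_ ?_ ?_
  · rintro ⟨s, Ω⟩ h
    simp only [Finset.mem_filter, Finset.mem_product, Finset.mem_powersetCard] at h ⊢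
    refine ⟨Finset.insert_subset h.1.1 h.1.2.1, ?_⟩
    rw [Finset.card_insert_of_notMem fun h' => lt_irrefl _ (h.2 s h'), h.1.2.2]
  · rintro ⟨s, Ω⟩ h ⟨s', Ω'⟩ h' heq
    simp only [Finset.mem_filter, Finset.mem_product, Finset.mem_powersetCard] at h h' heq
    have hs : s ∉ Ω := fun h1 => lt_irrefl _ (h.2 s h1)
    have hs' : s' ∉ Ω' := fun h1 => lt_irrefl _ (h'.2 s' h1)
    have h1 : s = s' := by
      by_contra hne
      have h2 : s ∈ Ω' := by
        have : s ∈ insert s' Ω' := heq ▸ Finset.mem_insert_self s Ω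
        exact (Finset.mem_insert.1 this).resolve_left hne
      have h3 : s' ∈ Ω := by
        have : s' ∈ insert s Ω := heq ▸ Finset.mem_insert_self s' Ω'
        exact (Finset.mem_insert.1 this).resolve_left (Ne.symm hne)
      exact lt_asymm (h.2 s' h3) (h'.2 s h2)
    subst h1
    have h2 : Ω = Ω' := by rw [← Finset.erase_insert hs, heq, Finset.erase_insert hs']
    rw [h2]
  · intro Ω hΩ
    rw [Finset.mem_powersetCard] at hΩ
    have hne : Ω.Nonempty := Finset.card_pos.1 (by omega)
    refine ⟨(Ω.min' hne, Ω.erase (Ω.min' hne)), ?_, Finset.insert_erase (Ω.min'_mem hne)⟩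
    simp only [Finset.mem_filter, Finset.mem_product, Finset.mem_powersetCard]
    refine ⟨⟨hΩ.1 (Ω.min'_mem hne), (Finset.erase_subset _ _).trans hΩ.1, ?_⟩, fun q hq => ?_⟩
    · rw [Finset.card_erase_of_mem (Ω.min'_mem hne), hΩ.2, Nat.add_sub_cancel]
    · exact Finset.min'_lt_of_mem_erase_min' _ hne hq
  · intro p _
    rfl

end

/-! ### The currents are given by the explicit formula -/

section

variable {N : ℕ} {ℓ : ℂ} {r : ℝ}

/-- The analytic continuation of the structure function times the contraction of the current at
position `s` with `fused Ω`. -/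
noncomputable def pairing (N : ℕ) (ℓ : ℂ) (r : ℝ) (s : ℕ) (Ω : Finset ℕ) (w : ℂ) : ℂ :=
  (if s ∈ Ω then 1 else dfun ℓ r (pw ℓ (gap Ω s) * w)) *
    if 2 * N - s ∈ Ω then dfun ℓ r (pw ℓ (gap Ω (2 * N - s) + 1 + 2 * s - 2 * N : ℤ) * w) else 1

theorem convergesTo_pairing (hℓ : ℓ.re < 0) (hr : 1 < r) (u : Fin N → ℂ) {s : ℕ}
    (hs : s ≤ 2 * N) {Ω : Finset ℕ} (hΩ : Ω ⊆ Finset.range (2 * N + 1)) (hj : 1 ≤ Ω.card) :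
    ConvergesTo (fser N ℓ r 1 Ω.card *
      expSeries ((current N ℓ r u s).contraction (fused N ℓ r u Ω) ℓ r)) (pairing N ℓ r s Ω) := by
  rw [fser_mul_contraction hℓ hr u hs hΩ hj]
  refine ConvergesTo.mul (ρ := fun w => if s ∈ Ω then 1 else dfun ℓ r (pw ℓ (gap Ω s) * w))
    (σ := fun w => if 2 * N - s ∈ Ω then
      dfun ℓ r (pw ℓ (gap Ω (2 * N - s) + 1 + 2 * s - 2 * N : ℤ) * w) else 1) ?_ ?_
  · split_ifs
    · exact convergesTo_one
    · exact convergesTo_dSeries ℓ r _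
  · split_ifs
    · exact convergesTo_dSeries ℓ r _
    · exact convergesTo_one

theorem meromorphicAt_pairing (s : ℕ) (Ω : Finset ℕ) (w : ℂ) :
    MeromorphicAt (pairing N ℓ r s Ω) w := by
  refine MeromorphicAt.mul (f := fun w => if s ∈ Ω then 1 else dfun ℓ r (pw ℓ (gap Ω s) * w))
    (g := fun w => if 2 * N - s ∈ Ω then
      dfun ℓ r (pw ℓ (gap Ω (2 * N - s) + 1 + 2 * s - 2 * N : ℤ) * w) else 1) ?_ ?_
  · split_ifs
    · exact MeromorphicAt.const 1 w
    · exact meromorphicAt_dfun ℓ r _ w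
  · split_ifs
    · exact meromorphicAt_dfun ℓ r _ w
    · exact MeromorphicAt.const 1 w

/-- The pole at `w = x ^ (|Ω| + 1)` survives only if `s` precedes all elements of `Ω`. -/
theorem tendsto_pairing (hℓ : ℓ.re < 0) (s : ℕ) (Ω : Finset ℕ) :
    Tendsto (fun w => (1 - w / pw ℓ ((Ω.card : ℤ) + 1 : ℤ)) * pairing N ℓ r s Ω w)
      (𝓝[≠] (pw ℓ ((Ω.card : ℤ) + 1 : ℤ)))
      (𝓝 (if ∀ q ∈ Ω, s < q then cst ℓ r * (if 2 * N - s ∈ Ω then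
        dfun ℓ r (pw ℓ (2 * (rank Ω (2 * N - s) + 1 - ((N : ℤ) - s)) : ℤ)) else 1) else 0)) := by
  set k : ℤ := (Ω.card : ℤ) + 1 with hk
  set σ : ℂ → ℂ := fun w => if 2 * N - s ∈ Ω then
    dfun ℓ r (pw ℓ (gap Ω (2 * N - s) + 1 + 2 * s - 2 * N : ℤ) * w) else 1 with hσ
  have h0 := pw_ne_zero ℓ 1
  have h1 : Tendsto σ (𝓝[≠] (pw ℓ k)) (𝓝 (if 2 * N - s ∈ Ω then
      dfun ℓ r (pw ℓ (2 * (rank Ω (2 * N - s) + 1 - ((N : ℤ) - s)) : ℤ)) else 1)) := by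
    by_cases h : 2 * N - s ∈ Ω
    · simp only [hσ, h, if_true]
      set n : ℤ := rank Ω (2 * N - s) + 1 - ((N : ℤ) - s) with hn
      have he : (gap Ω (2 * N - s) + 1 + 2 * s - 2 * N) + k = n + n := by
        rw [gap, hn, hk]; ring
      have h2 := (continuousAt_dfun hℓ r he).tendsto.mono_left
        (nhdsWithin_le_nhds (s := {pw ℓ k}ᶜ))
      have h3 : pw ℓ ((gap Ω (2 * N - s) + 1 + 2 * s - 2 * N : ℤ) : ℂ) * pw ℓ k =
          pw ℓ ((2 * n : ℤ) : ℂ) := by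
        rw [pw_intCast, pw_intCast, pw_intCast, ← zpow_add₀ h0, he, two_mul]
      rw [h3] at h2
      exact h2
    · simp only [hσ, h, if_false]
      exact tendsto_const_nhds
  have h2 : Tendsto (fun w => (1 - w / pw ℓ k) *
      if s ∈ Ω then 1 else dfun ℓ r (pw ℓ (gap Ω s) * w)) (𝓝[≠] (pw ℓ k))
      (𝓝 (if ∀ q ∈ Ω, s < q then cst ℓ r else 0)) := by
    by_cases h : s ∈ Ω
    · have h3 : ¬ ∀ q ∈ Ω, s < q := fun h' => lt_irrefl _ (h' s h)
      simp only [h, h3, if_true, if_false, mul_one]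
      have h4 : ContinuousAt (fun w : ℂ => 1 - w / pw ℓ k) (pw ℓ k) := by fun_prop
      have h5 := h4.tendsto
      rw [div_self (pw_ne_zero ℓ k), sub_self] at h5
      exact h5.mono_left nhdsWithin_le_nhds
    · have h3 : (∀ q ∈ Ω, s < q) ↔ ((rank Ω s : ℕ) : ℤ) = 0 := by
        rw [Nat.cast_eq_zero, rank_eq_zero_iff]
        exact forall₂_congr fun q hq => ⟨le_of_lt, fun h' => h'.lt_of_ne fun e => h (e ▸ hq)⟩
      simp only [h, h3, if_false]
      refine tendsto_mul_dfun hℓ r ?_ (by positivity)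
      rw [gap, hk]; ring
  have h3 := h2.mul h1
  rw [ite_mul, zero_mul] at h3
  refine h3.congr fun w => ?_
  rw [pairing, mul_assoc]

theorem vertexOperator_ext {V : Type*} [AddCommGroup V] [Module ℂ V] {A B : VertexOperator ℂ V}
    (h : ∀ (n : ℤ) (v : V) (φ : Module.Dual ℂ V),
      φ (HVertexOperator.coeff A n v) = φ (HVertexOperator.coeff B n v)) : A = B := by
  refine HVertexOperator.coeff_inj (funext fun n => LinearMap.ext fun v => ?_)
  rw [← sub_eq_zero, ← Module.forall_dual_apply_eq_zero_iff ℂ]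
  intro φ
  rw [map_sub, h, sub_self]

theorem coeff_sum_smul {ι V : Type*} [AddCommGroup V] [Module ℂ V] (S : Finset ι) (a : ι → ℂ)
    (A : ι → VertexOperator ℂ V) (n : ℤ) (v : V) :
    HVertexOperator.coeff (∑ i ∈ S, a i • A i) n v =
      ∑ i ∈ S, a i • HVertexOperator.coeff (A i) n v := by
  classical
  induction S using Finset.induction_on with
  | empty => rw [Finset.sum_empty, Finset.sum_empty]; rfl
  | insert i S hi ih => rw [Finset.sum_insert hi, Finset.sum_insert hi, ← ih]; rfl

/-- The fusion relation determines the next current. -/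
theorem eq_explicitCurrent_succ {hℓ : ℓ.re < 0} {hr : 1 < r} {u : Fin N → ℂ}
    {T : ℕ → VertexOperator ℂ (Fock N ℓ r)} (hT : IsWCurrents N hℓ hr u T) {j : ℕ} (hj : 1 ≤ j)
    (h : T j = explicitCurrent hℓ hr u j) : T (j + 1) = explicitCurrent hℓ hr u (j + 1) := by
  set R := Finset.range (2 * N + 1) with hR
  have h0 := pw_ne_zero ℓ 1
  refine vertexOperator_ext fun n v φ => ?_
  have hlim := hT.fusion 1 j le_rfl hj (-1) (Or.inr rfl) v φ n
  have hw : pw ℓ (-(((-1 : ℤ) : ℂ) * (((1 : ℕ) : ℂ) + (j : ℂ)))) = pw ℓ (((j : ℤ) + 1 : ℤ) : ℂ) := by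
    congr 1; push_cast; ring
  have hx : pw ℓ (((-1 : ℤ) : ℂ) * ((1 : ℕ) : ℂ)) = (pw ℓ 1)⁻¹ := by
    rw [← pw_neg]; congr 1; push_cast; ring
  rw [hw, hx, hT.one, basicCurrent_eq, h] at hlim
  have hmem : ∀ p ∈ R ×ˢ R.powersetCard j, p.1 ≤ 2 * N ∧ p.2 ⊆ R ∧ p.2.card = j := by
    intro p hp
    rw [Finset.mem_product, Finset.mem_powersetCard] at hp
    exact ⟨by have := Finset.mem_range.1 hp.1; omega, hp.2⟩
  -- `T_1(z₁) T_j(z₂)` is a sum over pairs of a position and a set of `j` positions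
  have key := HasFusionLimit.eq_sum_normal (S := R ×ˢ R.powersetCard j)
    (a := fun p => (if p.1 = N then middleCoef ℓ r else 1) * coef N ℓ r p.2)
    (E := fun p => current N ℓ r u p.1) (F := fun p => fused N ℓ r u p.2)
    (fun p => current_commutes hℓ hr u p.1) (fun p => fused_commutes hℓ hr u p.2)
    (ρ := fun p => pairing N ℓ r p.1 p.2)
    (L := fun p => if ∀ q ∈ p.2, p.1 < q then cst ℓ r * (if 2 * N - p.1 ∈ p.2 then
        dfun ℓ r (pw ℓ (2 * (rank p.2 (2 * N - p.1) + 1 - ((N : ℤ) - p.1)) : ℤ)) else 1) else 0)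
    (pw_ne_zero ℓ _) ?_ ?_ ?_ ?_ hlim
  · have e1 : ∀ p ∈ R ×ˢ R.powersetCard j,
        ((if p.1 = N then middleCoef ℓ r else 1) * coef N ℓ r p.2) *
        ((if ∀ q ∈ p.2, p.1 < q then cst ℓ r * (if 2 * N - p.1 ∈ p.2 then
          dfun ℓ r (pw ℓ (2 * (rank p.2 (2 * N - p.1) + 1 - ((N : ℤ) - p.1)) : ℤ)) else 1) else 0) *
          φ (HVertexOperator.coeff ((((current N ℓ r u p.1).rescale
            (pw ℓ (((j : ℤ) + 1 : ℤ) : ℂ))⁻¹).normal (fused N ℓ r u p.2)).toVertexOperator ℓ r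
            (((current_commutes hℓ hr u p.1).rescale _).normal
              (fused_commutes hℓ hr u p.2))) n v)) =
        cst ℓ r * (pw ℓ 1)⁻¹ ^ n * (if ∀ q ∈ p.2, p.1 < q then
          coef N ℓ r (insert p.1 p.2) *
            φ (HVertexOperator.coeff (fusedOp hℓ hr u (insert p.1 p.2)) n v) else 0) := by
      intro p hp
      obtain ⟨hp1, hp2, hp3⟩ := hmem p hp
      by_cases hlt : ∀ q ∈ p.2, p.1 < q
      · simp only [if_pos hlt]
        have e2 : (((current N ℓ r u p.1).rescale (pw ℓ (((j : ℤ) + 1 : ℤ) : ℂ))⁻¹).normal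
            (fused N ℓ r u p.2)) = (fused N ℓ r u (insert p.1 p.2)).rescale (pw ℓ 1)⁻¹ := by
          rw [← normal_current_fused u hlt, hp3, pw_intCast]
        rw [toVertexOperator_congr_eq e2 _ ((fused_commutes hℓ hr u _).rescale _),
          coeff_toVertexOperator_rescale _ (fused_commutes hℓ hr u _) (inv_ne_zero h0), map_smul,
          smul_eq_mul, coef_insert hlt hp1, fusedOp]
        ring
      · simp only [if_neg hlt, zero_mul, mul_zero]
    rw [Finset.sum_congr rfl e1, ← Finset.mul_sum,
      sum_powersetCard_succ R j fun Ω =>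
        coef N ℓ r Ω * φ (HVertexOperator.coeff (fusedOp hℓ hr u Ω) n v)] at key
    have e3 : min 1 j - 1 = 0 := by omega
    rw [e3, Finset.Icc_eq_empty (by norm_num), Finset.prod_empty, add_comm 1 j] at key
    have e4 : cst ℓ r * (pw ℓ 1)⁻¹ ^ n ≠ 0 :=
      mul_ne_zero (cst_ne_zero hℓ hr) (zpow_ne_zero _ (inv_ne_zero h0))
    rw [explicitCurrent, coeff_sum_smul, map_sum]
    simp only [map_smul, smul_eq_mul]
    refine mul_left_cancel₀ e4 ?_
    rw [← key]
    push_cast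
    ring
  · intro k l
    rw [explicitCurrent_one_eq_sum, explicitCurrent, coeff_sum_smul, coeff_sum_smul,
      Finset.sum_product]
    refine Finset.sum_congr rfl fun s _ => ?_
    rw [map_sum, Finset.smul_sum]
    refine Finset.sum_congr rfl fun Ω _ => ?_
    rw [map_smul, smul_smul, fusedOp]
  · intro p hp
    obtain ⟨hp1, hp2, hp3⟩ := hmem p hp
    have := convergesTo_pairing hℓ hr u hp1 hp2 (by omega)
    rw [hp3] at this
    exact this.mono fun w hw => hw.2
  · exact fun p _ => meromorphicAt_pairing p.1 p.2
  · intro p hp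
    obtain ⟨hp1, hp2, hp3⟩ := hmem p hp
    have := tendsto_pairing (N := N) (r := r) hℓ p.1 p.2
    rw [hp3] at this
    exact this

theorem explicitCurrent_zero (hℓ : ℓ.re < 0) (hr : 1 < r) (u : Fin N → ℂ) :
    explicitCurrent hℓ hr u 0 = fusedOp hℓ hr u ∅ := by
  rw [explicitCurrent, Finset.powersetCard_zero, Finset.sum_singleton, coef_empty, one_smul]

theorem fusedOp_empty (hℓ : ℓ.re < 0) (hr : 1 < r) (u : Fin N → ℂ) (v : Fock N ℓ r) :
    fusedOp hℓ hr u ∅ v = HahnModule.of ℂ (HahnSeries.single 0 v) := by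
  have h1 : (fused N ℓ r u ∅).creation ℓ r = 1 := by
    rw [VOData.creation, ← expSeries_zero]
    refine expSeries_congr fun m hm => ?_
    simp [fused, hm]
  have h2 : (fused N ℓ r u ∅).annihilation ℓ r (fused_commutes hℓ hr u ∅) = HahnSeries.C := by
    refine RingHom.ext fun v => ?_
    induction v using fock_induction with
    | one => rw [map_one, map_one]
    | add v w hv hw => rw [map_add, map_add, hv, hw]
    | smul c v hv =>
      rw [VOData.annihilation_smul, hv, Algebra.smul_def, map_mul, scal, RingHom.comp_apply]
    | mul p v hv =>
      rw [map_mul, map_mul, hv, VOData.annihilation_gen]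
      simp [fused]
  change HahnModule.of ℂ (scal N ℓ r _ * (HahnSeries.ofPowerSeries ℤ _ _ * _)) = _
  rw [h1, h2]
  simp [fused]

theorem eq_explicitCurrent {hℓ : ℓ.re < 0} {hr : 1 < r} {u : Fin N → ℂ}
    {T : ℕ → VertexOperator ℂ (Fock N ℓ r)} (hT : IsWCurrents N hℓ hr u T) (j : ℕ) :
    T j = explicitCurrent hℓ hr u j := by
  rcases Nat.eq_zero_or_pos j with rfl | hj
  · rw [explicitCurrent_zero]
    exact LinearMap.ext fun v => by rw [hT.zero, fusedOp_empty]
  · induction j, hj using Nat.le_induction with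
    | base => rw [← basicCurrent_eq]; exact hT.one
    | succ j hj ih => exact eq_explicitCurrent_succ hT hj ih

theorem explicitCurrent_eq_zero (hℓ : ℓ.re < 0) (hr : 1 < r) (u : Fin N → ℂ) {j : ℕ}
    (hj : 2 * N + 2 ≤ j) : explicitCurrent hℓ hr u j = 0 := by
  rw [explicitCurrent, Finset.powersetCard_eq_empty.2 (by rw [Finset.card_range]; omega),
    Finset.sum_empty]

end

/-! ### Duality of sets of positions -/

section

variable {N : ℕ} {ℓ : ℂ} {r : ℝ}

/-- The bar image of the complement of `Ω`. -/
def dual (N : ℕ) (Ω : Finset ℕ) : Finset ℕ :=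
  (Finset.range (2 * N + 1)).filter fun q => 2 * N - q ∉ Ω

theorem mem_dual {Ω : Finset ℕ} {q : ℕ} (hq : q ≤ 2 * N) : q ∈ dual N Ω ↔ 2 * N - q ∉ Ω := by
  rw [dual, Finset.mem_filter, Finset.mem_range]
  exact and_iff_right (by omega)

theorem dual_subset (N : ℕ) (Ω : Finset ℕ) : dual N Ω ⊆ Finset.range (2 * N + 1) :=
  Finset.filter_subset _ _

theorem dual_dual {Ω : Finset ℕ} (hΩ : Ω ⊆ Finset.range (2 * N + 1)) :
    dual N (dual N Ω) = Ω := by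
  ext q
  by_cases hq : q ≤ 2 * N
  · have h : 2 * N - (2 * N - q) = q := by omega
    rw [mem_dual hq, mem_dual (by omega), h, not_not]
  · refine iff_of_false (fun h => hq ?_) (fun h => hq ?_)
    · have := Finset.mem_range.1 (dual_subset N _ h); omega
    · have := Finset.mem_range.1 (hΩ h); omega

theorem rank_dual {Ω : Finset ℕ} (hΩ : Ω ⊆ Finset.range (2 * N + 1)) {q : ℕ}
    (hq : q ≤ 2 * N + 1) :
    (rank (dual N Ω) q : ℤ) = q - Ω.card + rank Ω (2 * N + 1 - q) := by
  induction q with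
  | zero =>
    rw [rank_zero, Nat.sub_zero, rank_of_subset_range hΩ]; push_cast; ring
  | succ q ih =>
    have h1 : 2 * N + 1 - q = 2 * N - q + 1 := by omega
    have h2 : 2 * N + 1 - (q + 1) = 2 * N - q := by omega
    have h3 := ih (by omega)
    rw [h1, rank_succ] at h3
    rw [h2, rank_succ]
    simp only [mem_dual (Ω := Ω) (show q ≤ 2 * N by omega)]
    by_cases h : 2 * N - q ∈ Ω
    · rw [if_pos h] at h3
      rw [if_neg (not_not.2 h)]
      push_cast at h3 ⊢
      linarith
    · rw [if_neg h] at h3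
      rw [if_pos h]
      push_cast at h3 ⊢
      linarith

theorem card_dual {Ω : Finset ℕ} (hΩ : Ω ⊆ Finset.range (2 * N + 1)) :
    ((dual N Ω).card : ℤ) = 2 * N + 1 - Ω.card := by
  have h := rank_dual hΩ le_rfl
  rw [rank_of_subset_range (dual_subset N Ω), Nat.sub_self, rank_zero] at h
  rw [h]; push_cast; ring

/-- The shift of the current at `2N - q` in `fused (dual N Ω)`. -/
theorem gap_dual {Ω : Finset ℕ} (hΩ : Ω ⊆ Finset.range (2 * N + 1)) {q : ℕ} (hq : q ≤ 2 * N)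
    (hqΩ : q ∉ Ω) : gap (dual N Ω) (2 * N - q) + 1 = dualGap N Ω q := by
  have h1 : 2 * N + 1 - (2 * N - q) = q + 1 := by omega
  rw [gap, dualGap, gap, card_dual hΩ, rank_dual hΩ (by omega), h1, rank_succ, if_neg hqΩ,
    Nat.cast_sub hq]
  push_cast
  ring

theorem prod_dual {A : Type*} [CommMonoid A] {Ω : Finset ℕ} (f : ℕ → A) :
    ∏ q ∈ dual N Ω, f q = ∏ q ∈ Finset.range (2 * N + 1) \ Ω, f (2 * N - q) := by
  refine Finset.prod_nbij' (fun q => 2 * N - q) (fun q => 2 * N - q) ?_ ?_ ?_ ?_ ?_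
  · intro q hq
    have h := Finset.mem_range.1 (dual_subset N Ω hq)
    rw [mem_dual (by omega)] at hq
    exact Finset.mem_sdiff.2 ⟨Finset.mem_range.2 (by omega), hq⟩
  · intro q hq
    obtain ⟨h1, h2⟩ := Finset.mem_sdiff.1 hq
    rw [Finset.mem_range] at h1
    have h : 2 * N - (2 * N - q) = q := by omega
    rw [mem_dual (by omega), h]
    exact h2
  · intro q hq
    have h := Finset.mem_range.1 (dual_subset N Ω hq)
    change 2 * N - (2 * N - q) = q
    omega
  · intro q hq
    have h := Finset.mem_range.1 (Finset.mem_sdiff.1 hq).1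
    change 2 * N - (2 * N - q) = q
    omega
  · intro q hq
    have h := Finset.mem_range.1 (dual_subset N Ω hq)
    have h' : 2 * N - (2 * N - q) = q := by omega
    rw [h']

theorem sum_dual {A : Type*} [AddCommMonoid A] {Ω : Finset ℕ} (f : ℕ → A) :
    ∑ q ∈ dual N Ω, f q = ∑ q ∈ Finset.range (2 * N + 1) \ Ω, f (2 * N - q) :=
  prod_dual (A := Multiplicative A) f

theorem current_const_mul {u : Fin N → ℂ} (hu : ∀ k, u k ≠ 0) {q : ℕ} (hq : q ≤ 2 * N) :
    (current N ℓ r u q).const * (current N ℓ r u (2 * N - q)).const = 1 := by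
  have h : 2 * N - (2 * N - q) = q := by omega
  rcases lt_trichotomy q N with h1 | h1 | h1
  · have h2 : ¬ 2 * N - q < N := by omega
    simp [current, VOData.dressed, h1, h2, h, lamPlus, lamMinus, hu]
  · subst h1
    have h2 : ¬ 2 * q - q < q := by omega
    simp [current, VOData.dressed, h2, h, lamZero]
  · have h2 : 2 * N - q < N := by omega
    simp [current, VOData.dressed, h1.not_gt, h2, lamPlus, lamMinus, hu]

/-- The constants `u_k` of the currents cancel between bar images. -/
theorem prod_const_range {u : Fin N → ℂ} (hu : ∀ k, u k ≠ 0) :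
    ∏ q ∈ Finset.range (2 * N + 1), (current N ℓ r u q).const = 1 := by
  refine Finset.prod_involution (fun q _ => 2 * N - q) ?_ ?_ ?_ ?_
  · intro q hq
    exact current_const_mul hu (by have := Finset.mem_range.1 hq; omega)
  · intro q hq h h'
    have h2 := Finset.mem_range.1 hq
    have h3 : q = N := by omega
    subst h3
    have h4 : ¬ 2 * q - q < q := by omega
    exact h (by simp [current, VOData.dressed, h4, lamZero])
  · intro q _
    exact Finset.mem_range.2 (by omega)
  · intro q hq
    have := Finset.mem_range.1 hq
    change 2 * N - (2 * N - q) = q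
    omega

/-- The normally ordered products over `Ω` and over its dual are the same operator. -/
theorem fusedOp_dual (hℓ : ℓ.re < 0) (hr : 1 < r) {u : Fin N → ℂ} (hu : ∀ k, u k ≠ 0)
    {Ω : Finset ℕ} (hΩ : Ω ⊆ Finset.range (2 * N + 1)) :
    fusedOp hℓ hr u (dual N Ω) = fusedOp hℓ hr u Ω := by
  have hle : ∀ q ∈ Finset.range (2 * N + 1), q ≤ 2 * N := fun q hq => by
    have := Finset.mem_range.1 hq; omega
  refine toVertexOperator_congr_redCr _ _ ?_ (fun l m hm => ?_) (fun l m hm => ?_)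
  · simp only [fused]
    rw [prod_dual]
    have h1 := Finset.prod_sdiff (f := fun q => (current N ℓ r u q).const) hΩ
    rw [prod_const_range hu] at h1
    have h2 : (∏ q ∈ Finset.range (2 * N + 1) \ Ω, (current N ℓ r u q).const) *
        ∏ q ∈ Finset.range (2 * N + 1) \ Ω, (current N ℓ r u (2 * N - q)).const = 1 := by
      rw [← Finset.prod_mul_distrib]
      exact Finset.prod_eq_one fun q hq => current_const_mul hu (hle q (Finset.mem_sdiff.1 hq).1)
    exact mul_left_cancel₀ (left_ne_zero_of_mul_eq_one h1) (h2.trans h1.symm)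
  · have ht : pw ℓ 1 ^ m ≠ 0 := pow_ne_zero _ (pw_ne_zero _ _)
    have key := sum_crMode_dual ht hΩ l.2
    rw [redCr_fused, redCr_fused, sum_dual,
      Finset.sum_congr rfl fun q hq => by
        rw [gap_dual hΩ (hle q (Finset.mem_sdiff.1 hq).1) (Finset.mem_sdiff.1 hq).2,
          current_redCr hℓ r u (Nat.sub_le _ _) l hm],
      Finset.sum_congr (s₁ := Ω) rfl fun q hq => by
        rw [current_redCr hℓ r u (hle q (hΩ hq)) l hm]]
    simp only [mul_left_comm _ (eta ℓ r m * (av N ℓ l)⁻¹ ^ m)]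
    rw [← Finset.mul_sum, ← Finset.mul_sum, key]
  · have ht : pw ℓ 1 ^ m ≠ 0 := pow_ne_zero _ (pw_ne_zero _ _)
    have hD := one_add_zpow_ne_zero ht (norm_pw_one_pow_lt hℓ hm) (k := -(2 * (N : ℤ) + 1))
      (by omega)
    have key := sum_anMode_dressed_dual ht hD hΩ l.2
    simp only [fused]
    rw [sum_dual,
      Finset.sum_congr rfl fun q hq => by
        rw [gap_dual hΩ (hle q (Finset.mem_sdiff.1 hq).1) (Finset.mem_sdiff.1 hq).2,
          current_an hℓ r u (Nat.sub_le _ _) l hm],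
      Finset.sum_congr (s₁ := Ω) rfl fun q hq => by
        rw [current_an hℓ r u (hle q (hΩ hq)) l hm]]
    simp only [mul_left_comm _ (eta ℓ r m * (pw ℓ 1 ^ m)⁻¹ * (av N ℓ l)⁻¹ ^ m)]
    rw [← Finset.mul_sum, ← Finset.mul_sum, key]

/-! ### Coefficients of dual sets -/

theorem dfun_inv (ℓ : ℂ) (r : ℝ) {z : ℂ} (hz : z ≠ 0) : dfun ℓ r z⁻¹ = dfun ℓ r z := by
  have h : ∀ a b : ℂ, a * b = 1 → (1 - a * z⁻¹) * (1 - b * z⁻¹) =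
      (z⁻¹ * z⁻¹) * ((1 - a * z) * (1 - b * z)) := by
    intro a b hab
    field_simp
    linear_combination (1 - z ^ 2) * hab
  rw [dfun, dfun, h _ _ (by rw [← pw_add, ← Complex.exp_zero, pw]; congr 1; ring),
    h _ _ (by rw [← pw_add, ← Complex.exp_zero, pw]; congr 1; ring),
    mul_div_mul_left _ _ (mul_ne_zero (inv_ne_zero hz) (inv_ne_zero hz))]

theorem dfun_pw_neg (ℓ : ℂ) (r : ℝ) (k : ℤ) :
    dfun ℓ r (pw ℓ ((2 * -k : ℤ) : ℂ)) = dfun ℓ r (pw ℓ ((2 * k : ℤ) : ℂ)) := by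
  rw [← dfun_inv ℓ r (pw_ne_zero ℓ ((2 * k : ℤ) : ℂ)), ← pw_neg]
  congr 2; push_cast; ring

theorem dfun_one (hℓ : ℓ.re < 0) (r : ℝ) : dfun ℓ r 1 = middleCoef ℓ r * middleCoef ℓ r := by
  have h1 := pw_one_sub_ne_zero hℓ
  have hp : pw ℓ (1 / 2) * pw ℓ (1 / 2) = pw ℓ 1 := by rw [← pw_add]; norm_num
  have hy : pw ℓ (r - 1 / 2) * pw ℓ (r - 1 / 2) = pw ℓ (2 * r - 1) := by
    rw [← pw_add]; congr 1; ring
  have hy' : pw ℓ (-2 * r + 1) = (pw ℓ (r - 1 / 2) * pw ℓ (r - 1 / 2))⁻¹ := by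
    rw [hy, ← pw_neg]; congr 1; ring
  have hy0 := pw_ne_zero ℓ (r - 1 / 2)
  have hp0 := pw_ne_zero ℓ (1 / 2)
  rw [dfun, middleCoef, qn, qn, div_div_div_cancel_right₀ h1, hy', ← hy, pw_neg, pw_neg, pw_neg,
    ← hp]
  have e : ∀ y : ℂ, y ≠ 0 →
      (1 - y * y * 1) * (1 - (y * y)⁻¹ * 1) = -((y - y⁻¹) * (y - y⁻¹)) := by
    intro y hy
    field_simp
    ring
  rw [e _ hy0, e _ hp0, neg_div_neg_eq, mul_div_mul_comm]

/-- A position between `q` and `2N - q` lies in `dual N Ω` if its bar image is not in `Ω`. -/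
theorem walk_dual {Ω : Finset ℕ} (hΩ : Ω ⊆ Finset.range (2 * N + 1)) {q : ℕ} (hq : q < N) :
    walk N (dual N Ω) q = -1 - walk N Ω q := by
  have h1 : 2 * N + 1 - (2 * N - q) = q + 1 := by omega
  have h2 : 2 * N + 1 - (q + 1) = 2 * N - q := by omega
  rw [walk, walk, rank_dual hΩ (by omega), rank_dual hΩ (by omega), h1, h2,
    Nat.cast_sub (by omega)]
  push_cast
  ring

/-- The ratio of the coefficients of `dual N Ω` and `Ω`, `|Ω| = N - n`, for which `walk` ends at
`-n - 1`. -/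
noncomputable def ratio (ℓ : ℂ) (r : ℝ) (n : ℕ) : ℂ :=
  middleCoef ℓ r * ∏ k ∈ Finset.Icc 1 n, dfun ℓ r (pw ℓ (2 * k))

theorem ratio_succ (ℓ : ℂ) (r : ℝ) (n : ℕ) :
    ratio ℓ r (n + 1) = ratio ℓ r n * dfun ℓ r (pw ℓ ((2 * ((n : ℤ) + 1) : ℤ) : ℂ)) := by
  rw [ratio, ratio, Finset.prod_Icc_succ_top (by omega), mul_assoc]
  push_cast
  rfl

/-- The relation between a coefficient `c` and its dual `c'` when `walk` has the value `h`.  It is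
written without division, since the values of `d` may vanish. -/
def IsDualPair (ℓ : ℂ) (r : ℝ) (h : ℤ) (c c' : ℂ) : Prop :=
  (∀ n : ℕ, h = n → c = ratio ℓ r n * c') ∧ ∀ n : ℕ, h = -n - 1 → c' = ratio ℓ r n * c

theorem IsDualPair.symm {h : ℤ} {c c' : ℂ} (H : IsDualPair ℓ r h c c') :
    IsDualPair ℓ r (-1 - h) c' c :=
  ⟨fun n hn => H.2 n (by omega), fun n hn => H.1 n (by omega)⟩

/-- One step up of `walk`, with its factor for `c`; the step from `-1` to `0` uses `d(1)`. -/
theorem IsDualPair.succ (hℓ : ℓ.re < 0) {h : ℤ} {c c' : ℂ} (H : IsDualPair ℓ r h c c') :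
    IsDualPair ℓ r (h + 1) (c * dfun ℓ r (pw ℓ ((2 * (h + 1) : ℤ) : ℂ))) c' := by
  refine ⟨fun n hn => ?_, fun n hn => ?_⟩
  · cases n with
    | zero =>
      have h0 : ((2 * (h + 1) : ℤ) : ℂ) = 0 := by rw [hn]; simp
      have h1 : pw ℓ 0 = 1 := by simp [pw]
      have h2 : ratio ℓ r 0 = middleCoef ℓ r := by simp [ratio]
      rw [h0, h1, H.2 0 (by push_cast at hn ⊢; omega), dfun_one hℓ, h2]
      ring
    | succ n =>
      rw [H.1 n (by push_cast at hn; omega), ratio_succ, hn]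
      push_cast
      ring
  · have h1 : h + 1 = -((n : ℤ) + 1) := by omega
    rw [H.2 (n + 1) (by push_cast; omega), ratio_succ, h1, dfun_pw_neg]
    ring

/-- One step down of `walk`, with its factor for `c'`. -/
theorem IsDualPair.pred (hℓ : ℓ.re < 0) {h : ℤ} {c c' : ℂ} (H : IsDualPair ℓ r h c c') :
    IsDualPair ℓ r (h - 1) c (c' * dfun ℓ r (pw ℓ ((2 * (-1 - h + 1) : ℤ) : ℂ))) := by
  have h1 := (H.symm.succ hℓ).symm
  have h2 : -1 - (-1 - h + 1) = h - 1 := by ring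
  rwa [h2] at h1

/-- The partial products of the coefficients, from the middle position outwards up to the pair
`N - M`, `N + M`, are related by the value of `walk` just beyond that pair. -/
theorem isDualPair_coef (hℓ : ℓ.re < 0) {Ω : Finset ℕ}
    (hΩ : Ω ⊆ Finset.range (2 * N + 1)) {M : ℕ} (hM : M ≤ N) :
    IsDualPair ℓ r ((rank Ω (N + M + 1) : ℤ) - rank Ω (N - M) - (M + 1))
      ((if N ∈ Ω then middleCoef ℓ r else 1) *
        ∏ j ∈ Finset.range M, pairFactor N ℓ r Ω (N - 1 - j))
      ((if N ∈ dual N Ω then middleCoef ℓ r else 1) *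
        ∏ j ∈ Finset.range M, pairFactor N ℓ r (dual N Ω) (N - 1 - j)) := by
  induction M with
  | zero =>
    have h1 : 2 * N - N = N := by omega
    have h2 : ratio ℓ r 0 = middleCoef ℓ r := by simp [ratio]
    simp only [mem_dual (Ω := Ω) (show N ≤ 2 * N by omega), h1, Finset.range_zero,
      Finset.prod_empty, mul_one, add_zero, Nat.sub_zero, rank_succ]
    by_cases h : N ∈ Ω
    · simp only [h, if_true, not_true_eq_false, if_false]
      refine ⟨fun n hn => ?_, fun n hn => ?_⟩
      · have : n = 0 := by push_cast at hn; omega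
        subst this
        rw [h2, mul_one]
      · push_cast at hn; omega
    · simp only [h, if_true, not_false_eq_true, if_false]
      refine ⟨fun n hn => ?_, fun n hn => ?_⟩
      · push_cast at hn; omega
      · have : n = 0 := by push_cast at hn; omega
        subst this
        rw [h2, mul_one]
  | succ M ih =>
    have H := ih (by omega)
    set q := N - 1 - M with hq
    have hqN : q < N := by omega
    have h1 : N - M = q + 1 := by omega
    have h2 : N + M + 1 = 2 * N - q := by omega
    have h3 : N - (M + 1) = q := by omega
    have h4 : N + (M + 1) + 1 = 2 * N - q + 1 := by omega
    have hw : walk N Ω q = (rank Ω (2 * N - q) : ℤ) - rank Ω (q + 1) - (M + 1) := by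
      rw [walk]; congr 1; omega
    have hw' := walk_dual hΩ hqN
    have hw'' : (rank Ω (2 * N - q + 1) : ℤ) - rank Ω q - ((M + 1 : ℕ) + 1) =
        walk N Ω q + (if q ∈ Ω then 1 else 0) + (if 2 * N - q ∈ Ω then 1 else 0) - 1 := by
      rw [hw, rank_succ Ω q, rank_succ]
      push_cast
      ring
    rw [h1, h2, ← hw] at H
    rw [Finset.prod_range_succ, Finset.prod_range_succ, ← mul_assoc, ← mul_assoc, h3, h4, hw'',
      ← hq]
    have h5 : 2 * N - (2 * N - q) = q := by omega
    have e1 : pairFactor N ℓ r (dual N Ω) q = if 2 * N - q ∉ Ω ∧ q ∉ Ω then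
        dfun ℓ r (pw ℓ ((2 * (-1 - walk N Ω q + 1) : ℤ) : ℂ)) else 1 := by
      simp only [pairFactor, hw', mem_dual (Ω := Ω) (show q ≤ 2 * N by omega),
        mem_dual (Ω := Ω) (show 2 * N - q ≤ 2 * N by omega), h5]
    rw [e1, pairFactor]
    by_cases ha : q ∈ Ω <;> by_cases hb : 2 * N - q ∈ Ω
    · simp only [ha, hb, not_true_eq_false, and_self, if_true, if_false, mul_one,
        add_sub_cancel_right]
      exact H.succ hℓ
    · simpa [ha, hb] using H
    · simpa [ha, hb] using H
    · simp only [ha, hb, not_false_eq_true, and_self, if_true, if_false, mul_one, add_zero]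
      exact H.pred hℓ

theorem coef_dual (hℓ : ℓ.re < 0) {Ω : Finset ℕ} (hΩ : Ω ⊆ Finset.range (2 * N + 1))
    (hc : Ω.card ≤ N) : coef N ℓ r (dual N Ω) = ratio ℓ r (N - Ω.card) * coef N ℓ r Ω := by
  have h := (isDualPair_coef (r := r) hℓ hΩ le_rfl).2 (N - Ω.card) (by
    have h1 : N + N + 1 = 2 * N + 1 := by ring
    rw [h1, rank_of_subset_range hΩ, Nat.sub_self, rank_zero]
    push_cast [hc]
    ring)
  simp only [Finset.prod_range_reflect] at h
  exact h

/-- Duality exchanges the terms of the currents of degrees `i` and `2N + 1 - i`. -/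
theorem explicitCurrent_dual (hℓ : ℓ.re < 0) (hr : 1 < r) {u : Fin N → ℂ} (hu : ∀ k, u k ≠ 0)
    {i : ℕ} (hi : i ≤ N) : explicitCurrent hℓ hr u (2 * N + 1 - i) =
      ratio ℓ r (N - i) • explicitCurrent hℓ hr u i := by
  rw [explicitCurrent, explicitCurrent, Finset.smul_sum]
  refine Finset.sum_nbij' (dual N) (dual N) ?_ ?_ ?_ ?_ ?_
  · intro Ω hΩ
    rw [Finset.mem_powersetCard] at hΩ ⊢
    have := card_dual hΩ.1
    exact ⟨dual_subset N Ω, by omega⟩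
  · intro Ω hΩ
    rw [Finset.mem_powersetCard] at hΩ ⊢
    have := card_dual hΩ.1
    exact ⟨dual_subset N Ω, by omega⟩
  · exact fun Ω hΩ => dual_dual (Finset.mem_powersetCard.1 hΩ).1
  · exact fun Ω hΩ => dual_dual (Finset.mem_powersetCard.1 hΩ).1
  · intro Ω hΩ
    rw [Finset.mem_powersetCard] at hΩ
    have h1 := card_dual hΩ.1
    have h2 := coef_dual (r := r) hℓ (dual_subset N Ω) (by omega)
    have h3 : N - (dual N Ω).card = N - i := by omega
    rw [dual_dual hΩ.1, h3] at h2
    rw [h2, mul_smul, fusedOp_dual hℓ hr hu hΩ.1]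

end

end DeformedW

theorem proposition1 (N : ℕ) (hN : 1 ≤ N) (ℓ : ℂ) (hℓ : ℓ.re < 0) (r : ℝ) (hr : 1 < r)
    (u : Fin N → ℂ) (hu : ∀ k, u k ≠ 0)
    (T : ℕ → VertexOperator ℂ (DeformedW.Fock N ℓ r))
    (hT : DeformedW.IsWCurrents N hℓ hr u T) :
    (∀ i ≤ N, T (2 * N + 1 - i) =
      (DeformedW.qn ℓ (r - 1 / 2) / DeformedW.qn ℓ (1 / 2) *
        ∏ k ∈ Finset.Icc 1 (N - i), DeformedW.dfun ℓ r (DeformedW.pw ℓ (2 * k))) • T i) ∧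
    (∀ i, 2 * N + 2 ≤ i → T i = 0) := by
  refine ⟨fun i hi => ?_, fun i hi => ?_⟩
  · rw [DeformedW.eq_explicitCurrent hT, DeformedW.eq_explicitCurrent hT,
      DeformedW.explicitCurrent_dual hℓ hr hu hi]
    rfl
  · rw [DeformedW.eq_explicitCurrent hT, DeformedW.explicitCurrent_eq_zero hℓ hr u hi]
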